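/- Setting. Let $\mathcal S$ be a set of states, $\mathcal A=(\mathcal A_1,\dots,\mathcal A_{|\mathcal A|})$ a finite nonempty ordered set of actions, and $\gamma\in(0,1)$ a discount factor. A planner has access to a simulator, which on a call at $(s,a)\in\mathcal S\times\mathcal A$ returns a (random) next state and a reward, and to a feature map $\phi:\mathcal S\times\mathcal A\to\mathbb R^d$ ($d\ge1$) with $\|\phi(s,a)\|_2\le L$, whose values it can read only at states that it has encountered (local access). Let $B>0$, $\omega>0$, $\delta\in(0,1]$, $s_0\in\mathcal S$, and $$\lambda=\tfrac{\omega^2}{B^2},\quad H=\max\Big\{0,\Big\lceil\tfrac{\log((\omega/4)(1-\gamma))}{\log\gamma}\Big\rceil\Big\},\quad \tilde d=4d\log\Big(1+\tfrac{4L^2}{\lambda}\Big),\quad \zeta=\tfrac{\delta}{\tilde dH},\quad n=\Big\lceil\tfrac{(\omega/4)^{-2}(1-\gamma)^{-2}\log(2/\zeta)}{2}\Big\rceil .$$ For a finite sequence $C$ of state-action pairs let $V(C)=\lambda I+\sum_{(s,a)\in C}\phi(s,a)\phi(s,a)^\top$, $\mathrm{ActionCover}(C)=\{(s,a):\phi(s,a)^\top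 V(C)^{-1}\phi(s,a)\le1\}$ and $\mathrm{Cover}(C)=\{s:(s,a)\in\mathrm{ActionCover}(C)\ \forall a\in\mathcal A\}$. $\textsc{Measure}(s,a,\pi,\mathcal S')$ makes $n$ rollouts. Each calls the simulator at $(s,a)$, and then, for $h=1,\dots,H-1$, if the current state $S$ is not in $\mathcal S'$ it ends the whole measurement with the result (discover, $S$), and otherwise it calls the simulator at $(S,\pi(S))$. If no rollout ends in this way, the result is (success, $q$), where $q$ is the average over the rollouts of $\sum_{h=0}^{H-1}\gamma^hR_h$, and $R_0,\dots,R_{H-1}$ are the rewards received in the rollout. The algorithm CAPI-Qpi-Plan keeps, for each level $l=0,\dots,H$, sequences $C_l$ and $\bar q_l$ of equal length (initially empty; the entries of $\bar q_l$ are reals or $\bot$) and a policy $\pi_l:\mathcal S\to\mathcal A$ (initially constant $\mathcal A_1$), and iterates the following. 1. If some $(s_0,a)\notin\mathrm{ActionCover}(C_0)$, append $(s_0,a)$ to $C_0$ and $\bot$ to $\bar q_0$, and go to the next iteration. 2. Let $\ell$ be the smallest level such that $\bar q_\ell$ contains $\bot$, and $\ell=H$ if there is none. If $\ell=H$, return $\pi_H$.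 3. Pick an index $m$ with $\bar q_{\ell,m}=\bot$ and call $\textsc{Measure}(C_{\ell,m},\pi_\ell,\mathrm{Cover}(C_\ell))$. If the result is (discover, $s$), append some $(s,a)\notin\mathrm{ActionCover}(C_0)$ to $C_0$ and $\bot$ to $\bar q_0$, and go to the next iteration. If it is (success, $q$), set $\bar q_{\ell,m}=q$. 4. If $\bar q_\ell$ now contains no $\bot$, let $\theta=V(C_\ell)^{-1}\sum_i\phi(C_{\ell,i})\bar q_{\ell,i}$ and $\hat q(s,a)=\langle\phi(s,a),\theta\rangle$. Let $\pi'(s)=\arg\max_a\hat q(s,a)$ (lowest index) if $s\in\mathrm{Cover}(C_\ell)$ and $\hat q(s,\pi_\ell(s))+\omega<\max_a\hat q(s,a)-\omega$, and $\pi'(s)=\pi_\ell(s)$ otherwise. Replace $\pi_{\ell+1}(s)$ by $\pi'(s)$ for all $s\notin\mathrm{Cover}(C_{\ell+1})$; then append to $C_{\ell+1}$ all members of $C_\ell$ that are not in it, and as many $\bot$ to $\bar q_{\ell+1}$. Costs are those of a real random access machine: it has memory cells for reals, for natural numbers and for states, arithmetic operations, logarithms, comparisons, memory accesses, simulator calls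 and readings of one coordinate of a feature vector have unit cost, and states can only be copied, passed to the simulator, or have their features read. $\tilde{\mathcal O}(f)$ means at most $c\,f\,\log^k(3+d+\frac1{1-\gamma}+\frac1\omega+\frac1\delta+L+B)$ with absolute constants $c,k$. Theorem 2. There is an implementation of CAPI-Qpi-Plan (one fixed program, independent of the problem and of the parameters, together with one fixed program that evaluates stored policies) such that for all parameters as above and for all possible answers of the simulator the algorithm terminates and: - running it takes $\tilde{\mathcal O}\big(d^2/(1-\gamma)\big)$ memory and $\tilde{\mathcal O}\big(d^4|\mathcal A|(1-\gamma)^{-5}\max\{\omega^{-2},(1-\gamma)^2\}\big)$ computation (which is $\tilde{\mathcal O}(d^4|\mathcal A|(1-\gamma)^{-5}\omega^{-2})$ for $\omega\le1/(1-\gamma)$); - storing the returned policy $\pi$ takes $\tilde{\mathcal O}\big(d^2/(1-\gamma)\big)$ memory; - evaluating the stored policy at any state $s\in\mathcal S$, that is, computing $\pi(s)$, takes $\tilde{\mathcal O}\big(d^3|\mathcal A|/(1-\gamma)\big)$ computation and $\tilde{\mathcal O}\big(d^2/(1-\gamma)\big)$ memory, and no simulator calls. -/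

import Mathlib

open scoped Matrix

namespace CAPI

/-! ### The planner, as a mathematical algorithm

States form an arbitrary type `S`, the ordered finite action set is `Fin K` (its first element is
`0`), and features have dimension `d`. -/

/-- Numerical parameters: discount factor `γ`, accuracy `ω`, failure probability `δ`, bound `L` on
the Euclidean norm of the features, and bound `B` on the norm of the parameter vectors. -/
structure Params where
  γ : ℝ
  ω : ℝ
  δ : ℝ
  L : ℝ
  B : ℝ

/-- What a planner can access: the features of state-action pairs, and a simulator.
`simulate k s a` is the answer (next state, reward) to the call number `k`, if this call is made at
`(s, a)`. A theorem about all possible `simulate` is a theorem about all possible outcomes of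
the random simulator of every Markov decision process with state space `S` and actions `Fin K`. -/
structure Access (S : Type*) (d K : ℕ) where
  feature : S → Fin K → Fin d → ℝ
  simulate : ℕ → S → Fin K → S × ℝ

section Planner

variable {S : Type*} {d K : ℕ}

/-- Regularization parameter `λ = ω² / B²`. -/
noncomputable def Params.lam (p : Params) : ℝ := p.ω ^ 2 / p.B ^ 2

/-- Effective horizon `H = ⌈log ((ω/4)(1-γ)) / log γ⌉` (zero if this number is negative). -/
noncomputable def Params.horizon (p : Params) : ℕ :=
  ⌈Real.log ((p.ω / 4) * (1 - p.γ)) / Real.log p.γ⌉₊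

/-- The bound `d̃ = 4 d log (1 + 4 L² / λ)` on the size of the core sets. -/
noncomputable def Params.dTilde (p : Params) (d : ℕ) : ℝ :=
  4 * d * Real.log (1 + 4 * p.L ^ 2 / p.lam)

/-- Failure probability `ζ = δ / (d̃ H)` of a single measurement. -/
noncomputable def Params.zeta (p : Params) (d : ℕ) : ℝ :=
  p.δ / (p.dTilde d * p.horizon)

/-- Number of rollouts `⌈(ω/4)⁻² (1-γ)⁻² log (2/ζ) / 2⌉` of a single measurement. -/
noncomputable def Params.rollouts (p : Params) (d : ℕ) : ℕ :=
  ⌈((p.ω / 4) ^ 2)⁻¹ * ((1 - p.γ) ^ 2)⁻¹ * Real.log (2 / p.zeta d) / 2⌉₊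

/-- `V(C) = λ I + ∑ φ(s,a) φ(s,a)ᵀ`, the sum being over the sequence `C`. -/
noncomputable def covMatrix (p : Params) (φ : S → Fin K → Fin d → ℝ) (C : List (S × Fin K)) :
    Matrix (Fin d) (Fin d) ℝ :=
  p.lam • (1 : Matrix (Fin d) (Fin d) ℝ) +
    (C.map fun sa => Matrix.vecMulVec (φ sa.1 sa.2) (φ sa.1 sa.2)).sum

/-- `‖x‖_V = √(xᵀ V x)`. -/
noncomputable def ellNorm (V : Matrix (Fin d) (Fin d) ℝ) (x : Fin d → ℝ) : ℝ :=
  Real.sqrt (x ⬝ᵥ (V *ᵥ x))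

/-- State-action pairs covered by `C`. -/
def actionCover (p : Params) (φ : S → Fin K → Fin d → ℝ) (C : List (S × Fin K)) :
    Set (S × Fin K) :=
  {sa | ellNorm (covMatrix p φ C)⁻¹ (φ sa.1 sa.2) ≤ 1}

/-- States all of whose actions are covered by `C`. -/
def cover (p : Params) (φ : S → Fin K → Fin d → ℝ) (C : List (S × Fin K)) : Set S :=
  {s | ∀ a, (s, a) ∈ actionCover p φ C}

/-- The regularized least-squares estimator
`⟨φ(s,a), V(C)⁻¹ ∑ᵢ φ(sᵢ,aᵢ) q̄ᵢ⟩`. It is only used when no entry of `qbar` is `none`. -/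
noncomputable def lse (p : Params) (φ : S → Fin K → Fin d → ℝ) (C : List (S × Fin K))
    (qbar : List (Option ℝ)) (s : S) (a : Fin K) : ℝ :=
  φ s a ⬝ᵥ ((covMatrix p φ C)⁻¹ *ᵥ
    ((C.zip qbar).map fun x => (x.2.getD 0) • φ x.1.1 x.1.2).sum)

open Classical in
/-- The first action with property `P`, if there is one. -/
noncomputable def firstAction (P : Fin K → Prop) : Option (Fin K) :=
  (List.finRange K).find? fun a => decide (P a)

/-- The maximizer of `f` of lowest index. -/
noncomputable def argmaxFirst [NeZero K] (f : Fin K → ℝ) : Fin K :=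
  (firstAction fun a => ∀ b, f b ≤ f a).getD 0

open Classical in
/-- The confident policy update `π_{q̂, π, S_fix}`: act greedily with respect to `q` in the states
outside `fixed` where this is confidently an improvement, and like `π` elsewhere. -/
noncomputable def capiUpdate [NeZero K] (ω : ℝ) (q : S → Fin K → ℝ) (π : S → Fin K)
    (fixed : Set S) : S → Fin K := fun s =>
  if s ∉ fixed ∧ q s (π s) + ω < Finset.univ.sup' Finset.univ_nonempty (q s) - ω then
    argmaxFirst (q s)
  else π s

/-- Result of a measurement. -/
inductive Outcome (S : Type*) where
  | discover (s : S)
  | success (q : ℝ)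

open Classical in
/-- The inner loop of a measurement: `m` iterations are left, the next one has number `h`, the
current state is `x`, the discounted reward collected in this rollout is `g`, and `tr` lists all
simulator calls made so far. -/
noncomputable def rollout (p : Params) (acc : Access S d K) (π : S → Fin K) (S' : Set S) :
    ℕ → ℕ → S → ℝ → List (S × Fin K) → Outcome S × List (S × Fin K)
  | 0, _, _, g, tr => (.success g, tr)
  | m + 1, h, x, g, tr =>
    if x ∈ S' then
      let y := acc.simulate tr.length x (π x)
      rollout p acc π S' m (h + 1) y.1 (g + p.γ ^ h * y.2) (tr ++ [(x, π x)])
    else (.discover x, tr)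

/-- The outer loop of a measurement at `(s, a)`: `i` rollouts are left, and `g` is the sum of the
discounted rewards of the completed ones. -/
noncomputable def episodes (p : Params) (acc : Access S d K) (s : S) (a : Fin K) (π : S → Fin K)
    (S' : Set S) : ℕ → ℝ → List (S × Fin K) → Outcome S × List (S × Fin K)
  | 0, g, tr => (.success g, tr)
  | i + 1, g, tr =>
    let y := acc.simulate tr.length s a
    match rollout p acc π S' (p.horizon - 1) 1 y.1 y.2 (tr ++ [(s, a)]) with
    | (.discover x, tr') => (.discover x, tr')
    | (.success g', tr') => episodes p acc s a π S' i (g + g') tr'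

/-- The subroutine Measure, with the failure probability that the planner passes to it. -/
noncomputable def measure (p : Params) (acc : Access S d K) (s : S) (a : Fin K) (π : S → Fin K)
    (S' : Set S) (tr : List (S × Fin K)) : Outcome S × List (S × Fin K) :=
  match episodes p acc s a π S' (p.rollouts d) 0 tr with
  | (.discover x, tr') => (.discover x, tr')
  | (.success g, tr') => (.success (g / p.rollouts d), tr')

/-- The variables of the planner, for the levels `l = 0, …, H` (larger `l` are not used): core
sequences `C l`, estimates `qbar l` (`none` stands for `⊥`), policies `pol l`; and the list of all
simulator calls so far. -/
structure PlanState (S : Type*) (K : ℕ) where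
  C : ℕ → List (S × Fin K)
  qbar : ℕ → List (Option ℝ)
  pol : ℕ → S → Fin K
  trace : List (S × Fin K)

/-- Initial values of the variables. -/
def PlanState.initial (S : Type*) (K : ℕ) [NeZero K] : PlanState S K where
  C := fun _ => []
  qbar := fun _ => []
  pol := fun _ _ => 0
  trace := []

/-- Append the pairs in `new` to `C l`, and as many `⊥` to `qbar l`. -/
def PlanState.append (x : PlanState S K) (l : ℕ) (new : List (S × Fin K)) : PlanState S K :=
  { x with
    C := Function.update x.C l (x.C l ++ new)
    qbar := Function.update x.qbar l (x.qbar l ++ List.replicate new.length none) }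

open Classical in
/-- The smallest level with a missing estimate, and `H` if there is none. -/
noncomputable def PlanState.lmin (x : PlanState S K) (H : ℕ) : ℕ :=
  ((List.range H).find? fun l => decide (none ∈ x.qbar l)).getD H

open Classical in
/-- Policy update at level `l`, merging of the new policy into level `l + 1`, and propagation of
the core pairs to level `l + 1`. -/
noncomputable def PlanState.improve [NeZero K] (p : Params) (acc : Access S d K)
    (x : PlanState S K) (l : ℕ) : PlanState S K :=
  let q := lse p acc.feature (x.C l) (x.qbar l)
  let π' := capiUpdate p.ω q (x.pol l) (cover p acc.feature (x.C l))ᶜ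
  let merged : S → Fin K := fun s =>
    if s ∈ cover p acc.feature (x.C (l + 1)) then x.pol (l + 1) s else π' s
  PlanState.append { x with pol := Function.update x.pol (l + 1) merged } (l + 1)
    ((x.C l).filter fun sa => decide (sa ∉ x.C (l + 1)))

open Classical in
/-- One iteration of the main loop of CAPI-Qpi-Plan; `none` means that the planner returns. Where
the choice of an action or of a missing estimate is free, the first one is taken. (The default
values of `getD` are never used, as `C l` and `qbar l` have the same length, and a discovered
state has an action that is not covered by `C 0`.) -/
noncomputable def planStep [NeZero K] (p : Params) (acc : Access S d K) (s₀ : S)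
    (x : PlanState S K) : Option (PlanState S K) :=
  match firstAction fun a => (s₀, a) ∉ actionCover p acc.feature (x.C 0) with
  | some a => some (x.append 0 [(s₀, a)])
  | none =>
    let l := x.lmin p.horizon
    if l = p.horizon then none
    else
      let m := (x.qbar l).findIdx Option.isNone
      let sa := (x.C l).getD m (s₀, 0)
      match measure p acc sa.1 sa.2 (x.pol l) (cover p acc.feature (x.C l)) x.trace with
      | (.discover s', tr) =>
        let a := (firstAction fun a => (s', a) ∉ actionCover p acc.feature (x.C 0)).getD 0
        some (PlanState.append { x with trace := tr } 0 [(s', a)])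
      | (.success r, tr) =>
        let x' : PlanState S K :=
          { x with qbar := Function.update x.qbar l ((x.qbar l).set m (some r)), trace := tr }
        if none ∈ x'.qbar l then some x' else some (x'.improve p acc l)

/-- CAPI-Qpi-Plan, started from `s₀`, terminates and returns the policy `π`, after the sequence
`tr` of simulator calls. -/
def PlanReturns [NeZero K] (p : Params) (acc : Access S d K) (s₀ : S) (π : S → Fin K)
    (tr : List (S × Fin K)) : Prop :=
  ∃ x : PlanState S K,
    Relation.ReflTransGen (fun y z => planStep p acc s₀ y = some z) (PlanState.initial S K) x ∧
    planStep p acc s₀ x = none ∧ x.pol p.horizon = π ∧ x.trace = tr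

end Planner

/-! ### The machine model

A real random access machine with unit-cost operations, programmed in a structured language. It
has finitely many registers (those mentioned in the program) and `M` memory cells of each of
three kinds: indices (natural numbers), real numbers, and states. States are opaque: they can be
copied, given to the simulator, and their features can be read, one coordinate at a time. So
only features of states that have been encountered are accessible. -/

/-- Index expressions over the index registers. -/
inductive IExp where
  | const (n : ℕ)
  | reg (i : ℕ)
  | plus (a b : IExp)
  | minus (a b : IExp)
  | times (a b : IExp)

/-- Real expressions over the registers. -/
inductive RExp where
  | ofIdx (e : IExp)
  | reg (i : ℕ)
  | plus (a b : RExp)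
  | minus (a b : RExp)
  | times (a b : RExp)
  | quot (a b : RExp)
  | log (a : RExp)

/-- Tests. -/
inductive Test where
  | ltIdx (a b : IExp)
  | leReal (a b : RExp)
  | neg (a : Test)
  | conj (a b : Test)

/-- Programs. Addresses, actions and coordinates are given by index expressions; the other
arguments `x`, `y`, `z` are numbers of registers. -/
inductive Cmd where
  | skip
  | setIdx (x : ℕ) (e : IExp)
  | setReal (x : ℕ) (e : RExp)
  | setState (x y : ℕ)
  | loadIdx (x : ℕ) (addr : IExp)
  | loadReal (x : ℕ) (addr : IExp)
  | loadState (x : ℕ) (addr : IExp)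
  | storeIdx (addr : IExp) (e : IExp)
  | storeReal (addr : IExp) (e : RExp)
  | storeState (addr : IExp) (y : ℕ)
  | feature (x y : ℕ) (act coord : IExp)
  | simulate (x y z : ℕ) (act : IExp)
  | seq (c₁ c₂ : Cmd)
  | ite (b : Test) (c₁ c₂ : Cmd)
  | loop (b : Test) (c : Cmd)

/-- Contents of the registers and of the memory, and the list of simulator calls so far. -/
structure Store (S : Type*) (K : ℕ) where
  idx : ℕ → ℕ
  real : ℕ → ℝ
  state : ℕ → S
  idxMem : ℕ → ℕ
  realMem : ℕ → ℝ
  stateMem : ℕ → S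
  trace : List (S × Fin K)

section Semantics

variable {S : Type*} {d K : ℕ}

/-- Value of an index expression (subtraction is truncated at zero). -/
def IExp.value (σ : Store S K) : IExp → ℕ
  | const n => n
  | reg i => σ.idx i
  | plus a b => a.value σ + b.value σ
  | minus a b => a.value σ - b.value σ
  | times a b => a.value σ * b.value σ

/-- Number of operations in an index expression. -/
def IExp.cost : IExp → ℕ
  | const _ => 1
  | reg _ => 1
  | plus a b => a.cost + b.cost + 1
  | minus a b => a.cost + b.cost + 1
  | times a b => a.cost + b.cost + 1

/-- Value of a real expression. -/
noncomputable def RExp.value (σ : Store S K) : RExp → ℝ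
  | ofIdx e => (e.value σ : ℝ)
  | reg i => σ.real i
  | plus a b => a.value σ + b.value σ
  | minus a b => a.value σ - b.value σ
  | times a b => a.value σ * b.value σ
  | quot a b => a.value σ / b.value σ
  | log a => Real.log (a.value σ)

/-- Number of operations in a real expression. -/
def RExp.cost : RExp → ℕ
  | ofIdx e => e.cost + 1
  | reg _ => 1
  | plus a b => a.cost + b.cost + 1
  | minus a b => a.cost + b.cost + 1
  | times a b => a.cost + b.cost + 1
  | quot a b => a.cost + b.cost + 1
  | log a => a.cost + 1

/-- Truth of a test. -/
def Test.Holds (σ : Store S K) : Test → Prop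
  | ltIdx a b => a.value σ < b.value σ
  | leReal a b => a.value σ ≤ b.value σ
  | neg a => ¬ a.Holds σ
  | conj a b => a.Holds σ ∧ b.Holds σ

/-- Number of operations in a test. -/
def Test.cost : Test → ℕ
  | ltIdx a b => a.cost + b.cost + 1
  | leReal a b => a.cost + b.cost + 1
  | neg a => a.cost + 1
  | conj a b => a.cost + b.cost + 1

/-- `Exec acc M c σ σ' t`: on a machine with `M` memory cells of each kind, the program `c`,
started in `σ`, terminates in `σ'` after `t` elementary operations. Every access to the memory has
to be at an address smaller than `M`. -/
inductive Exec (acc : Access S d K) (M : ℕ) : Cmd → Store S K → Store S K → ℕ → Prop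
  | skip (σ : Store S K) : Exec acc M .skip σ σ 1
  | setIdx (σ : Store S K) (x : ℕ) (e : IExp) :
      Exec acc M (.setIdx x e) σ { σ with idx := Function.update σ.idx x (e.value σ) }
        (e.cost + 1)
  | setReal (σ : Store S K) (x : ℕ) (e : RExp) :
      Exec acc M (.setReal x e) σ { σ with real := Function.update σ.real x (e.value σ) }
        (e.cost + 1)
  | setState (σ : Store S K) (x y : ℕ) :
      Exec acc M (.setState x y) σ { σ with state := Function.update σ.state x (σ.state y) } 1
  | loadIdx (σ : Store S K) (x : ℕ) (addr : IExp) (h : addr.value σ < M) :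
      Exec acc M (.loadIdx x addr) σ
        { σ with idx := Function.update σ.idx x (σ.idxMem (addr.value σ)) } (addr.cost + 1)
  | loadReal (σ : Store S K) (x : ℕ) (addr : IExp) (h : addr.value σ < M) :
      Exec acc M (.loadReal x addr) σ
        { σ with real := Function.update σ.real x (σ.realMem (addr.value σ)) } (addr.cost + 1)
  | loadState (σ : Store S K) (x : ℕ) (addr : IExp) (h : addr.value σ < M) :
      Exec acc M (.loadState x addr) σ
        { σ with state := Function.update σ.state x (σ.stateMem (addr.value σ)) } (addr.cost + 1)
  | storeIdx (σ : Store S K) (addr : IExp) (e : IExp) (h : addr.value σ < M) :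
      Exec acc M (.storeIdx addr e) σ
        { σ with idxMem := Function.update σ.idxMem (addr.value σ) (e.value σ) }
        (addr.cost + e.cost + 1)
  | storeReal (σ : Store S K) (addr : IExp) (e : RExp) (h : addr.value σ < M) :
      Exec acc M (.storeReal addr e) σ
        { σ with realMem := Function.update σ.realMem (addr.value σ) (e.value σ) }
        (addr.cost + e.cost + 1)
  | storeState (σ : Store S K) (addr : IExp) (y : ℕ) (h : addr.value σ < M) :
      Exec acc M (.storeState addr y) σ
        { σ with stateMem := Function.update σ.stateMem (addr.value σ) (σ.state y) }
        (addr.cost + 1)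
  | feature (σ : Store S K) (x y : ℕ) (act coord : IExp)
      (ha : act.value σ < K) (hj : coord.value σ < d) :
      Exec acc M (.feature x y act coord) σ
        { σ with
          real := Function.update σ.real x
            (acc.feature (σ.state y) ⟨act.value σ, ha⟩ ⟨coord.value σ, hj⟩) }
        (act.cost + coord.cost + 1)
  | simulate (σ : Store S K) (x y z : ℕ) (act : IExp) (ha : act.value σ < K) :
      Exec acc M (.simulate x y z act) σ
        { σ with
          real := Function.update σ.real x
            (acc.simulate σ.trace.length (σ.state z) ⟨act.value σ, ha⟩).2
          state := Function.update σ.state y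
            (acc.simulate σ.trace.length (σ.state z) ⟨act.value σ, ha⟩).1
          trace := σ.trace ++ [(σ.state z, ⟨act.value σ, ha⟩)] }
        (act.cost + 1)
  | seq {c₁ c₂ : Cmd} {σ₁ σ₂ σ₃ : Store S K} {t₁ t₂ : ℕ}
      (h₁ : Exec acc M c₁ σ₁ σ₂ t₁) (h₂ : Exec acc M c₂ σ₂ σ₃ t₂) :
      Exec acc M (.seq c₁ c₂) σ₁ σ₃ (t₁ + t₂)
  | iteTrue {b : Test} {c₁ c₂ : Cmd} {σ σ' : Store S K} {t : ℕ} (hb : b.Holds σ)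
      (h : Exec acc M c₁ σ σ' t) : Exec acc M (.ite b c₁ c₂) σ σ' (b.cost + t)
  | iteFalse {b : Test} {c₁ c₂ : Cmd} {σ σ' : Store S K} {t : ℕ} (hb : ¬ b.Holds σ)
      (h : Exec acc M c₂ σ σ' t) : Exec acc M (.ite b c₁ c₂) σ σ' (b.cost + t)
  | loopTrue {b : Test} {c : Cmd} {σ₁ σ₂ σ₃ : Store S K} {t₁ t₂ : ℕ} (hb : b.Holds σ₁)
      (h₁ : Exec acc M c σ₁ σ₂ t₁) (h₂ : Exec acc M (.loop b c) σ₂ σ₃ t₂) :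
      Exec acc M (.loop b c) σ₁ σ₃ (b.cost + t₁ + t₂)
  | loopFalse {b : Test} {c : Cmd} {σ : Store S K} (hb : ¬ b.Holds σ) :
      Exec acc M (.loop b c) σ σ b.cost

/-- Start of the planner: the input is in the first registers, everything else is blank. -/
def Store.planInput (d K : ℕ) (p : Params) (s₀ : S) : Store S K where
  idx := fun i => if i = 0 then d else if i = 1 then K else 0
  real := fun i => if i = 0 then p.γ else if i = 1 then p.ω else if i = 2 then p.δ
    else if i = 3 then p.L else if i = 4 then p.B else 0
  state := fun _ => s₀
  idxMem := fun _ => 0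
  realMem := fun _ => 0
  stateMem := fun _ => s₀
  trace := []

/-- Start of the evaluation of a stored policy in the state `s`. All that is kept of the store `σ`
are its first `M` index cells and its first `M` real cells. -/
def Store.policyInput (σ : Store S K) (M : ℕ) (s : S) : Store S K where
  idx := fun _ => 0
  real := fun _ => 0
  state := fun _ => s
  idxMem := fun i => if i < M then σ.idxMem i else 0
  realMem := fun i => if i < M then σ.realMem i else 0
  stateMem := fun _ => s
  trace := []

end Semantics

/-- The logarithm of which powers are hidden in the notation `Õ`. -/
noncomputable def Params.logFactor (p : Params) (d : ℕ) : ℝ :=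
  Real.log (3 + d + 1 / (1 - p.γ) + 1 / p.ω + 1 / p.δ + p.L + p.B)

end CAPI

/-! Taken literally, the planner handles H + 1 core sequences and policies that are functions on the
whole state space, each defined through the previous ones. The theorem holds because a small amount
of data determines all of this.

New pairs enter only the core sequence of level 0, and propagation copies a whole level to the next
one, so all core sequences are prefixes of a single one. Between iterations, every level below H
without missing estimates has been propagated. So the level that is picked for a measurement sees
the whole sequence (`Ledger.Settled.len_eq`). A policy is never changed in a state that its level
already covers. Hence the action of a level in a covered state `s` depends only on `s` and on its
rank, the least length of a prefix that covers it: starting from action 0, it results from one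
confident improvement per lower level, with the least-squares coefficients in force when the prefix
of that length reached the next level. One vector for each level and each position of the core
sequence therefore describes all policies. This is the `Ledger`; `Track` says that it describes the
variables of the planner, and `Track.improve` is the main step.

Finding a rank requires the values yᵀV⁻¹y for all prefixes. By the Sherman–Morrison formula, each
pair subtracts (yᵀu)²/D, where u = V⁻¹φ and D = 1 + φᵀV⁻¹φ are taken at the preceding prefix. With
all u and D stored, one pass over N pairs costs O(Nd) operations per action and settles coverage by
every prefix; the same u and D drive recursive least squares. A step of a rollout, or the evaluation
of the stored policy, thus costs O((N + H)|A|d), with O(NHd) memory.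

It remains to bound the sizes. A pair is appended only if it is not covered, so it more than doubles
det V, whereas det V ≤ (tr V)^d; this makes N of order d up to logarithms (`Fresh.pow_length_le`,
`length_le_coreBound`). Each iteration before the last adds a pair or an estimate, so there are at
most N(H + 1) of them (`Ledger.Chain.progress_le`), each with at most n rollouts of H steps. With H
of order 1/(1-γ) and n of order 1 + (1-γ)⁻²ω⁻², up to logarithms, the products stay within the
claimed bounds, even with a factor d to spare in both computation bounds.

On the machine side, `Runs` is total correctness with a time bound, `PlannerMem` fixes how a store
represents a ledger, and `iterationCmd_runs` matches one pass of the program with one step of the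
planner. -/

namespace CAPI

/-! ### Reasoning about programs -/

infixr:60 " ;; " => Cmd.seq

/-- Index registers that a program may write. -/
def Cmd.wIdx : Cmd → List ℕ
  | .setIdx x _ => [x]
  | .loadIdx x _ => [x]
  | .seq a b => a.wIdx ++ b.wIdx
  | .ite _ a b => a.wIdx ++ b.wIdx
  | .loop _ a => a.wIdx
  | _ => []

/-- Real registers that a program may write. -/
def Cmd.wReal : Cmd → List ℕ
  | .setReal x _ => [x]
  | .loadReal x _ => [x]
  | .feature x _ _ _ => [x]
  | .simulate x _ _ _ => [x]
  | .seq a b => a.wReal ++ b.wReal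
  | .ite _ a b => a.wReal ++ b.wReal
  | .loop _ a => a.wReal
  | _ => []

/-- State registers that a program may write. -/
def Cmd.wState : Cmd → List ℕ
  | .setState x _ => [x]
  | .loadState x _ => [x]
  | .simulate _ y _ _ => [y]
  | .seq a b => a.wState ++ b.wState
  | .ite _ a b => a.wState ++ b.wState
  | .loop _ a => a.wState
  | _ => []

/-- Whether a program may write to the memory of index cells. -/
def Cmd.wIdxMem : Cmd → Bool
  | .storeIdx _ _ => true
  | .seq a b => a.wIdxMem || b.wIdxMem
  | .ite _ a b => a.wIdxMem || b.wIdxMem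
  | .loop _ a => a.wIdxMem
  | _ => false

/-- Whether a program may write to the memory of real cells. -/
def Cmd.wRealMem : Cmd → Bool
  | .storeReal _ _ => true
  | .seq a b => a.wRealMem || b.wRealMem
  | .ite _ a b => a.wRealMem || b.wRealMem
  | .loop _ a => a.wRealMem
  | _ => false

/-- Whether a program may write to the memory of state cells. -/
def Cmd.wStateMem : Cmd → Bool
  | .storeState _ _ => true
  | .seq a b => a.wStateMem || b.wStateMem
  | .ite _ a b => a.wStateMem || b.wStateMem
  | .loop _ a => a.wStateMem
  | _ => false

/-- Whether a program may call the simulator. -/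
def Cmd.calls : Cmd → Bool
  | .simulate _ _ _ _ => true
  | .seq a b => a.calls || b.calls
  | .ite _ a b => a.calls || b.calls
  | .loop _ a => a.calls
  | _ => false

section Logic

variable {S : Type*} {d K : ℕ}

/-- `σ'` differs from `σ` only where the program `c` may write. -/
structure Frame (c : Cmd) (σ σ' : Store S K) : Prop where
  idx : ∀ i, i ∉ c.wIdx → σ'.idx i = σ.idx i
  real : ∀ i, i ∉ c.wReal → σ'.real i = σ.real i
  state : ∀ i, i ∉ c.wState → σ'.state i = σ.state i
  idxMem : c.wIdxMem = false → σ'.idxMem = σ.idxMem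
  realMem : c.wRealMem = false → σ'.realMem = σ.realMem
  stateMem : c.wStateMem = false → σ'.stateMem = σ.stateMem
  trace : c.calls = false → σ'.trace = σ.trace

theorem Frame.refl (c : Cmd) (σ : Store S K) : Frame c σ σ :=
  ⟨fun _ _ => rfl, fun _ _ => rfl, fun _ _ => rfl, fun _ => rfl, fun _ => rfl, fun _ => rfl,
    fun _ => rfl⟩

theorem Frame.trans {c : Cmd} {σ₁ σ₂ σ₃ : Store S K} (h : Frame c σ₁ σ₂) (h' : Frame c σ₂ σ₃) :
    Frame c σ₁ σ₃ :=
  ⟨fun i hi => (h'.idx i hi).trans (h.idx i hi), fun i hi => (h'.real i hi).trans (h.real i hi),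
    fun i hi => (h'.state i hi).trans (h.state i hi),
    fun hc => (h'.idxMem hc).trans (h.idxMem hc), fun hc => (h'.realMem hc).trans (h.realMem hc),
    fun hc => (h'.stateMem hc).trans (h.stateMem hc), fun hc => (h'.trace hc).trans (h.trace hc)⟩

theorem Frame.mono {c c' : Cmd} {σ σ' : Store S K} (h : Frame c σ σ')
    (hi : ∀ i ∈ c.wIdx, i ∈ c'.wIdx) (hr : ∀ i ∈ c.wReal, i ∈ c'.wReal)
    (hs : ∀ i ∈ c.wState, i ∈ c'.wState) (him : c'.wIdxMem = false → c.wIdxMem = false)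
    (hrm : c'.wRealMem = false → c.wRealMem = false)
    (hsm : c'.wStateMem = false → c.wStateMem = false)
    (ht : c'.calls = false → c.calls = false) : Frame c' σ σ' :=
  ⟨fun i hn => h.idx i fun hm => hn (hi i hm), fun i hn => h.real i fun hm => hn (hr i hm),
    fun i hn => h.state i fun hm => hn (hs i hm), fun hc => h.idxMem (him hc),
    fun hc => h.realMem (hrm hc), fun hc => h.stateMem (hsm hc), fun hc => h.trace (ht hc)⟩

theorem Frame.seqLeft {a b : Cmd} {σ σ' : Store S K} (h : Frame a σ σ') :
    Frame (.seq a b) σ σ' := by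
  apply h.mono <;> simp +contextual [Cmd.wIdx, Cmd.wReal, Cmd.wState, Cmd.wIdxMem, Cmd.wRealMem,
    Cmd.wStateMem, Cmd.calls]

theorem Frame.seqRight {a b : Cmd} {σ σ' : Store S K} (h : Frame b σ σ') :
    Frame (.seq a b) σ σ' := by
  apply h.mono <;> simp +contextual [Cmd.wIdx, Cmd.wReal, Cmd.wState, Cmd.wIdxMem, Cmd.wRealMem,
    Cmd.wStateMem, Cmd.calls]

theorem Frame.iteLeft {t : Test} {a b : Cmd} {σ σ' : Store S K} (h : Frame a σ σ') :
    Frame (.ite t a b) σ σ' := by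
  apply h.mono <;> simp +contextual [Cmd.wIdx, Cmd.wReal, Cmd.wState, Cmd.wIdxMem, Cmd.wRealMem,
    Cmd.wStateMem, Cmd.calls]

theorem Frame.iteRight {t : Test} {a b : Cmd} {σ σ' : Store S K} (h : Frame b σ σ') :
    Frame (.ite t a b) σ σ' := by
  apply h.mono <;> simp +contextual [Cmd.wIdx, Cmd.wReal, Cmd.wState, Cmd.wIdxMem, Cmd.wRealMem,
    Cmd.wStateMem, Cmd.calls]

theorem Frame.loop {t : Test} {a : Cmd} {σ σ' : Store S K} (h : Frame a σ σ') :
    Frame (.loop t a) σ σ' := by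
  apply h.mono <;> simp [Cmd.wIdx, Cmd.wReal, Cmd.wState, Cmd.wIdxMem, Cmd.wRealMem,
    Cmd.wStateMem, Cmd.calls]

/-- The sets of written registers are read off the syntax. For a concrete program, the survival of a
register is then settled by `decide` or `simp`, so that postconditions only have to speak about
results. -/
theorem Exec.frame {acc : Access S d K} {M : ℕ} {c : Cmd} {σ σ' : Store S K} {t : ℕ}
    (h : Exec acc M c σ σ' t) : Frame c σ σ' := by
  induction h with
  | skip σ => exact .refl _ _
  | seq _ _ ih₁ ih₂ => exact ih₁.seqLeft.trans ih₂.seqRight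
  | iteTrue _ _ ih => exact ih.iteLeft
  | iteFalse _ _ ih => exact ih.iteRight
  | loopTrue _ _ _ ih₁ ih₂ => exact ih₁.loop.trans ih₂
  | loopFalse _ => exact .refl _ _
  | _ =>
    constructor <;>
      simp +contextual [Cmd.wIdx, Cmd.wReal, Cmd.wState, Cmd.wIdxMem, Cmd.wRealMem,
        Cmd.wStateMem, Cmd.calls, Function.update_of_ne]

/-- `c`, started in `σ`, terminates after at most `t` operations in a store with property `Q`. -/
def Runs (acc : Access S d K) (M : ℕ) (c : Cmd) (σ : Store S K) (t : ℕ)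
    (Q : Store S K → Prop) : Prop :=
  ∃ σ' t', Exec acc M c σ σ' t' ∧ t' ≤ t ∧ Q σ'

variable {acc : Access S d K} {M : ℕ}

namespace Runs

theorem frame {c : Cmd} {σ : Store S K} {t : ℕ} {Q : Store S K → Prop}
    (h : Runs acc M c σ t Q) : Runs acc M c σ t fun σ' => Q σ' ∧ Frame c σ σ' :=
  let ⟨σ', t', he, ht, hq⟩ := h
  ⟨σ', t', he, ht, hq, he.frame⟩

theorem mono {c : Cmd} {σ : Store S K} {t : ℕ} {Q Q' : Store S K → Prop}
    (h : Runs acc M c σ t Q) (hQ : ∀ σ', Q σ' → Q' σ') : Runs acc M c σ t Q' :=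
  let ⟨σ', t', he, ht, hq⟩ := h
  ⟨σ', t', he, ht, hQ _ hq⟩

/-- Weakening of the postcondition with the use of the frame. -/
theorem monoFrame {c : Cmd} {σ : Store S K} {t : ℕ} {Q Q' : Store S K → Prop}
    (h : Runs acc M c σ t Q) (hQ : ∀ σ', Q σ' → Frame c σ σ' → Q' σ') : Runs acc M c σ t Q' :=
  h.frame.mono fun _ h => hQ _ h.1 h.2

theorem le {c : Cmd} {σ : Store S K} {t t' : ℕ} {Q : Store S K → Prop}
    (h : Runs acc M c σ t Q) (ht : t ≤ t') : Runs acc M c σ t' Q :=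
  let ⟨σ', t₁, he, h₁, hq⟩ := h
  ⟨σ', t₁, he, h₁.trans ht, hq⟩

theorem skip {σ : Store S K} {Q : Store S K → Prop} (h : Q σ) : Runs acc M .skip σ 1 Q :=
  ⟨_, _, .skip σ, le_rfl, h⟩

theorem setIdx {σ : Store S K} {x : ℕ} {e : IExp} {Q : Store S K → Prop}
    (h : Q { σ with idx := Function.update σ.idx x (e.value σ) }) :
    Runs acc M (.setIdx x e) σ (e.cost + 1) Q :=
  ⟨_, _, .setIdx σ x e, le_rfl, h⟩

theorem setReal {σ : Store S K} {x : ℕ} {e : RExp} {Q : Store S K → Prop}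
    (h : Q { σ with real := Function.update σ.real x (e.value σ) }) :
    Runs acc M (.setReal x e) σ (e.cost + 1) Q :=
  ⟨_, _, .setReal σ x e, le_rfl, h⟩

theorem setState {σ : Store S K} {x y : ℕ} {Q : Store S K → Prop}
    (h : Q { σ with state := Function.update σ.state x (σ.state y) }) :
    Runs acc M (.setState x y) σ 1 Q :=
  ⟨_, _, .setState σ x y, le_rfl, h⟩

theorem loadIdx {σ : Store S K} {x : ℕ} {e : IExp} {Q : Store S K → Prop} (he : e.value σ < M)
    (h : Q { σ with idx := Function.update σ.idx x (σ.idxMem (e.value σ)) }) :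
    Runs acc M (.loadIdx x e) σ (e.cost + 1) Q :=
  ⟨_, _, .loadIdx σ x e he, le_rfl, h⟩

theorem loadReal {σ : Store S K} {x : ℕ} {e : IExp} {Q : Store S K → Prop} (he : e.value σ < M)
    (h : Q { σ with real := Function.update σ.real x (σ.realMem (e.value σ)) }) :
    Runs acc M (.loadReal x e) σ (e.cost + 1) Q :=
  ⟨_, _, .loadReal σ x e he, le_rfl, h⟩

theorem loadState {σ : Store S K} {x : ℕ} {e : IExp} {Q : Store S K → Prop} (he : e.value σ < M)
    (h : Q { σ with state := Function.update σ.state x (σ.stateMem (e.value σ)) }) :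
    Runs acc M (.loadState x e) σ (e.cost + 1) Q :=
  ⟨_, _, .loadState σ x e he, le_rfl, h⟩

theorem storeIdx {σ : Store S K} {e f : IExp} {Q : Store S K → Prop} (he : e.value σ < M)
    (h : Q { σ with idxMem := Function.update σ.idxMem (e.value σ) (f.value σ) }) :
    Runs acc M (.storeIdx e f) σ (e.cost + f.cost + 1) Q :=
  ⟨_, _, .storeIdx σ e f he, le_rfl, h⟩

theorem storeReal {σ : Store S K} {e : IExp} {f : RExp} {Q : Store S K → Prop}
    (he : e.value σ < M)
    (h : Q { σ with realMem := Function.update σ.realMem (e.value σ) (f.value σ) }) :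
    Runs acc M (.storeReal e f) σ (e.cost + f.cost + 1) Q :=
  ⟨_, _, .storeReal σ e f he, le_rfl, h⟩

theorem storeState {σ : Store S K} {e : IExp} {y : ℕ} {Q : Store S K → Prop}
    (he : e.value σ < M)
    (h : Q { σ with stateMem := Function.update σ.stateMem (e.value σ) (σ.state y) }) :
    Runs acc M (.storeState e y) σ (e.cost + 1) Q :=
  ⟨_, _, .storeState σ e y he, le_rfl, h⟩

theorem feature {σ : Store S K} {x y : ℕ} {act coord : IExp} {Q : Store S K → Prop}
    (a : Fin K) (j : Fin d) (ha : act.value σ = a) (hj : coord.value σ = j)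
    (h : Q { σ with real := Function.update σ.real x (acc.feature (σ.state y) a j) }) :
    Runs acc M (.feature x y act coord) σ (act.cost + coord.cost + 1) Q := by
  have ha' : act.value σ < K := ha ▸ a.2
  have hj' : coord.value σ < d := hj ▸ j.2
  refine ⟨_, _, .feature σ x y act coord ha' hj', le_rfl, ?_⟩
  have e₁ : (⟨act.value σ, ha'⟩ : Fin K) = a := Fin.ext ha
  have e₂ : (⟨coord.value σ, hj'⟩ : Fin d) = j := Fin.ext hj
  rwa [e₁, e₂]

theorem simulate {σ : Store S K} {x y z : ℕ} {act : IExp} {Q : Store S K → Prop}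
    (a : Fin K) (ha : act.value σ = a)
    (h : Q { σ with
      real := Function.update σ.real x (acc.simulate σ.trace.length (σ.state z) a).2
      state := Function.update σ.state y (acc.simulate σ.trace.length (σ.state z) a).1
      trace := σ.trace ++ [(σ.state z, a)] }) :
    Runs acc M (.simulate x y z act) σ (act.cost + 1) Q := by
  have ha' : act.value σ < K := ha ▸ a.2
  refine ⟨_, _, .simulate σ x y z act ha', le_rfl, ?_⟩
  have e₁ : (⟨act.value σ, ha'⟩ : Fin K) = a := Fin.ext ha
  rwa [e₁]

theorem seq {c₁ c₂ : Cmd} {σ : Store S K} {t₁ t₂ : ℕ} {Q : Store S K → Prop}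
    (h : Runs acc M c₁ σ t₁ fun σ' => Runs acc M c₂ σ' t₂ Q) :
    Runs acc M (c₁ ;; c₂) σ (t₁ + t₂) Q := by
  obtain ⟨σ₁, u₁, he₁, hu₁, σ₂, u₂, he₂, hu₂, hq⟩ := h
  exact ⟨σ₂, _, .seq he₁ he₂, add_le_add hu₁ hu₂, hq⟩

theorem ite {b : Test} {c₁ c₂ : Cmd} {σ : Store S K} {t₁ t₂ : ℕ} {Q : Store S K → Prop}
    (h₁ : b.Holds σ → Runs acc M c₁ σ t₁ Q) (h₂ : ¬ b.Holds σ → Runs acc M c₂ σ t₂ Q) :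
    Runs acc M (.ite b c₁ c₂) σ (b.cost + (t₁ + t₂)) Q := by
  by_cases hb : b.Holds σ
  · obtain ⟨σ', t', he, ht, hq⟩ := h₁ hb
    exact ⟨σ', _, .iteTrue hb he, by omega, hq⟩
  · obtain ⟨σ', t', he, ht, hq⟩ := h₂ hb
    exact ⟨σ', _, .iteFalse hb he, by omega, hq⟩

theorem loopStop {b : Test} {c : Cmd} {σ : Store S K} {Q : Store S K → Prop}
    (hb : ¬ b.Holds σ) (h : Q σ) : Runs acc M (.loop b c) σ b.cost Q :=
  ⟨σ, _, .loopFalse hb, le_rfl, h⟩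

theorem loopStep {b : Test} {c : Cmd} {σ : Store S K} {t₁ t₂ : ℕ} {Q : Store S K → Prop}
    (hb : b.Holds σ) (h : Runs acc M c σ t₁ fun σ' => Runs acc M (.loop b c) σ' t₂ Q) :
    Runs acc M (.loop b c) σ (b.cost + t₁ + t₂) Q := by
  obtain ⟨σ₁, u₁, he₁, hu₁, σ₂, u₂, he₂, hu₂, hq⟩ := h
  exact ⟨σ₂, _, .loopTrue hb he₁ he₂, by omega, hq⟩

end Runs

attribute [simp] Cmd.wIdx Cmd.wReal Cmd.wState Cmd.wIdxMem Cmd.wRealMem Cmd.wStateMem Cmd.calls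

/-- `for x := 0 to e - 1 do c`. -/
def Cmd.forLoop (x : ℕ) (e : IExp) (c : Cmd) : Cmd :=
  .setIdx x (.const 0) ;;
    .loop (.ltIdx (.reg x) e) (c ;; .setIdx x (.plus (.reg x) (.const 1)))

@[simp] theorem Cmd.wIdx_forLoop (x : ℕ) (e : IExp) (c : Cmd) :
    (Cmd.forLoop x e c).wIdx = x :: (c.wIdx ++ [x]) := rfl

@[simp] theorem Cmd.wReal_forLoop (x : ℕ) (e : IExp) (c : Cmd) :
    (Cmd.forLoop x e c).wReal = c.wReal := by simp [Cmd.forLoop]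

@[simp] theorem Cmd.wState_forLoop (x : ℕ) (e : IExp) (c : Cmd) :
    (Cmd.forLoop x e c).wState = c.wState := by simp [Cmd.forLoop]

@[simp] theorem Cmd.wIdxMem_forLoop (x : ℕ) (e : IExp) (c : Cmd) :
    (Cmd.forLoop x e c).wIdxMem = c.wIdxMem := by simp [Cmd.forLoop]

@[simp] theorem Cmd.wRealMem_forLoop (x : ℕ) (e : IExp) (c : Cmd) :
    (Cmd.forLoop x e c).wRealMem = c.wRealMem := by simp [Cmd.forLoop]

theorem Frame.forLoopBody {x : ℕ} {e : IExp} {c : Cmd} {σ σ' : Store S K} (h : Frame c σ σ') :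
    Frame (.forLoop x e c) σ σ' :=
  Frame.seqRight (Frame.loop (Frame.seqLeft h))

theorem Frame.forLoopCounter {x : ℕ} {e : IExp} {c : Cmd} (σ : Store S K) (n : ℕ) :
    Frame (.forLoop x e c) σ { σ with idx := Function.update σ.idx x n } := by
  constructor <;> simp +contextual [Cmd.forLoop, Cmd.wIdx, Function.update_of_ne]

/-- Rule for counting loops. The invariant `I j` holds before the iteration number `j`. -/
theorem Runs.forLoop {x : ℕ} {e : IExp} {c : Cmd} {σ : Store S K} {t : ℕ} (n : ℕ)
    (I : ℕ → Store S K → Prop) {Q : Store S K → Prop} (hx : x ∉ c.wIdx)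
    (hn : ∀ σ', Frame (.forLoop x e c) σ σ' → e.value σ' = n)
    (h0 : I 0 { σ with idx := Function.update σ.idx x 0 })
    (hI : ∀ j σ' v, I j σ' → I j { σ' with idx := Function.update σ'.idx x v })
    (hstep : ∀ j < n, ∀ σ', Frame (.forLoop x e c) σ σ' → σ'.idx x = j → I j σ' →
      Runs acc M c σ' t (I (j + 1)))
    (hQ : ∀ σ', Frame (.forLoop x e c) σ σ' → I n σ' → Q σ') :
    Runs acc M (.forLoop x e c) σ ((n + 1) * (t + (e.cost + 10))) Q := by
  -- Induction on the number `m` of remaining iterations. The final test and the initialization of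
  -- the counter are paid for by the additional factor in `n + 1`.
  have main : ∀ m j, j + m = n → ∀ σ', Frame (.forLoop x e c) σ σ' → σ'.idx x = j → I j σ' →
      Runs acc M (.loop (.ltIdx (.reg x) e) (c ;; .setIdx x (.plus (.reg x) (.const 1)))) σ'
        (m * (t + (e.cost + 10)) + (e.cost + 2)) Q := by
    intro m
    induction m with
    | zero =>
      intro j hj σ' hf hxj hIj
      refine (loopStop ?_ (hQ _ hf ?_)).le (by simp [Test.cost, IExp.cost]; omega)
      · simp [Test.Holds, IExp.value, hn σ' hf, hxj]; omega
      · have : j = n := by omega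
        exact this ▸ hIj
    | succ m ih =>
      intro j hj σ' hf hxj hIj
      have hb : (Test.ltIdx (.reg x) e).Holds σ' := by
        simp [Test.Holds, IExp.value, hn σ' hf, hxj]; omega
      refine (loopStep (t₂ := m * (t + (e.cost + 10)) + (e.cost + 2)) hb
        (seq (t₂ := 4) ((hstep j (by omega) σ' hf hxj hIj).monoFrame ?_))).le ?_
      · intro σ₁ h₁ hf₁
        have e₁ : σ₁.idx x = j := by rw [hf₁.idx x hx, hxj]
        refine (setIdx ?_).le (by simp [IExp.cost])
        refine ih (j + 1) (by omega) _ ((hf.trans hf₁.forLoopBody).trans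
          (Frame.forLoopCounter _ _)) ?_ (hI _ _ _ h₁)
        simp [IExp.value, e₁]
      · simp [Test.cost, IExp.cost]; ring_nf; omega
  refine (seq (setIdx (main n 0 (by omega) _ (Frame.forLoopCounter _ _) ?_ ?_))).le ?_
  · simp [IExp.value]
  · simpa [IExp.value] using h0
  · simp [IExp.cost]; ring_nf; omega

end Logic

/-! ### Rank-one updates of the covariance matrix -/

section Covariance

variable {S : Type*} {d K : ℕ} {p : Params} {φ : S → Fin K → Fin d → ℝ}

@[simp]
theorem covMatrix_nil : covMatrix p φ [] = p.lam • (1 : Matrix (Fin d) (Fin d) ℝ) := by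
  simp [covMatrix]

theorem covMatrix_append_singleton (C : List (S × Fin K)) (e : S × Fin K) :
    covMatrix p φ (C ++ [e]) =
      covMatrix p φ C + Matrix.vecMulVec (φ e.1 e.2) (φ e.1 e.2) := by
  simp [covMatrix, add_assoc]

theorem posSemidef_vecMulVec_self (x : Fin d → ℝ) : (Matrix.vecMulVec x x).PosSemidef := by
  simpa using Matrix.posSemidef_vecMulVec_self_star x

theorem covMatrix_posDef (hp : 0 < p.lam) (C : List (S × Fin K)) :
    (covMatrix p φ C).PosDef := by
  induction C using List.reverseRecOn with
  | nil => simpa using Matrix.PosDef.one.smul hp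
  | append_singleton C e ih =>
    rw [covMatrix_append_singleton]
    exact ih.add_posSemidef (posSemidef_vecMulVec_self _)

/-- `V(C)⁻¹ y`. -/
noncomputable def invCov (p : Params) (φ : S → Fin K → Fin d → ℝ) (C : List (S × Fin K))
    (y : Fin d → ℝ) : Fin d → ℝ :=
  (covMatrix p φ C)⁻¹ *ᵥ y

/-- `V(C)⁻¹ φ(e)`, the direction of the rank-one update of `V(C)⁻¹` by `e`. -/
noncomputable def updateDir (p : Params) (φ : S → Fin K → Fin d → ℝ) (C : List (S × Fin K))
    (e : S × Fin K) : Fin d → ℝ :=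
  invCov p φ C (φ e.1 e.2)

/-- The denominator `1 + φ(e)ᵀ V(C)⁻¹ φ(e)` of the rank-one update of `V(C)⁻¹` by `e`. -/
noncomputable def updateDen (p : Params) (φ : S → Fin K → Fin d → ℝ) (C : List (S × Fin K))
    (e : S × Fin K) : ℝ :=
  1 + φ e.1 e.2 ⬝ᵥ updateDir p φ C e

theorem invCov_nil (hp : 0 < p.lam) (y : Fin d → ℝ) :
    invCov p φ ([] : List (S × Fin K)) y = p.lam⁻¹ • y := by
  have h : (p.lam • (1 : Matrix (Fin d) (Fin d) ℝ))⁻¹ = p.lam⁻¹ • 1 := by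
    apply Matrix.inv_eq_right_inv
    simp [smul_smul, hp.ne']
  rw [invCov, covMatrix_nil, h, Matrix.smul_mulVec, Matrix.one_mulVec]

theorem dotProduct_invCov_comm (hp : 0 < p.lam) (C : List (S × Fin K)) (x y : Fin d → ℝ) :
    x ⬝ᵥ invCov p φ C y = invCov p φ C x ⬝ᵥ y := by
  have hs : ((covMatrix p φ C)⁻¹)ᵀ = (covMatrix p φ C)⁻¹ := by
    have := (covMatrix_posDef (φ := φ) hp C).inv.isHermitian
    simpa [Matrix.IsHermitian, Matrix.conjTranspose_eq_transpose_of_trivial] using this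
  rw [invCov, invCov, Matrix.dotProduct_mulVec, ← Matrix.mulVec_transpose, hs]

theorem dotProduct_invCov_nonneg (hp : 0 < p.lam) (C : List (S × Fin K)) (x : Fin d → ℝ) :
    0 ≤ x ⬝ᵥ invCov p φ C x := by
  simpa [invCov] using (covMatrix_posDef (φ := φ) hp C).inv.posSemidef.dotProduct_mulVec_nonneg x

theorem one_le_updateDen (hp : 0 < p.lam) (C : List (S × Fin K)) (e : S × Fin K) :
    1 ≤ updateDen p φ C e := by
  have := dotProduct_invCov_nonneg (φ := φ) hp C (φ e.1 e.2)
  unfold updateDen updateDir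
  linarith

/-- The Sherman–Morrison formula. -/
theorem invCov_append_singleton (hp : 0 < p.lam) (C : List (S × Fin K)) (e : S × Fin K)
    (y : Fin d → ℝ) :
    invCov p φ (C ++ [e]) y = invCov p φ C y -
      ((updateDir p φ C e ⬝ᵥ y) / updateDen p φ C e) • updateDir p φ C e := by
  have hV := covMatrix_posDef (φ := φ) hp C
  have hV' := covMatrix_posDef (φ := φ) hp (C ++ [e])
  have hD := one_le_updateDen (φ := φ) hp C e
  have hu : ∀ z, covMatrix p φ C *ᵥ invCov p φ C z = z := fun z => by
    rw [invCov, Matrix.mulVec_mulVec, Matrix.mul_nonsing_inv _ ((Matrix.isUnit_iff_isUnit_det _).1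
      hV.isUnit), Matrix.one_mulVec]
  set z := invCov p φ C y -
      ((updateDir p φ C e ⬝ᵥ y) / updateDen p φ C e) • updateDir p φ C e with hz
  -- It suffices that the proposed vector solves the new linear system, as the new matrix is
  -- invertible.
  have key : covMatrix p φ (C ++ [e]) *ᵥ z = y := by
    rw [covMatrix_append_singleton, Matrix.add_mulVec, Matrix.vecMulVec_mulVec, hz,
      Matrix.mulVec_sub, Matrix.mulVec_smul, hu, updateDir, hu, dotProduct_sub, dotProduct_smul,
      dotProduct_invCov_comm hp C (φ e.1 e.2) y]
    have h1 : φ e.1 e.2 ⬝ᵥ invCov p φ C (φ e.1 e.2) = updateDen p φ C e - 1 := by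
      simp [updateDen, updateDir]
    rw [h1]
    set c := invCov p φ C (φ e.1 e.2) ⬝ᵥ y
    have h2 : c - c / updateDen p φ C e * (updateDen p φ C e - 1) = c / updateDen p φ C e := by
      field_simp; ring
    simp only [smul_eq_mul, h2, op_smul_eq_smul]
    abel
  rw [← key, invCov, Matrix.mulVec_mulVec, Matrix.nonsing_inv_mul _
    ((Matrix.isUnit_iff_isUnit_det _).1 hV'.isUnit), Matrix.one_mulVec]

/-- `yᵀ V(C)⁻¹ y`. -/
noncomputable def invQuad (p : Params) (φ : S → Fin K → Fin d → ℝ) (C : List (S × Fin K))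
    (y : Fin d → ℝ) : ℝ :=
  y ⬝ᵥ invCov p φ C y

theorem invQuad_nil (hp : 0 < p.lam) (y : Fin d → ℝ) :
    invQuad p φ ([] : List (S × Fin K)) y = (y ⬝ᵥ y) / p.lam := by
  rw [invQuad, invCov_nil hp, dotProduct_smul, smul_eq_mul, div_eq_inv_mul]

theorem invQuad_append_singleton (hp : 0 < p.lam) (C : List (S × Fin K)) (e : S × Fin K)
    (y : Fin d → ℝ) :
    invQuad p φ (C ++ [e]) y = invQuad p φ C y -
      (y ⬝ᵥ updateDir p φ C e) * (y ⬝ᵥ updateDir p φ C e) / updateDen p φ C e := by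
  rw [invQuad, invCov_append_singleton hp, dotProduct_sub, dotProduct_smul, smul_eq_mul,
    dotProduct_comm (updateDir p φ C e) y, invQuad]
  ring

theorem mem_actionCover_iff (C : List (S × Fin K)) (e : S × Fin K) :
    e ∈ actionCover p φ C ↔ invQuad p φ C (φ e.1 e.2) ≤ 1 := by
  simp [actionCover, ellNorm, invQuad, invCov, Real.sqrt_le_one]

/-- Each rank-one update subtracts a square divided by a positive number. Coverage is therefore
monotone in the prefix, which is what makes ranks meaningful. -/
theorem invQuad_append_le (hp : 0 < p.lam) (C C' : List (S × Fin K)) (y : Fin d → ℝ) :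
    invQuad p φ (C ++ C') y ≤ invQuad p φ C y := by
  induction C' using List.reverseRecOn with
  | nil => simp
  | append_singleton C' e ih =>
    rw [← List.append_assoc, invQuad_append_singleton hp]
    have h : 0 ≤ (y ⬝ᵥ updateDir p φ (C ++ C') e) * (y ⬝ᵥ updateDir p φ (C ++ C') e) /
        updateDen p φ (C ++ C') e :=
      div_nonneg (mul_self_nonneg _) (zero_le_one.trans (one_le_updateDen hp _ _))
    linarith

theorem actionCover_append (hp : 0 < p.lam) (C C' : List (S × Fin K)) :
    actionCover p φ C ⊆ actionCover p φ (C ++ C') := fun e he => by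
  rw [mem_actionCover_iff] at he ⊢
  exact (invQuad_append_le hp C C' _).trans he

theorem cover_append (hp : 0 < p.lam) (C C' : List (S × Fin K)) :
    cover p φ C ⊆ cover p φ (C ++ C') := fun _ hs a => actionCover_append hp C C' (hs a)

theorem actionCover_take_mono (hp : 0 < p.lam) (C : List (S × Fin K)) {m n : ℕ} (h : m ≤ n) :
    actionCover p φ (C.take m) ⊆ actionCover p φ (C.take n) := by
  obtain ⟨k, rfl⟩ := Nat.exists_eq_add_of_le h
  rw [List.take_add]
  exact actionCover_append hp _ _

/-- If x = φᵀV⁻¹φ before the update, then the value after it is x - x²/(1 + x) = x/(1 + x) < 1. -/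
theorem mem_actionCover_append_singleton (hp : 0 < p.lam) (C : List (S × Fin K))
    (e : S × Fin K) : e ∈ actionCover p φ (C ++ [e]) := by
  rw [mem_actionCover_iff, invQuad_append_singleton hp]
  have h1 : invQuad p φ C (φ e.1 e.2) = updateDen p φ C e - 1 := by
    simp [updateDen, updateDir, invQuad]
  have h2 : φ e.1 e.2 ⬝ᵥ updateDir p φ C e = updateDen p φ C e - 1 := by simp [updateDen]
  have hD := one_le_updateDen (φ := φ) hp C e
  rw [h1, h2, sub_le_iff_le_add, ← sub_le_iff_le_add', le_div_iff₀ (by linarith)]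
  nlinarith

theorem mem_actionCover_of_mem (hp : 0 < p.lam) {C : List (S × Fin K)} {e : S × Fin K}
    (h : e ∈ C) : e ∈ actionCover p φ C := by
  obtain ⟨C₁, C₂, rfl⟩ := List.append_of_mem h
  have := actionCover_append (φ := φ) hp (C₁ ++ [e]) C₂ (mem_actionCover_append_singleton hp C₁ e)
  simpa using this

/-- Each pair in the sequence is not covered by the preceding ones. -/
def Fresh (p : Params) (φ : S → Fin K → Fin d → ℝ) (C : List (S × Fin K)) : Prop :=
  ∀ C' e, C' ++ [e] <+: C → e ∉ actionCover p φ C'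

theorem Fresh.nil : Fresh p φ [] := fun C' e h => by simp at h

theorem Fresh.append_singleton {C : List (S × Fin K)} (hC : Fresh p φ C) {e : S × Fin K}
    (he : e ∉ actionCover p φ C) : Fresh p φ (C ++ [e]) := fun C' e' h => by
  rcases List.prefix_concat_iff.1 h with h | h
  · have := List.append_inj' h rfl
    simp only [List.cons.injEq, and_true] at this
    obtain ⟨rfl, rfl⟩ := this
    exact he
  · exact hC C' e' h

theorem Fresh.of_append {C C' : List (S × Fin K)} (h : Fresh p φ (C ++ C')) : Fresh p φ C :=
  fun _ _ h' => h _ _ (h'.trans (List.prefix_append C C'))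

/-- A member of a sequence is covered by it, so it cannot be appended again. Propagation, which
skips pairs already present, needs this in order to yield prefixes. -/
theorem Fresh.nodup (hp : 0 < p.lam) {C : List (S × Fin K)} (h : Fresh p φ C) : C.Nodup := by
  induction C using List.reverseRecOn with
  | nil => simp
  | append_singleton C e ih =>
    have he := h C e List.prefix_rfl
    rw [List.nodup_append]
    refine ⟨ih h.of_append, by simp, fun a ha b hb => ?_⟩
    rintro rfl
    rw [List.mem_singleton] at hb
    subst hb
    exact he (mem_actionCover_of_mem hp ha)

/-- The coefficients of the regularized least-squares estimator. -/
noncomputable def lseCoef (p : Params) (φ : S → Fin K → Fin d → ℝ) (C : List (S × Fin K))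
    (q : ℕ → ℝ) : Fin d → ℝ :=
  invCov p φ C
    (((C.zip ((List.range C.length).map fun i => some (q i))).map
      fun x => (x.2.getD 0) • φ x.1.1 x.1.2).sum)

theorem lse_eq (C : List (S × Fin K)) (q : ℕ → ℝ) (s : S) (a : Fin K) :
    lse p φ C ((List.range C.length).map fun i => some (q i)) s a =
      φ s a ⬝ᵥ lseCoef p φ C q := rfl

theorem lseCoef_nil (q : ℕ → ℝ) : lseCoef p φ [] q = 0 := by
  simp [lseCoef, invCov]

/-- Recursive least squares. -/
theorem lseCoef_append_singleton (hp : 0 < p.lam) (C : List (S × Fin K)) (e : S × Fin K)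
    (q : ℕ → ℝ) :
    lseCoef p φ (C ++ [e]) q = lseCoef p φ C q +
      ((q C.length - φ e.1 e.2 ⬝ᵥ lseCoef p φ C q) / updateDen p φ C e) • updateDir p φ C e := by
  have hD := one_le_updateDen (φ := φ) hp C e
  have hz : (C ++ [e]).zip ((List.range (C ++ [e]).length).map fun i => some (q i)) =
      C.zip ((List.range C.length).map fun i => some (q i)) ++ [(e, some (q C.length))] := by
    rw [List.length_append, List.length_singleton, List.range_succ, List.map_append,
      List.zip_append (by simp)]
    simp
  unfold lseCoef
  rw [hz, List.map_append, List.sum_append]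
  set b := ((C.zip ((List.range C.length).map fun i => some (q i))).map
      fun x => (x.2.getD 0) • φ x.1.1 x.1.2).sum
  have h1 : updateDir p φ C e ⬝ᵥ φ e.1 e.2 = updateDen p φ C e - 1 := by
    rw [dotProduct_comm]; simp [updateDen]
  have h2 : updateDir p φ C e ⬝ᵥ b = φ e.1 e.2 ⬝ᵥ invCov p φ C b := by
    rw [dotProduct_invCov_comm hp, updateDir]
  rw [invCov_append_singleton hp]
  simp only [List.map_cons, List.map_nil, List.sum_singleton, Option.getD_some, dotProduct_add,
    dotProduct_smul, h1, h2]
  have h3 : invCov p φ C (b + q C.length • φ e.1 e.2) =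
      invCov p φ C b + q C.length • updateDir p φ C e := by
    simp [invCov, updateDir, Matrix.mulVec_add, Matrix.mulVec_smul]
  rw [h3, add_sub_assoc, ← sub_smul, smul_eq_mul]
  congr 2
  field_simp
  ring

/-- By the matrix determinant lemma, a new pair multiplies the determinant by 1 + φᵀV⁻¹φ, which
exceeds 2 exactly because the pair is not covered. The empty sequence contributes λ^d. -/
theorem two_pow_mul_le_det_covMatrix (hp : 0 < p.lam) {C : List (S × Fin K)}
    (h : Fresh p φ C) : p.lam ^ d * 2 ^ C.length ≤ (covMatrix p φ C).det := by
  induction C using List.reverseRecOn with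
  | nil => simp
  | append_singleton C e ih =>
    have hV := covMatrix_posDef (φ := φ) hp C
    have he := h C e List.prefix_rfl
    rw [mem_actionCover_iff, not_le] at he
    have hdet : (covMatrix p φ (C ++ [e])).det =
        (covMatrix p φ C).det * (1 + invQuad p φ C (φ e.1 e.2)) := by
      rw [covMatrix_append_singleton, Matrix.vecMulVec_eq Unit,
        Matrix.det_add_replicateCol_mul_replicateRow
          ((Matrix.isUnit_iff_isUnit_det _).1 hV.isUnit), Matrix.det_unique (n := Unit),
        Matrix.mul_assoc, ← Matrix.replicateCol_mulVec, Matrix.add_apply,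
        Matrix.replicateRow_mul_replicateCol_apply, Matrix.one_apply_eq]
      rfl
    rw [hdet, List.length_append, List.length_singleton, pow_succ, ← mul_assoc]
    exact mul_le_mul (ih h.of_append) (by linarith) (by norm_num) hV.det_pos.le

theorem trace_covMatrix_le {L : ℝ} (hL : ∀ s a, ‖WithLp.toLp 2 (φ s a)‖ ≤ L)
    (C : List (S × Fin K)) :
    (covMatrix p φ C).trace ≤ p.lam * d + C.length * L ^ 2 := by
  induction C using List.reverseRecOn with
  | nil => simp
  | append_singleton C e ih =>
    have h1 : φ e.1 e.2 ⬝ᵥ φ e.1 e.2 ≤ L ^ 2 := by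
      have h := pow_le_pow_left₀ (norm_nonneg _) (hL e.1 e.2) 2
      rw [EuclideanSpace.norm_sq_eq] at h
      simpa [dotProduct, ← pow_two] using h
    rw [covMatrix_append_singleton, Matrix.trace_add, Matrix.trace_vecMulVec]
    push_cast [List.length_append, List.length_singleton]
    linarith

/-- Every eigenvalue is at most the sum of all. Compared with the inequality of arithmetic and
geometric means this loses a factor d^d, which disappears in the logarithmic factor. -/
theorem _root_.Matrix.PosDef.det_le_trace_pow {A : Matrix (Fin d) (Fin d) ℝ} (hA : A.PosDef) :
    A.det ≤ A.trace ^ d := by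
  have htr : A.trace = ∑ i, hA.isHermitian.eigenvalues i := by
    simpa using hA.isHermitian.trace_eq_sum_eigenvalues
  have hdet : A.det = ∏ i, hA.isHermitian.eigenvalues i := by
    simpa using hA.isHermitian.det_eq_prod_eigenvalues
  rw [hdet, htr]
  calc ∏ i, hA.isHermitian.eigenvalues i
      ≤ ∏ _i : Fin d, ∑ j, hA.isHermitian.eigenvalues j :=
        Finset.prod_le_prod (fun i _ => (hA.eigenvalues_pos i).le) fun i _ =>
          Finset.single_le_sum (f := hA.isHermitian.eigenvalues)
            (fun j _ => (hA.eigenvalues_pos j).le) (Finset.mem_univ i)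
    _ = _ := by simp

/-- The determinant grows exponentially in the length and the trace only linearly. Comparing the
two, after cancelling λ^d, forces the length to be of order `d` up to logarithms. -/
theorem Fresh.pow_length_le (hp : 0 < p.lam) {L : ℝ}
    (hL : ∀ s a, ‖WithLp.toLp 2 (φ s a)‖ ≤ L) {C : List (S × Fin K)} (h : Fresh p φ C) :
    (2 : ℝ) ^ C.length ≤ (d + C.length * (L ^ 2 / p.lam)) ^ d := by
  have h1 := (two_pow_mul_le_det_covMatrix hp h).trans
    (covMatrix_posDef (φ := φ) hp C).det_le_trace_pow
  have h2 : (covMatrix p φ C).trace ^ d ≤ (p.lam * d + C.length * L ^ 2) ^ d :=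
    pow_le_pow_left₀ (covMatrix_posDef (φ := φ) hp C).posSemidef.trace_nonneg
      (trace_covMatrix_le hL C) d
  have h3 : p.lam * d + C.length * L ^ 2 = p.lam * (d + C.length * (L ^ 2 / p.lam)) := by
    field_simp
  rw [h3, mul_pow] at h2
  exact le_of_mul_le_mul_left (h1.trans h2) (pow_pos hp d)

end Covariance

/-! ### A compact description of the variables of the planner

All core sequences are prefixes of the one of level `0`, and the estimates that are present form a
prefix of `qbar l`. -/

section FirstAction

variable {K : ℕ}

theorem firstAction_eq_none {P : Fin K → Prop} : firstAction P = none ↔ ∀ a, ¬ P a := by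
  simp [firstAction]

theorem firstAction_eq_some {P : Fin K → Prop} {a : Fin K} (ha : P a) (h : ∀ b < a, ¬ P b) :
    firstAction P = some a := by
  cases hf : firstAction P with
  | none => exact absurd ha (firstAction_eq_none.1 hf a)
  | some b =>
    rw [firstAction, List.find?_eq_some_iff_getElem] at hf
    obtain ⟨hb, i, hi, hib, hlt⟩ := hf
    have hb' : P b := by simpa using hb
    rw [List.getElem_finRange] at hib
    rcases lt_trichotomy a b with hab | rfl | hab
    · have := hlt a (by
        have : (b : ℕ) = i := by simp [← hib]
        have : (a : ℕ) < b := hab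
        omega)
      simp [ha] at this
    · rfl
    · exact absurd hb' (h b hab)

theorem argmaxFirst_eq [NeZero K] {f : Fin K → ℝ} {a : Fin K} (ha : ∀ b, f b ≤ f a)
    (h : ∀ b < a, f b < f a) : argmaxFirst f = a := by
  rw [argmaxFirst, firstAction_eq_some ha fun b hb hb' => (h b hb).not_ge (hb' a)]
  rfl

open Classical in
/-- The confident improvement of the action `a` with respect to the action values `q`. -/
noncomputable def improveAct [NeZero K] (ω : ℝ) (q : Fin K → ℝ) (a : Fin K) : Fin K :=
  if q a + ω < Finset.univ.sup' Finset.univ_nonempty q - ω then argmaxFirst q else a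

end FirstAction

/-- A core sequence `C`, the lengths `len l` of its prefixes that are the core sequences of the
levels `l`, the numbers `meas l` of estimates at level `l`, the estimates `q l i`, and the
coefficients `θ l i` that determine the action of the policy of level `l + 1` in the states that
are covered by the first `i + 1`, but not by the first `i` members of `C`. -/
structure Ledger (S : Type*) (d K : ℕ) where
  C : List (S × Fin K)
  len : ℕ → ℕ
  meas : ℕ → ℕ
  q : ℕ → ℕ → ℝ
  θ : ℕ → ℕ → Fin d → ℝ

section Ledger

variable {S : Type*} {d K : ℕ} {p : Params} {φ : S → Fin K → Fin d → ℝ}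

/-- `r` is the least length of a prefix of `C` that covers `s`, and larger than the length of `C`
if there is none. -/
def IsRank (p : Params) (φ : S → Fin K → Fin d → ℝ) (C : List (S × Fin K)) (s : S) (r : ℕ) :
    Prop :=
  ∀ m ≤ C.length, s ∈ cover p φ (C.take m) ↔ r ≤ m

/-- Ranks beyond the length of the sequence are not distinguished, so a rank for a longer sequence
also serves for the shorter one. Hence vectors stored by rank stay valid when the core sequence
grows. -/
theorem IsRank.of_append {C C' : List (S × Fin K)} {s : S} {r : ℕ}
    (h : IsRank p φ (C ++ C') s r) : IsRank p φ C s r := fun m hm => by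
  rw [← h m (by simp; omega), List.take_append_of_le_length hm]

theorem IsRank.mem_cover_iff {C : List (S × Fin K)} {s : S} {r : ℕ} (h : IsRank p φ C s r) :
    s ∈ cover p φ C ↔ r ≤ C.length := by
  simpa using h C.length le_rfl

namespace Ledger

/-- The action at level `l` in a state `s` covered by the first `i + 1`, but not by the first `i`
members of the core sequence. -/
noncomputable def act [NeZero K] (p : Params) (φ : S → Fin K → Fin d → ℝ) (y : Ledger S d K)
    (s : S) (i : ℕ) : ℕ → Fin K
  | 0 => 0
  | l + 1 => improveAct p.ω (fun b => φ s b ⬝ᵥ y.θ l i) (y.act p φ s i l)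

/-- The action at level `l` in a state `s` of rank `r`. -/
noncomputable def policy [NeZero K] (p : Params) (φ : S → Fin K → Fin d → ℝ) (y : Ledger S d K)
    (s : S) (r l : ℕ) : Fin K :=
  if r = 0 then 0 else y.act p φ s (r - 1) l

theorem act_congr [NeZero K] {y y' : Ledger S d K} {s : S} {i l : ℕ}
    (h : ∀ l' < l, y.θ l' i = y'.θ l' i) : y.act p φ s i l = y'.act p φ s i l := by
  induction l with
  | zero => rfl
  | succ l ih => rw [act, act, ih fun l' hl' => h l' (by omega), h l (by omega)]

theorem policy_congr [NeZero K] {y y' : Ledger S d K} {s : S} {r l : ℕ}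
    (h : r ≠ 0 → ∀ l' < l, y.θ l' (r - 1) = y'.θ l' (r - 1)) :
    y.policy p φ s r l = y'.policy p φ s r l := by
  unfold policy
  split_ifs with h0
  · rfl
  · exact act_congr (h h0)

/-- The empty ledger. -/
def empty (S : Type*) (d K : ℕ) : Ledger S d K := ⟨[], fun _ => 0, fun _ => 0, fun _ _ => 0, 0⟩

/-- Append a pair to the core sequence of level `0`. -/
def push (y : Ledger S d K) (e : S × Fin K) : Ledger S d K :=
  { y with C := y.C ++ [e], len := Function.update y.len 0 (y.C.length + 1) }

/-- Record the next estimate at level `l`. -/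
def record (y : Ledger S d K) (l : ℕ) (r : ℝ) : Ledger S d K :=
  { y with
    meas := Function.update y.meas l (y.meas l + 1)
    q := Function.update y.q l (Function.update (y.q l) (y.meas l) r) }

/-- Propagate the core sequence and the policy of level `l` to level `l + 1`. -/
def propagate (y : Ledger S d K) (l : ℕ) (v : Fin d → ℝ) : Ledger S d K :=
  { y with
    len := Function.update y.len (l + 1) (y.len l)
    θ := fun l' i => if l' = l ∧ y.len (l + 1) ≤ i ∧ i < y.len l then v else y.θ l' i }

/-- The relations between the lengths of the core sequences and the numbers of estimates. -/
structure Chain (y : Ledger S d K) (H : ℕ) : Prop where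
  len_zero : y.len 0 = y.C.length
  len_succ_le : ∀ l < H, y.len (l + 1) ≤ y.meas l
  meas_le : ∀ l < H, y.meas l ≤ y.len l

/-- Every level below `H` without missing estimates has been propagated. -/
def Settled (y : Ledger S d K) (H : ℕ) : Prop :=
  ∀ l < H, y.meas l = y.len l → y.len (l + 1) = y.len l

theorem Chain.len_anti {y : Ledger S d K} {H : ℕ} (h : y.Chain H) {l l' : ℕ} (hl : l ≤ l')
    (hl' : l' ≤ H) : y.len l' ≤ y.len l := by
  induction l', hl using Nat.le_induction with
  | base => exact le_rfl
  | succ n hn ih =>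
    exact ((h.len_succ_le n (by omega)).trans (h.meas_le n (by omega))).trans (ih (by omega))

theorem Chain.len_le {y : Ledger S d K} {H : ℕ} (h : y.Chain H) {l : ℕ} (hl : l ≤ H) :
    y.len l ≤ y.C.length :=
  h.len_zero ▸ h.len_anti (Nat.zero_le l) hl

/-- If all lower levels have their estimates, each has been propagated in full, so the whole
sequence has climbed up to `l`. At the level chosen for measurement, coverage thus means coverage by
the core sequence of level 0, and a discovered state has an action to append there. -/
theorem Settled.len_eq {y : Ledger S d K} {H : ℕ} (hs : y.Settled H) (h : y.Chain H) {l : ℕ}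
    (hl : l ≤ H) (hm : ∀ l' < l, y.meas l' = y.len l') : y.len l = y.C.length := by
  induction l with
  | zero => exact h.len_zero
  | succ l ih =>
    rw [hs l (by omega) (hm l (by omega))]
    exact ih (by omega) fun l' hl' => hm l' (by omega)

theorem Chain.empty (H : ℕ) : (Ledger.empty S d K).Chain H :=
  ⟨rfl, fun _ _ => le_rfl, fun _ _ => le_rfl⟩

theorem Settled.empty (H : ℕ) : (Ledger.empty S d K).Settled H := fun _ _ _ => rfl

theorem Chain.push {y : Ledger S d K} {H : ℕ} (h : y.Chain H) (e : S × Fin K) :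
    (y.push e).Chain H where
  len_zero := by simp [Ledger.push]
  len_succ_le l hl := by simpa [Ledger.push] using h.len_succ_le l hl
  meas_le l hl := by
    have h1 := h.meas_le l hl
    have h2 := h.len_zero
    rcases Nat.eq_zero_or_pos l with rfl | h0
    · simp [Ledger.push]; omega
    · simpa [Ledger.push, h0.ne'] using h1

theorem Settled.push {y : Ledger S d K} {H : ℕ} (hs : y.Settled H) (h : y.Chain H)
    (e : S × Fin K) : (y.push e).Settled H := fun l hl hm => by
  have h1 := h.meas_le l hl
  have h2 := h.len_zero
  rcases Nat.eq_zero_or_pos l with rfl | h0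
  · simp [Ledger.push] at hm; omega
  · simpa [Ledger.push, h0.ne'] using hs l hl (by simpa [Ledger.push, h0.ne'] using hm)

theorem Chain.record {y : Ledger S d K} {H : ℕ} (h : y.Chain H) {l : ℕ}
    (hl : y.meas l < y.len l) (r : ℝ) : (y.record l r).Chain H where
  len_zero := h.len_zero
  len_succ_le l' hl' := by
    have := h.len_succ_le l' hl'
    by_cases e : l' = l
    · subst e; simp [Ledger.record]; omega
    · simpa [Ledger.record, e] using this
  meas_le l' hl' := by
    have := h.meas_le l' hl'
    by_cases e : l' = l
    · subst e; simp [Ledger.record]; omega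
    · simpa [Ledger.record, e] using this

theorem Settled.record {y : Ledger S d K} {H : ℕ} (hs : y.Settled H) {l : ℕ}
    (hl : y.meas l + 1 < y.len l) (r : ℝ) : (y.record l r).Settled H := fun l' hl' hm => by
  by_cases e : l' = l
  · subst e; simp [Ledger.record] at hm; omega
  · exact hs l' hl' (by simpa [Ledger.record, e] using hm)

theorem Chain.propagate {y : Ledger S d K} {H : ℕ} (h : y.Chain H) {l : ℕ}
    (hl : l < H) (hm : y.meas l = y.len l) (v : Fin d → ℝ) : (y.propagate l v).Chain H where
  len_zero := by simpa [Ledger.propagate] using h.len_zero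
  len_succ_le l' hl' := by
    have := h.len_succ_le l' hl'
    by_cases e : l' = l
    · subst e; simp [Ledger.propagate]; omega
    · simpa [Ledger.propagate, e] using this
  meas_le l' hl' := by
    have h1 := h.meas_le l' hl'
    have h2 := h.len_anti (show l ≤ l + 1 by omega) hl
    by_cases e : l' = l + 1
    · subst e; simp [Ledger.propagate]; omega
    · simpa [Ledger.propagate, e] using h1

/-- Propagation of a level that has just received its last estimate settles the ledger. -/
theorem Settled.record_propagate {y : Ledger S d K} {H : ℕ} (hs : y.Settled H) (h : y.Chain H)
    {l : ℕ} (hl : l < H) (hm : y.meas l + 1 = y.len l) (r : ℝ) (v : Fin d → ℝ) :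
    ((y.record l r).propagate l v).Settled H := fun l' hl' hm' => by
  have h1 := h.len_succ_le l hl
  by_cases e : l' = l
  · subst e; simp [Ledger.propagate, Ledger.record]
  by_cases e' : l' = l + 1
  · subst e'
    have h2 := h.meas_le _ hl'
    simp [Ledger.propagate, Ledger.record] at hm'
    omega
  · have := hs l' hl' (by simpa [Ledger.propagate, Ledger.record, e, e'] using hm')
    simpa [Ledger.propagate, Ledger.record, e, e'] using this

end Ledger

/-- The ledger `y` describes the variables `x` of the planner. -/
structure Track [NeZero K] (p : Params) (φ : S → Fin K → Fin d → ℝ) (x : PlanState S K)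
    (y : Ledger S d K) : Prop where
  chain : y.Chain p.horizon
  fresh : Fresh p φ y.C
  core : ∀ l ≤ p.horizon, x.C l = y.C.take (y.len l)
  est : ∀ l < p.horizon, x.qbar l = ((List.range (y.meas l)).map fun i => some (y.q l i)) ++
    List.replicate (y.len l - y.meas l) none
  pol : ∀ l ≤ p.horizon, ∀ s r, IsRank p φ y.C s r → r ≤ y.len l →
    x.pol l s = y.policy p φ s r l
  pol_of_notMem : ∀ l ≤ p.horizon, ∀ s ∉ cover p φ y.C, x.pol l s = 0

variable [NeZero K] {x : PlanState S K} {y : Ledger S d K}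

theorem Track.initial : Track p φ (PlanState.initial S K) (Ledger.empty S d K) where
  chain := .empty _
  fresh := .nil
  core l _ := by simp [PlanState.initial, Ledger.empty]
  est l _ := by simp [PlanState.initial, Ledger.empty]
  pol l _ s r _ hr := by
    have : r = 0 := by simpa [Ledger.empty] using hr
    simp [PlanState.initial, Ledger.policy, this]
  pol_of_notMem _ _ _ _ := rfl

theorem Track.setTrace (h : Track p φ x y) (tr : List (S × Fin K)) :
    Track p φ { x with trace := tr } y :=
  ⟨h.chain, h.fresh, h.core, h.est, h.pol, h.pol_of_notMem⟩

/-- Only level 0 gains newly covered states. Its policy has to be the initial one there, and this is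
why `Track` also records the policies outside the cover of the whole sequence. -/
theorem Track.append_zero (hp : 0 < p.lam) (h : Track p φ x y) {e : S × Fin K}
    (he : e ∉ actionCover p φ y.C) : Track p φ (x.append 0 [e]) (y.push e) where
  chain := h.chain.push e
  fresh := h.fresh.append_singleton he
  core l hl := by
    have h1 := h.core l hl
    have h2 := h.chain.len_le hl
    rcases Nat.eq_zero_or_pos l with rfl | h0
    · rw [h.chain.len_zero] at h1
      simp [PlanState.append, Ledger.push, h1]
    · simp [PlanState.append, Ledger.push, h0.ne', h1, List.take_append_of_le_length h2]
  est l hl := by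
    have h1 := h.est l hl
    have h2 := h.chain.meas_le l hl
    rcases Nat.eq_zero_or_pos l with rfl | h0
    · rw [h.chain.len_zero] at h1 h2
      simp [PlanState.append, Ledger.push, h1, Nat.sub_add_comm h2, List.replicate_add]
    · simpa [PlanState.append, Ledger.push, h0.ne'] using h1
  pol l hl s r hr hrl := by
    have h2 := h.chain.len_le hl
    have hr' : IsRank p φ y.C s r := hr.of_append
    rcases Nat.eq_zero_or_pos l with rfl | h0
    · have hpol : (y.push e).policy p φ s r 0 = 0 := by simp [Ledger.policy, Ledger.act]
      rw [hpol]
      by_cases hs : s ∈ cover p φ y.C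
      · have := h.pol 0 hl s r hr' (h.chain.len_zero ▸ hr'.mem_cover_iff.1 hs)
        simpa [PlanState.append, Ledger.policy, Ledger.act] using this
      · exact h.pol_of_notMem 0 hl s hs
    · refine (h.pol l hl s r hr' (by simpa [Ledger.push, h0.ne'] using hrl)).trans ?_
      exact Ledger.policy_congr fun _ _ _ => rfl
  pol_of_notMem l hl s hs := h.pol_of_notMem l hl s fun h' => hs (cover_append hp _ _ h')

theorem Track.findIdx_eq (h : Track p φ x y) {l : ℕ} (hl : l < p.horizon)
    (hm : y.meas l < y.len l) : (x.qbar l).findIdx Option.isNone = y.meas l := by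
  rw [h.est l hl, List.findIdx_append]
  have h1 : ((List.range (y.meas l)).map fun i => some (y.q l i)).findIdx Option.isNone =
      ((List.range (y.meas l)).map fun i => some (y.q l i)).length := by
    rw [List.findIdx_eq_length]; simp
  obtain ⟨k, hk⟩ : ∃ k, y.len l - y.meas l = k + 1 := ⟨y.len l - y.meas l - 1, by omega⟩
  rw [h1, if_neg (lt_irrefl _), hk, List.replicate_succ]
  simp [List.findIdx_cons]

theorem Track.none_mem_iff (h : Track p φ x y) {l : ℕ} (hl : l < p.horizon) :
    none ∈ x.qbar l ↔ y.meas l ≠ y.len l := by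
  have := h.chain.meas_le l hl
  rw [h.est l hl]
  simp
  omega

theorem Track.lmin_eq (h : Track p φ x y) {ℓ : ℕ} (hℓ : ℓ ≤ p.horizon)
    (hlt : ∀ l < ℓ, y.meas l = y.len l) (hm : ℓ < p.horizon → y.meas ℓ ≠ y.len ℓ) :
    x.lmin p.horizon = ℓ := by
  rw [PlanState.lmin]
  rcases hℓ.lt_or_eq with h' | h'
  · have : (List.range p.horizon).find? (fun l => decide (none ∈ x.qbar l)) = some ℓ := by
      rw [List.find?_range_eq_some]
      refine ⟨by simpa using (h.none_mem_iff h').2 (hm h'), by simpa using h', fun j hj => ?_⟩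
      have := (h.none_mem_iff (hj.trans h')).not.2 (not_not.2 (hlt j hj))
      simpa using this
    rw [this]
    rfl
  · have : (List.range p.horizon).find? (fun l => decide (none ∈ x.qbar l)) = none := by
      rw [List.find?_eq_none]
      intro l hl
      have hl' : l < p.horizon := by simpa using hl
      have := (h.none_mem_iff hl').not.2 (not_not.2 (hlt l (h' ▸ hl')))
      simpa using this
    rw [this, h']
    rfl

theorem Track.record (h : Track p φ x y) {l : ℕ} (hl : l < p.horizon)
    (hm : y.meas l < y.len l) (r : ℝ) :
    Track p φ { x with qbar := Function.update x.qbar l ((x.qbar l).set (y.meas l) (some r)) }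
      (y.record l r) where
  chain := h.chain.record hm r
  fresh := h.fresh
  core := h.core
  est l' hl' := by
    have h1 := h.est l' hl'
    by_cases e : l' = l
    · subst e
      simp only [Function.update_self, Ledger.record, h1]
      obtain ⟨k, hk⟩ : ∃ k, y.len l' - y.meas l' = k + 1 := ⟨y.len l' - y.meas l' - 1, by omega⟩
      have hk' : y.len l' - (y.meas l' + 1) = k := by omega
      rw [hk, hk', List.set_append_right _ _ (by simp), List.range_succ, List.map_append,
        List.append_assoc]
      congr 1
      · refine List.map_congr_left fun i hi => ?_
        rw [Function.update_of_ne (List.mem_range.1 hi).ne]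
      · simp [List.replicate_succ]
    · simpa [Ledger.record, e] using h1
  pol l' hl' s r' hr hrl := by
    rw [h.pol l' hl' s r' hr hrl]
    exact Ledger.policy_congr fun _ _ _ => rfl
  pol_of_notMem := h.pol_of_notMem

/-- For two prefixes of a list without repetitions, the members of the longer one outside the
shorter one are exactly its tail, in order. The decidability instance is arbitrary because the
planner uses a classical one. -/
theorem append_filter_notMem {α : Type*} {C A B : List α} (hC : C.Nodup) {m n : ℕ}
    (hmn : m ≤ n) (hA : A = C.take m) (hB : B = C.take n) (dec : DecidablePred fun e => e ∉ A) :
    A ++ B.filter (fun e => decide (e ∉ A)) = C.take n := by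
  have h1 : B = A ++ B.drop m := by
    conv_lhs => rw [← List.take_append_drop m B, hB, List.take_take, min_eq_left hmn, ← hA, ← hB]
  have hd : B.Nodup := hB ▸ hC.sublist (List.take_sublist _ _)
  rw [h1] at hd
  have h2 := (List.nodup_append.1 hd).2.2
  conv_lhs => rw [h1]
  conv_rhs => rw [← hB, h1]
  rw [List.filter_append, List.filter_eq_nil_iff.2 (by simp), List.nil_append,
    List.filter_eq_self.2]
  intro e he
  simpa using fun h' => h2 e h' e he rfl

/-- States whose rank is at most the old length of level `l + 1` keep their action, and their
vectors are not touched. States with rank between the old and the new length take the action of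
level `l`, improved by the new coefficients, which are written exactly at their positions. Other
states are not covered by the new level, and nothing is claimed of them unless the whole sequence
fails to cover them. -/
theorem Track.improve (hp : 0 < p.lam) {acc : Access S d K} (h : Track p acc.feature x y)
    {l : ℕ} (hl : l < p.horizon) (hm : y.meas l = y.len l) :
    Track p acc.feature (x.improve p acc l)
      (y.propagate l (lseCoef p acc.feature (y.C.take (y.len l)) (y.q l))) where
  chain := h.chain.propagate hl hm _
  fresh := h.fresh
  core l' hl' := by
    by_cases e : l' = l + 1
    · subst e
      simp only [PlanState.improve, PlanState.append, Function.update_self, Ledger.propagate]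
      exact append_filter_notMem (h.fresh.nodup hp)
        (h.chain.len_anti (show l ≤ l + 1 by omega) hl) (h.core (l + 1) hl) (h.core l hl.le) _
    · simpa [PlanState.improve, PlanState.append, Ledger.propagate, e] using h.core l' hl'
  est l' hl' := by
    have h1 := h.est l' hl'
    by_cases e : l' = l + 1
    · subst e
      have hle := h.chain.len_anti (show l ≤ l + 1 by omega) hl
      have hlen := congrArg List.length (append_filter_notMem (h.fresh.nodup hp) hle
        (h.core (l + 1) hl) (h.core l hl.le) (fun e => Classical.propDecidable _))
      have h2 := h.chain.len_le hl.le
      have h3 := h.chain.meas_le _ hl'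
      rw [List.length_append, List.length_take, min_eq_left h2, h.core (l + 1) hl,
        List.length_take, min_eq_left (hle.trans h2)] at hlen
      simp only [PlanState.improve, PlanState.append, Function.update_self, Ledger.propagate,
        h1, List.append_assoc, ← List.replicate_add]
      congr 2
      have h4 : ∀ z : ℕ, y.len (l + 1) + z = y.len l →
          y.len (l + 1) - y.meas (l + 1) + z = y.len l - y.meas (l + 1) := by omega
      refine h4 _ ?_
      rw [← hlen, h.core (l + 1) hl]
      congr!
    · simpa [PlanState.improve, PlanState.append, Ledger.propagate, e] using h1
  pol l' hl' s r hr hrl := by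
    by_cases e : l' = l + 1
    · subst e
      have hr1 : IsRank p acc.feature y.C s r := hr
      have hle := h.chain.len_anti (show l ≤ l + 1 by omega) hl
      have hN := h.chain.len_le hl.le
      simp only [Ledger.propagate, Function.update_self] at hrl
      have hc1 : s ∈ cover p acc.feature (x.C (l + 1)) ↔ r ≤ y.len (l + 1) := by
        rw [h.core _ hl]
        exact hr1 _ (hle.trans hN)
      have hc0 : s ∈ cover p acc.feature (x.C l) := by
        rw [h.core _ hl.le]
        exact (hr1 _ hN).2 hrl
      -- Here `y.len (l + 1)` is the length before the propagation: the frozen states come first,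
      -- then those that the level acquires now.
      by_cases hc : r ≤ y.len (l + 1)
      · have := h.pol (l + 1) hl s r hr1 hc
        simp only [PlanState.improve, PlanState.append, Function.update_self, if_pos (hc1.2 hc),
          this]
        refine Ledger.policy_congr fun h0 l' _ => ?_
        simp only [Ledger.propagate]
        rw [if_neg (by omega)]
      · have h2 := h.pol l hl.le s r hr1 hrl
        have hr0 : r ≠ 0 := by omega
        have hq : x.qbar l = (List.range (y.C.take (y.len l)).length).map
            fun i => some (y.q l i) := by
          rw [h.est l hl, hm, List.length_take, min_eq_left hN]
          simp
        simp only [PlanState.improve, PlanState.append, Function.update_self,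
          if_neg (hc1.not.2 hc)]
        rw [capiUpdate, Ledger.policy, if_neg hr0, Ledger.act, h2, Ledger.policy, if_neg hr0]
        have hact : (y.propagate l (lseCoef p acc.feature (y.C.take (y.len l)) (y.q l))).act p
            acc.feature s (r - 1) l = y.act p acc.feature s (r - 1) l := by
          refine Ledger.act_congr fun l' hl' => ?_
          simp only [Ledger.propagate]
          rw [if_neg (by omega)]
        -- Positions count from zero: a rank `r` with old length < `r` ≤ new length belongs to
        -- position `r - 1`, which is in the half-open interval that is overwritten.
        have hθ : (y.propagate l (lseCoef p acc.feature (y.C.take (y.len l)) (y.q l))).θ l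
            (r - 1) = lseCoef p acc.feature (y.C.take (y.len l)) (y.q l) :=
          if_pos ⟨rfl, by omega, by omega⟩
        rw [hact, hθ, improveAct]
        have hlse : lse p acc.feature (x.C l) (x.qbar l) s = fun b =>
            acc.feature s b ⬝ᵥ lseCoef p acc.feature (y.C.take (y.len l)) (y.q l) := by
          funext b
          rw [h.core l hl.le, hq, lse_eq]
        simp only [hlse, Set.mem_compl_iff, hc0, not_true_eq_false, not_false_eq_true, true_and]
    · have hrl' : r ≤ y.len l' := by simpa [Ledger.propagate, e] using hrl
      have := h.pol l' hl' s r hr hrl'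
      have h2 : (x.improve p acc l).pol l' = x.pol l' := by
        simp [PlanState.improve, PlanState.append, e]
      rw [h2, this]
      refine Ledger.policy_congr fun h0 l'' hl'' => ?_
      simp only [Ledger.propagate]
      -- A level above `l + 1` has a core sequence no longer than the old one of level `l + 1`, so
      -- none of its ranks refers to an overwritten position.
      rw [if_neg]
      rintro ⟨rfl, h3, -⟩
      have := h.chain.len_anti (show l'' + 1 ≤ l' by omega) hl'
      omega
  pol_of_notMem l' hl' s hs := by
    have hs0 : s ∉ cover p acc.feature y.C := hs
    by_cases e : l' = l + 1
    · subst e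
      have hc : ∀ l'' ≤ p.horizon, s ∉ cover p acc.feature (x.C l'') := fun l'' hl'' h' => by
        rw [h.core l'' hl''] at h'
        refine hs0 ?_
        rw [← List.take_append_drop (y.len l'') y.C]
        exact cover_append hp _ _ h'
      simp [PlanState.improve, PlanState.append, hc (l + 1) hl, hc l hl.le, capiUpdate,
        h.pol_of_notMem l hl.le s hs0]
    · have h2 : (x.improve p acc l).pol l' = x.pol l' := by
        simp [PlanState.improve, PlanState.append, e]
      rw [h2]
      exact h.pol_of_notMem l' hl' s hs0

end Ledger

/-! ### Subprograms -/

/-- `⟨φ(s, a), v⟩`, where `s` is in the state register `y`, `a` in the index register `x`, and `v` in the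
real cells from the address in the index register 17 on. The result is put into the real
register 10. -/
def dotCmd (x y : ℕ) : Cmd :=
  .setReal 10 (.ofIdx (.const 0)) ;;
  .forLoop 13 (.reg 0)
    (.feature 11 y (.reg x) (.reg 13) ;;
     .loadReal 12 (.plus (.reg 17) (.reg 13)) ;;
     .setReal 10 (.plus (.reg 10) (.times (.reg 11) (.reg 12))))

section PartialDot

variable {d : ℕ}

/-- The part of a dot product that comes from the coordinates below `k`. -/
noncomputable def partialDot (x v : Fin d → ℝ) (k : ℕ) : ℝ :=
  ∑ j : Fin d with j.val < k, x j * v j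

theorem partialDot_zero (x v : Fin d → ℝ) : partialDot x v 0 = 0 := by simp [partialDot]

theorem partialDot_succ (x v : Fin d → ℝ) (j : Fin d) :
    partialDot x v (j + 1) = partialDot x v j + x j * v j := by
  have : (Finset.univ.filter fun i : Fin d => i.val < j.val + 1) =
      insert j (Finset.univ.filter fun i : Fin d => i.val < j.val) := by
    ext i
    simp [Fin.ext_iff]
    omega
  rw [partialDot, this, Finset.sum_insert (by simp), add_comm, partialDot]

theorem partialDot_full (x v : Fin d → ℝ) : partialDot x v d = x ⬝ᵥ v := by
  simp [partialDot, dotProduct]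

end PartialDot

section Subprograms

variable {S : Type*} {d K : ℕ} {acc : Access S d K} {M : ℕ}

theorem dotCmd_runs {x y : ℕ} {σ : Store S K} (a : Fin K) (v : Fin d → ℝ) (hd : σ.idx 0 = d)
    (hx : x ≠ 13) (ha : σ.idx x = a) (hM : σ.idx 17 + d ≤ M)
    (hv : ∀ j : Fin d, σ.realMem (σ.idx 17 + j) = v j) :
    Runs acc M (dotCmd x y) σ (50 * (d + 1))
      fun σ' => σ'.real 10 = acc.feature (σ.state y) a ⬝ᵥ v := by
  apply Runs.le
  · unfold dotCmd
    apply Runs.seq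
    apply Runs.setReal
    apply Runs.forLoop d (fun j σ' => σ'.real 10 = partialDot (acc.feature (σ.state y) a) v j)
    · simp
    · intro σ' hf
      simp [IExp.value, hf.idx 0 (by simp), hd]
    · simp [RExp.value, IExp.value, partialDot_zero]
    · exact fun _ _ _ h => h
    · intro j hj σ' hf hxj hI
      lift j to Fin d using hj
      apply Runs.seq
      refine Runs.feature a j ?_ ?_ ?_
      · simp [IExp.value, hf.idx x (by simp [hx]), ha]
      · simp [IExp.value, hxj]
      apply Runs.seq
      apply Runs.loadReal
      · simp [IExp.value, hxj, hf.idx 17 (by simp)]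
        omega
      apply Runs.setReal
      have h17 := hf.idx 17 (by simp)
      have hs := hf.state y (by simp)
      have hm := hf.realMem (by simp)
      simp only at h17 hs hm
      simp [RExp.value, IExp.value, hI, hxj, h17, hs, hm, hv, partialDot_succ]
    · intro σ' _ hI
      rw [hI, partialDot_full]
  · simp [IExp.cost, RExp.cost]
    ring_nf
    omega

/-- `‖φ(s, a)‖²`, where `s` is in the state register 1, and `a` in the index register `x`. The
result is put into the real register 10. -/
def normSqCmd (x : ℕ) : Cmd :=
  .setReal 10 (.ofIdx (.const 0)) ;;
  .forLoop 13 (.reg 0)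
    (.feature 11 1 (.reg x) (.reg 13) ;;
     .setReal 10 (.plus (.reg 10) (.times (.reg 11) (.reg 11))))

theorem normSqCmd_runs {x : ℕ} {σ : Store S K} (a : Fin K) (hd : σ.idx 0 = d)
    (hx : x ≠ 13) (ha : σ.idx x = a) :
    Runs acc M (normSqCmd x) σ (50 * (d + 1))
      fun σ' => σ'.real 10 = acc.feature (σ.state 1) a ⬝ᵥ acc.feature (σ.state 1) a := by
  apply Runs.le
  · unfold normSqCmd
    apply Runs.seq
    apply Runs.setReal
    apply Runs.forLoop d (fun j σ' =>
      σ'.real 10 = partialDot (acc.feature (σ.state 1) a) (acc.feature (σ.state 1) a) j)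
    · simp
    · intro σ' hf
      simp [IExp.value, hf.idx 0 (by simp), hd]
    · simp [RExp.value, IExp.value, partialDot_zero]
    · exact fun _ _ _ h => h
    · intro j hj σ' hf hxj hI
      lift j to Fin d using hj
      apply Runs.seq
      refine Runs.feature a j ?_ ?_ ?_
      · simp [IExp.value, hf.idx x (by simp [hx]), ha]
      · simp [IExp.value, hxj]
      apply Runs.setReal
      have hs := hf.state 1 (by simp)
      simp only at hs
      simp [RExp.value, hI, hs, partialDot_succ]
    · intro σ' _ hI
      rw [hI, partialDot_full]
  · simp [IExp.cost, RExp.cost]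
    ring_nf
    omega

/-- Address of the slot `l ≤ H` of the record of the core pair number `i`. A slot has `d + 1`
cells. -/
def slot (d H i l : ℕ) : ℕ := d + 2 + (i * (H + 1) + l) * (d + 1)

/-- Layout of the real memory: the cells 0 and 1 hold λ and ω, the next `d` cells are scratch space
for least squares, and then the records follow. In the record of a pair, slot 0 holds the vector u
and, in its last cell, D; slot `l + 1` holds the coefficients of level `l` and, in its last cell,
the estimate at level `l`. -/
theorem slot_add_le {H i l N : ℕ} (hi : i < N) (hl : l ≤ H) :
    slot d H i l + (d + 1) ≤ slot d H N 0 := by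
  have h1 : i * (H + 1) + l + 1 ≤ N * (H + 1) + 0 := by
    have := Nat.mul_le_mul_right (H + 1) (Nat.succ_le_of_lt hi)
    rw [Nat.succ_mul] at this
    omega
  have h2 := Nat.mul_le_mul_right (d + 1) h1
  rw [Nat.succ_mul] at h2
  unfold slot
  omega

/-- An address is a mixed-radix number with digits `i`, `l`, `j`, so two divisions with remainder
recover them. The offset `d` is admitted because it is the scalar cell of a slot. -/
theorem slot_inj {H i l j i' l' j' : ℕ} (hl : l ≤ H) (hl' : l' ≤ H) (hj : j ≤ d) (hj' : j' ≤ d)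
    (h : slot d H i l + j = slot d H i' l' + j') : i = i' ∧ l = l' ∧ j = j' := by
  have key : ∀ {b u v u' v' : ℕ}, v < b → v' < b → u * b + v = u' * b + v' → u = u' ∧ v = v' := by
    intro b u v u' v' hv hv' h
    have h1 := congrArg (· / b) h
    have h2 := congrArg (· % b) h
    have hb : 0 < b := by omega
    simp only [Nat.mul_add_mod', Nat.mod_eq_of_lt hv, Nat.mod_eq_of_lt hv'] at h2
    simp only [mul_comm _ b, Nat.mul_add_div hb, Nat.div_eq_of_lt hv, Nat.div_eq_of_lt hv',
      add_zero] at h1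
    exact ⟨h1, h2⟩
  have h0 : (i * (H + 1) + l) * (d + 1) + j = (i' * (H + 1) + l') * (d + 1) + j' := by
    unfold slot at h; omega
  obtain ⟨h1, h2⟩ := key (by omega) (by omega) h0
  obtain ⟨h3, h4⟩ := key (by omega) (by omega) h1
  exact ⟨h3, h4, h2⟩

/-- Address of a slot, with `d` in the index register 0, and `H` in the index register 2. -/
def slotExp (i l : IExp) : IExp :=
  .plus (.plus (.reg 0) (.const 2))
    (.times (.plus (.times i (.plus (.reg 2) (.const 1))) l) (.plus (.reg 0) (.const 1)))

theorem slotExp_value (σ : Store S K) (i l : IExp) :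
    (slotExp i l).value σ = slot (σ.idx 0) (σ.idx 2) (i.value σ) (l.value σ) := rfl

@[simp] theorem slotExp_cost (i l : IExp) : (slotExp i l).cost = i.cost + l.cost + 13 := by
  simp [slotExp, IExp.cost]; ring

/-- The registers and memory cells on which coverage tests and policies depend. -/
structure Tables (p : Params) (φ : S → Fin K → Fin d → ℝ) (y : Ledger S d K) (σ : Store S K) :
    Prop where
  dim : σ.idx 0 = d
  actions : σ.idx 1 = K
  horizon : σ.idx 2 = p.horizon
  size : σ.idx 3 = y.C.length
  omega : σ.real 1 = p.ω
  lam : σ.real 5 = p.lam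
  dir : ∀ (i : ℕ) (hi : i < y.C.length) (j : Fin d),
    σ.realMem (slot d p.horizon i 0 + j) = updateDir p φ (y.C.take i) y.C[i] j
  den : ∀ (i : ℕ) (hi : i < y.C.length),
    σ.realMem (slot d p.horizon i 0 + d) = updateDen p φ (y.C.take i) y.C[i]
  coef : ∀ l < p.horizon, ∀ i < y.len (l + 1), ∀ j : Fin d,
    σ.realMem (slot d p.horizon i (l + 1) + j) = y.θ l i j

theorem Tables.of_eq {p : Params} {φ : S → Fin K → Fin d → ℝ} {y : Ledger S d K}
    {σ σ' : Store S K} (h : Tables p φ y σ) (h0 : σ'.idx 0 = σ.idx 0) (h1 : σ'.idx 1 = σ.idx 1)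
    (h2 : σ'.idx 2 = σ.idx 2) (h3 : σ'.idx 3 = σ.idx 3) (hr1 : σ'.real 1 = σ.real 1)
    (hr5 : σ'.real 5 = σ.real 5) (hm : σ'.realMem = σ.realMem) : Tables p φ y σ' where
  dim := h0.trans h.dim
  actions := h1.trans h.actions
  horizon := h2.trans h.horizon
  size := h3.trans h.size
  omega := hr1.trans h.omega
  lam := hr5.trans h.lam
  dir := hm ▸ h.dir
  den := hm ▸ h.den
  coef := hm ▸ h.coef

/-- Determine the rank of the state in the state register 1, and the first of its actions that is
not covered (`K` if there is none). The results are put into the index registers 11 and 10. -/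
def coverCmd : Cmd :=
  .setIdx 10 (.reg 1) ;; .setIdx 11 (.const 0) ;;
  .forLoop 14 (.reg 1)
    (normSqCmd 14 ;;
     .setReal 13 (.quot (.reg 10) (.reg 5)) ;;
     .forLoop 15 (.reg 3)
       (.ite (.conj (.neg (.leReal (.reg 13) (.ofIdx (.const 1))))
            (.ltIdx (.reg 11) (.plus (.reg 15) (.const 1))))
          (.setIdx 11 (.plus (.reg 15) (.const 1))) .skip ;;
        .setIdx 17 (slotExp (.reg 15) (.const 0)) ;;
        dotCmd 14 1 ;;
        .loadReal 12 (.plus (.reg 17) (.reg 0)) ;;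
        .setReal 13 (.minus (.reg 13) (.quot (.times (.reg 10) (.reg 10)) (.reg 12)))) ;;
     .ite (.neg (.leReal (.reg 13) (.ofIdx (.const 1))))
       (.setIdx 11 (.plus (.reg 3) (.const 1)) ;;
        .ite (.ltIdx (.reg 10) (.reg 1)) .skip (.setIdx 10 (.reg 14)))
       .skip)

/-- `u` is the number of the first action of `s` that is not covered by `C`, and `K` if there is
none. -/
def IsFirstUncovered (p : Params) (φ : S → Fin K → Fin d → ℝ) (C : List (S × Fin K)) (s : S)
    (u : ℕ) : Prop :=
  (firstAction (fun a => (s, a) ∉ actionCover p φ C) = none ∧ u = K) ∨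
    ∃ a : Fin K, firstAction (fun a => (s, a) ∉ actionCover p φ C) = some a ∧ u = a ∧
      (s, a) ∉ actionCover p φ C

variable {p : Params} {y : Ledger S d K}

/-- The pass subtracts one Sherman–Morrison term per pair, starting from the value for the empty
prefix, and raises register 11 to `n + 1` whenever the prefix of length `n` fails to cover. A
maximum is described by its upper bounds, so that the passes for the different actions compose. The
whole sequence itself is not tested here. -/
theorem updateRank_runs (hp : 0 < p.lam) {σ : Store S K} (hT : Tables p acc.feature y σ)
    (hM : slot d p.horizon y.C.length 0 ≤ M) (a : Fin K) (ha : σ.idx 14 = a)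
    (hv : σ.real 13 = invQuad p acc.feature [] (acc.feature (σ.state 1) a)) :
    Runs acc M (.forLoop 15 (.reg 3)
       (.ite (.conj (.neg (.leReal (.reg 13) (.ofIdx (.const 1))))
            (.ltIdx (.reg 11) (.plus (.reg 15) (.const 1))))
          (.setIdx 11 (.plus (.reg 15) (.const 1))) .skip ;;
        .setIdx 17 (slotExp (.reg 15) (.const 0)) ;;
        dotCmd 14 1 ;;
        .loadReal 12 (.plus (.reg 17) (.reg 0)) ;;
        .setReal 13 (.minus (.reg 13) (.quot (.times (.reg 10) (.reg 10)) (.reg 12)))))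
      σ ((y.C.length + 1) * (150 * (d + 1)))
      fun σ' => σ'.real 13 = invQuad p acc.feature y.C (acc.feature (σ.state 1) a) ∧
        ∀ m, σ'.idx 11 ≤ m ↔ σ.idx 11 ≤ m ∧ ∀ i < y.C.length, m ≤ i →
          (σ.state 1, a) ∈ actionCover p acc.feature (y.C.take i) := by
  apply Runs.le
  · apply Runs.forLoop y.C.length (fun n σ' =>
      σ'.real 13 = invQuad p acc.feature (y.C.take n) (acc.feature (σ.state 1) a) ∧
        ∀ m, σ'.idx 11 ≤ m ↔ σ.idx 11 ≤ m ∧ ∀ i < n, m ≤ i →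
          (σ.state 1, a) ∈ actionCover p acc.feature (y.C.take i))
    · simp [dotCmd]
    · intro σ' hf
      simp [IExp.value, hf.idx 3 (by simp [dotCmd]), hT.size]
    · simpa using hv
    · intro n σ' v h
      simpa using h
    · intro n hn σ' hf hxn ⟨hI, hr⟩
      have hT' : Tables p acc.feature y σ' := by
        refine hT.of_eq (hf.idx _ ?_) (hf.idx _ ?_) (hf.idx _ ?_) (hf.idx _ ?_) (hf.real _ ?_)
          (hf.real _ ?_) (hf.realMem ?_) <;> simp [dotCmd]
      have hs : σ'.state 1 = σ.state 1 := hf.state 1 (by simp [dotCmd])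
      have ha' : σ'.idx 14 = a := (hf.idx 14 (by simp [dotCmd])).trans ha
      have hslot := slot_add_le (d := d) (H := p.horizon) hn (Nat.zero_le _)
      apply Runs.seq
      apply Runs.monoFrame (Q := fun σ₁ => ∀ m, σ₁.idx 11 ≤ m ↔ σ.idx 11 ≤ m ∧ ∀ i < n + 1,
        m ≤ i → (σ.state 1, a) ∈ actionCover p acc.feature (y.C.take i))
      · have hcov : (σ.state 1, a) ∈ actionCover p acc.feature (y.C.take n) ↔ σ'.real 13 ≤ 1 := by
          rw [mem_actionCover_iff, hI]
        have split : ∀ m, (∀ i < n + 1, m ≤ i → (σ.state 1, a) ∈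
            actionCover p acc.feature (y.C.take i)) ↔ (∀ i < n, m ≤ i → (σ.state 1, a) ∈
            actionCover p acc.feature (y.C.take i)) ∧ (m ≤ n → σ'.real 13 ≤ 1) := by
          intro m
          rw [← hcov]
          refine ⟨fun h => ⟨fun i hi => h i (by omega), h n (by omega)⟩, fun h i hi hm => ?_⟩
          rcases Nat.lt_succ_iff_lt_or_eq.1 hi with hi | rfl
          exacts [h.1 i hi hm, h.2 hm]
        apply Runs.ite
        · intro hb
          simp [Test.Holds, RExp.value, IExp.value, hxn] at hb
          apply Runs.setIdx
          intro m
          have := hr m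
          rw [split, ← and_assoc, ← this]
          simp [IExp.value, hxn, not_le.2 hb.1]
          omega
        · intro hb
          simp [Test.Holds, RExp.value, IExp.value, hxn] at hb
          apply Runs.skip
          intro m
          have := hr m
          rw [split, ← and_assoc, ← this, iff_self_and]
          intro h1 h2
          by_contra h3
          have := hb (not_le.1 h3)
          omega
      · intro σ₁ hr₁ hf₁
        have h0 : σ₁.idx 0 = d := (hf₁.idx 0 (by simp)).trans hT'.dim
        have h2 : σ₁.idx 2 = p.horizon := (hf₁.idx 2 (by simp)).trans hT'.horizon
        have h15 : σ₁.idx 15 = n := (hf₁.idx 15 (by simp)).trans hxn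
        have hm₁ : σ₁.realMem = σ'.realMem := hf₁.realMem (by simp)
        have hr₁' : σ₁.real 13 = σ'.real 13 := hf₁.real 13 (by simp)
        apply Runs.seq
        apply Runs.setIdx
        apply Runs.seq
        refine (dotCmd_runs a (updateDir p acc.feature (y.C.take n) y.C[n]) ?_ (by norm_num) ?_
          ?_ ?_).monoFrame ?_
        · simpa using h0
        · simpa [ha'] using hf₁.idx 14 (by simp)
        · simp [slotExp_value, IExp.value, h0, h2, h15]
          omega
        · intro j
          simpa [slotExp_value, IExp.value, h0, h2, h15, hm₁] using hT'.dir n hn j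
        · intro σ₂ hd₂ hf₂
          have h17 := hf₂.idx 17 (by simp [dotCmd])
          have h0' := hf₂.idx 0 (by simp [dotCmd])
          have h11 := hf₂.idx 11 (by simp [dotCmd])
          have h13 := hf₂.real 13 (by simp [dotCmd])
          have hm₂ := hf₂.realMem (by simp [dotCmd])
          have hs₁ := hf₁.state 1 (by simp)
          simp [slotExp_value, IExp.value, h0, h2, h15] at h17 h0' h11 h13 hm₂ hd₂
          apply Runs.seq
          apply Runs.loadReal
          · simp [IExp.value, h17, h0']
            omega
          apply Runs.setReal
          refine ⟨?_, fun m => ?_⟩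
          · have hden := hT'.den n hn
            rw [List.take_succ_eq_append_getElem hn, invQuad_append_singleton hp, ← hI]
            simp [RExp.value, IExp.value, h17, h0', h13, hm₂, hm₁, hr₁', hd₂, hs₁, hs, hden]
          · simpa [h11] using hr₁ m
    · intro σ' _ h
      simpa using h
  · simp only [IExp.cost, RExp.cost, Test.cost, slotExp_cost]
    exact Nat.mul_le_mul_left _ (by omega)

/-- By monotonicity, a prefix covers the state iff it is at least as long as the first covering
prefix of each action, so the rank is a maximum over actions. An action that the whole sequence does
not cover pushes it to the length plus one. In register 10, the impossible action `K` means that no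
uncovered action has been met. -/
theorem coverCmd_runs (hp : 0 < p.lam) {σ : Store S K} (hT : Tables p acc.feature y σ)
    (hM : slot d p.horizon y.C.length 0 ≤ M) :
    Runs acc M coverCmd σ (400 * ((K + 1) * ((y.C.length + 1) * (d + 1))))
      fun σ' => IsRank p acc.feature y.C (σ.state 1) (σ'.idx 11) ∧
        IsFirstUncovered p acc.feature y.C (σ.state 1) (σ'.idx 10) := by
  have hN : (σ.idx 3) = y.C.length := hT.size
  apply Runs.le
  · unfold coverCmd
    apply Runs.seq
    apply Runs.setIdx
    apply Runs.seq
    apply Runs.setIdx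
    apply Runs.forLoop K (fun k σ' =>
      (∀ m ≤ y.C.length, (∀ a : Fin K, a.val < k →
        (σ.state 1, a) ∈ actionCover p acc.feature (y.C.take m)) ↔ σ'.idx 11 ≤ m) ∧
      ((σ'.idx 10 = K ∧ ∀ a : Fin K, a.val < k → (σ.state 1, a) ∈ actionCover p acc.feature y.C) ∨
        ∃ a : Fin K, σ'.idx 10 = a ∧ (σ.state 1, a) ∉ actionCover p acc.feature y.C ∧
          ∀ b < a, (σ.state 1, b) ∈ actionCover p acc.feature y.C))
    · simp [dotCmd, normSqCmd]
    · intro σ' hf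
      simpa [IExp.value, hT.actions] using hf.idx 1 (by simp [dotCmd, normSqCmd])
    · simp [IExp.value, hT.actions]
    · intro k σ' v h
      simpa using h
    · intro k hk σ' hf hxk ⟨hr, hu⟩
      lift k to Fin K using hk
      have hT' : Tables p acc.feature y σ' := by
        refine hT.of_eq ((hf.idx _ ?_).trans ?_) ((hf.idx _ ?_).trans ?_) ((hf.idx _ ?_).trans ?_)
          ((hf.idx _ ?_).trans ?_) (hf.real _ ?_) (hf.real _ ?_) (hf.realMem ?_) <;>
          simp [dotCmd, normSqCmd]
      have hs : σ'.state 1 = σ.state 1 := hf.state 1 (by simp [dotCmd, normSqCmd])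
      apply Runs.seq
      refine (normSqCmd_runs k hT'.dim (by norm_num) hxk).monoFrame fun σ₁ hn₁ hf₁ => ?_
      apply Runs.seq
      apply Runs.setReal
      apply Runs.seq
      have hT₁ : Tables p acc.feature y
          { σ₁ with
            real := Function.update σ₁.real 13 (RExp.value σ₁ (.quot (.reg 10) (.reg 5))) } := by
        refine hT'.of_eq (hf₁.idx _ ?_) (hf₁.idx _ ?_) (hf₁.idx _ ?_) (hf₁.idx _ ?_)
          ?_ ?_ (hf₁.realMem ?_)
        · simp [normSqCmd]
        · simp [normSqCmd]
        · simp [normSqCmd]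
        · simp [normSqCmd]
        · simpa using hf₁.real 1 (by simp [normSqCmd])
        · simpa using hf₁.real 5 (by simp [normSqCmd])
        · simp [normSqCmd]
      have hs₁ : σ₁.state 1 = σ.state 1 := (hf₁.state 1 (by simp [normSqCmd])).trans hs
      refine (updateRank_runs hp hT₁ hM k ?_ ?_).monoFrame ?_
      · simp [hf₁.idx 14 (by simp [normSqCmd]), hxk]
      · have h5 : σ₁.real 5 = p.lam := by simpa using hT₁.lam
        simp [RExp.value, invQuad_nil hp, hn₁, hs, hs₁, h5]
      intro σ₂ ⟨hv₂, hr₂⟩ hf₂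
      have h3 : σ₂.idx 3 = y.C.length :=
        (hf₂.idx 3 (by simp [dotCmd])).trans hT₁.size
      have h1 : σ₂.idx 1 = K := (hf₂.idx 1 (by simp [dotCmd])).trans hT₁.actions
      have h14 : σ₂.idx 14 = k := by
        simpa [hxk] using (hf₂.idx 14 (by simp [dotCmd])).trans
          (hf₁.idx 14 (by simp [normSqCmd]))
      have h10 : σ₂.idx 10 = σ'.idx 10 :=
        (hf₂.idx 10 (by simp [dotCmd])).trans (hf₁.idx 10 (by simp [normSqCmd]))
      have h11 : σ₁.idx 11 = σ'.idx 11 := hf₁.idx 11 (by simp [normSqCmd])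
      simp only [hs₁, h11] at hv₂ hr₂
      have hcov : (σ.state 1, k) ∈ actionCover p acc.feature y.C ↔ σ₂.real 13 ≤ 1 := by
        rw [mem_actionCover_iff, hv₂]
      have split : ∀ P : Fin K → Prop, (∀ a : Fin K, a.val < k.val + 1 → P a) ↔
          (∀ a : Fin K, a.val < k.val → P a) ∧ P k := by
        refine fun P => ⟨fun h => ⟨fun a ha => h a (by omega), h k (by omega)⟩,
          fun h a ha => ?_⟩
        rcases Nat.lt_succ_iff_lt_or_eq.1 ha with ha | ha
        exacts [h.1 a ha, Fin.ext ha ▸ h.2]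
      apply Runs.ite
      · intro hb
        simp [Test.Holds, RExp.value, IExp.value] at hb
        have hnc : (σ.state 1, k) ∉ actionCover p acc.feature y.C := by
          rw [hcov]; exact not_le.2 hb
        -- An action that the whole sequence leaves uncovered is not covered by any prefix, so no
        -- admissible length qualifies.
        have hrank : ∀ m ≤ y.C.length, (∀ a : Fin K, a.val < k.val + 1 →
            (σ.state 1, a) ∈ actionCover p acc.feature (y.C.take m)) ↔
            y.C.length + 1 ≤ m := by
          intro m hm
          rw [split]
          refine ⟨fun h => absurd ?_ hnc, fun h => by omega⟩
          have := actionCover_take_mono hp y.C hm h.2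
          rwa [List.take_length] at this
        apply Runs.seq
        apply Runs.setIdx
        apply Runs.ite
        · intro hb'
          simp [Test.Holds, IExp.value, h10, h1] at hb'
          apply Runs.skip
          refine ⟨?_, ?_⟩
          · simpa [IExp.value, h3] using hrank
          · rcases hu with ⟨hu, -⟩ | hu
            · omega
            · right
              simpa [h10] using hu
        · intro hb'
          simp [Test.Holds, IExp.value, h10, h1] at hb'
          apply Runs.setIdx
          refine ⟨?_, ?_⟩
          · simpa [IExp.value, h3] using hrank
          · rcases hu with ⟨-, hu⟩ | ⟨a, hu, -⟩
            · right
              refine ⟨k, by simp [IExp.value, h14], hnc, fun b hb => hu b hb⟩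
            · have := a.2
              omega
      · intro hb
        simp [Test.Holds, RExp.value, IExp.value] at hb
        have hc : (σ.state 1, k) ∈ actionCover p acc.feature y.C := hcov.2 hb
        apply Runs.skip
        refine ⟨fun m hm => ?_, ?_⟩
        · rw [hr₂ m, split, hr m hm]
          refine and_congr_right fun _ => ⟨fun h i _ hmi => actionCover_take_mono hp _ hmi h,
            fun h => ?_⟩
          -- The inner loop tests proper prefixes only; for the full length the test after the loop
          -- supplies the coverage.
          rcases hm.lt_or_eq with hm | rfl
          · exact h m hm le_rfl
          · rwa [List.take_length]
        · rw [h10, split]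
          rcases hu with hu | hu
          · exact .inl ⟨hu.1, hu.2, hc⟩
          · exact .inr hu
    · intro σ' _ ⟨hr, hu⟩
      refine ⟨fun m hm => ?_, ?_⟩
      · rw [← hr m hm]
        exact ⟨fun h a _ => h a, fun h a => h a a.2⟩
      · rcases hu with ⟨hu, h⟩ | ⟨a, hu, h1, h2⟩
        · exact .inl ⟨firstAction_eq_none.2 fun a => not_not.2 (h a a.2), hu⟩
        · exact .inr ⟨a, firstAction_eq_some h1 fun b hb => not_not.2 (h2 b hb), hu, h1⟩
  · simp only [IExp.cost, RExp.cost, Test.cost]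
    have h1 : 1 ≤ (y.C.length + 1) * (d + 1) := Nat.one_le_iff_ne_zero.2 (by positivity)
    have h2 : d + 1 ≤ (y.C.length + 1) * (d + 1) := Nat.le_mul_of_pos_left _ (by omega)
    have h3 : 1 ≤ (K + 1) * ((y.C.length + 1) * (d + 1)) := Nat.one_le_iff_ne_zero.2 (by positivity)
    generalize hA : (y.C.length + 1) * (d + 1) = A at h1 h2 h3 ⊢
    have h4 : (y.C.length + 1) * (150 * (d + 1)) = 150 * A := by rw [← hA]; ring
    rw [h4]
    have h5 : 400 * ((K + 1) * A) = (K + 1) * (350 * A) + 50 * ((K + 1) * A) := by ring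
    rw [h5]
    refine le_trans (b := 1 + 1 + (1 + 1 + (K + 1) * (350 * A))) ?_ (by omega)
    refine Nat.add_le_add_left (Nat.add_le_add_left (Nat.mul_le_mul_left _ ?_) _) _
    omega

end Subprograms
-- Evaluation of policies from stored coefficients
section PolicyProgram

variable {S : Type*} {d K : ℕ} {acc : Access S d K} {M : ℕ} {p : Params} {y : Ledger S d K}

/-- Maximize `⟨φ(s, ·), v⟩`, where `s` is in the state register 1, and `v` in the real cells from
the address in the index register 17 on. The maximum is put into the real register 14, and the
first maximizer into the index register 18. -/
def argmaxCmd : Cmd :=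
  .setIdx 18 (.const 0) ;; dotCmd 18 1 ;; .setReal 14 (.reg 10) ;;
  .forLoop 14 (.reg 1)
    (dotCmd 14 1 ;;
     .ite (.leReal (.reg 10) (.reg 14)) .skip (.setReal 14 (.reg 10) ;; .setIdx 18 (.reg 14)))

theorem argmaxCmd_runs [NeZero K] {σ : Store S K} (v : Fin d → ℝ) (hd : σ.idx 0 = d)
    (hK : σ.idx 1 = K) (hM : σ.idx 17 + d ≤ M)
    (hv : ∀ j : Fin d, σ.realMem (σ.idx 17 + j) = v j) :
    Runs acc M argmaxCmd σ (150 * ((K + 1) * (d + 1))) fun σ' =>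
      σ'.idx 18 = argmaxFirst (fun b => acc.feature (σ.state 1) b ⬝ᵥ v) ∧
      σ'.real 14 = Finset.univ.sup' Finset.univ_nonempty
        (fun b => acc.feature (σ.state 1) b ⬝ᵥ v) := by
  set q : Fin K → ℝ := fun b => acc.feature (σ.state 1) b ⬝ᵥ v with hq
  apply Runs.le
  · unfold argmaxCmd
    apply Runs.seq
    apply Runs.setIdx
    apply Runs.seq
    refine (dotCmd_runs 0 v ?_ (by norm_num) ?_ ?_ ?_).monoFrame ?_
    · simpa using hd
    · simp [IExp.value]
    · simpa using hM
    · simpa using hv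
    intro σ₁ h₁ hf₁
    apply Runs.seq
    apply Runs.setReal
    apply Runs.forLoop K (fun k σ' => ∃ a : Fin K, σ'.idx 18 = a ∧ σ'.real 14 = q a ∧
      (∀ b : Fin K, b.val < k → q b ≤ q a) ∧ ∀ b < a, q b < q a)
    · simp [dotCmd]
    · intro σ' hf
      have h2 := hf₁.idx 1 (by simp [dotCmd])
      simpa [IExp.value, h2, hK] using hf.idx 1 (by simp [dotCmd])
    · refine ⟨0, ?_, ?_, ?_, ?_⟩
      · simpa [IExp.value] using hf₁.idx 18 (by simp [dotCmd])
      · simpa [RExp.value] using h₁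
      · simp
      · simp
    · intro k σ' v h
      simpa using h
    · intro k hk σ' hf hxk ⟨a, ha, hb, hle, hlt⟩
      lift k to Fin K using hk
      have h0 : σ'.idx 0 = d := (hf.idx 0 (by simp [dotCmd])).trans
        ((hf₁.idx 0 (by simp [dotCmd])).trans (by simpa using hd))
      have h17 : σ'.idx 17 = σ.idx 17 := (hf.idx 17 (by simp [dotCmd])).trans
        ((hf₁.idx 17 (by simp [dotCmd])).trans (by simp))
      have hm : σ'.realMem = σ.realMem := (hf.realMem (by simp [dotCmd])).trans
        ((hf₁.realMem (by simp [dotCmd])).trans (by simp))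
      have hs : σ'.state 1 = σ.state 1 := (hf.state 1 (by simp [dotCmd])).trans
        ((hf₁.state 1 (by simp [dotCmd])).trans (by simp))
      apply Runs.seq
      refine (dotCmd_runs k v h0 (by norm_num) hxk (by rwa [h17]) ?_).monoFrame ?_
      · simpa [h17, hm] using hv
      intro σ₂ h₂ hf₂
      have h18 := hf₂.idx 18 (by simp [dotCmd])
      have h14 := hf₂.idx 14 (by simp [dotCmd])
      have hr14 := hf₂.real 14 (by simp [dotCmd])
      have h₂' : σ₂.real 10 = q k := by rw [h₂, hs]
      have split : ∀ P : Fin K → Prop, (∀ a : Fin K, a.val < k.val → P a) → P k →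
          (∀ a : Fin K, a.val < k.val + 1 → P a) := by
        intro P h h' a ha
        rcases Nat.lt_succ_iff_lt_or_eq.1 ha with ha | ha
        exacts [h a ha, Fin.ext ha ▸ h']
      apply Runs.ite
      · intro ht
        simp [Test.Holds, RExp.value, h₂', hr14, hb] at ht
        apply Runs.skip
        exact ⟨a, h18.trans ha, hr14.trans hb, split _ hle ht, hlt⟩
      · intro ht
        simp [Test.Holds, RExp.value, h₂', hr14, hb] at ht
        apply Runs.seq
        apply Runs.setReal
        apply Runs.setIdx
        -- The candidate changes only on strict improvement, so every earlier action stays strictly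
        -- below it, which makes it the maximizer of lowest index.
        refine ⟨k, ?_, ?_, split _ (fun b hb => ((hle b hb).trans_lt ht).le) le_rfl,
          fun b hb => (hle b hb).trans_lt ht⟩
        · simp [IExp.value, h14, hxk]
        · simpa [RExp.value] using h₂'
    · intro σ' _ ⟨a, ha, hb, hle, hlt⟩
      have hle' : ∀ b, q b ≤ q a := fun b => hle b b.2
      refine ⟨by rw [ha, argmaxFirst_eq hle' hlt], hb.trans (le_antisymm ?_ ?_)⟩
      · exact Finset.le_sup' q (Finset.mem_univ a)
      · exact Finset.sup'_le _ _ fun b _ => hle' b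
  · simp only [IExp.cost, RExp.cost, Test.cost]
    have h1 : d + 1 ≤ (K + 1) * (d + 1) := Nat.le_mul_of_pos_left _ (by omega)
    have h2 := Nat.mul_le_mul_left (K + 1) (show 50 * (d + 1) + (1 + 1 + 1 + (1 + (1 + 1 + (1 + 1)))) +
      (1 + 10) ≤ 80 * (d + 1) by omega)
    rw [mul_left_comm (K + 1) 80] at h2
    omega

/-- Determine the action of the policy whose level is in the index register 6, in the state in the
state register 1, whose rank is in the index register 11. The result is put into the index
register 12. -/
def policyCmd : Cmd :=
  .setIdx 12 (.const 0) ;;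
  .ite (.conj (.ltIdx (.const 0) (.reg 11)) (.neg (.ltIdx (.reg 3) (.reg 11))))
    (.forLoop 16 (.reg 6)
      (.setIdx 17 (slotExp (.minus (.reg 11) (.const 1)) (.plus (.reg 16) (.const 1))) ;;
       dotCmd 12 1 ;;
       .setReal 15 (.reg 10) ;;
       argmaxCmd ;;
       .ite (.leReal (.minus (.reg 14) (.reg 1)) (.plus (.reg 15) (.reg 1))) .skip
         (.setIdx 12 (.reg 18))))
    .skip

/-- The action is carried up through the levels, with one improvement at each level by the vector at
position `r - 1`; the hypothesis `hlen` guarantees that these vectors have been stored. A state of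
rank 0 is covered before any pair is present, and a state beyond the last rank by none, so the
initial action applies to both. -/
theorem policyCmd_runs [NeZero K] {σ : Store S K} (hT : Tables p acc.feature y σ)
    (hM : slot d p.horizon y.C.length 0 ≤ M) {r l : ℕ} (hr : σ.idx 11 = r) (hl : σ.idx 6 = l)
    (hlH : l ≤ p.horizon) (hlen : r ≤ y.C.length → ∀ l' < l, r ≤ y.len (l' + 1)) :
    Runs acc M policyCmd σ (400 * ((l + 1) * ((K + 1) * (d + 1)))) fun σ' =>
      σ'.idx 12 = if r ≤ y.C.length then (y.policy p acc.feature (σ.state 1) r l : ℕ) else 0 := by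
  apply Runs.le
  · unfold policyCmd
    apply Runs.seq
    apply Runs.setIdx
    apply Runs.ite
    · intro hb
      simp [Test.Holds, IExp.value, hr, hT.size] at hb
      apply Runs.forLoop l (fun n σ' =>
        σ'.idx 12 = y.act p acc.feature (σ.state 1) (r - 1) n)
      · simp [dotCmd, argmaxCmd]
      · intro σ' hf
        simpa [IExp.value, hl] using hf.idx 6 (by simp [dotCmd, argmaxCmd])
      · simp [IExp.value, Ledger.act]
      · intro n σ' v h
        simpa using h
      · intro n hn σ' hf hxn hI
        have h0 : σ'.idx 0 = d := (hf.idx 0 (by simp [dotCmd, argmaxCmd])).trans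
          (by simpa using hT.dim)
        have h1 : σ'.idx 1 = K := (hf.idx 1 (by simp [dotCmd, argmaxCmd])).trans
          (by simpa using hT.actions)
        have h2 : σ'.idx 2 = p.horizon := (hf.idx 2 (by simp [dotCmd, argmaxCmd])).trans
          (by simpa using hT.horizon)
        have h11 : σ'.idx 11 = r := (hf.idx 11 (by simp [dotCmd, argmaxCmd])).trans
          (by simpa using hr)
        have hr1 : σ'.real 1 = p.ω := (hf.real 1 (by simp [dotCmd, argmaxCmd])).trans
          (by simpa using hT.omega)
        have hm : σ'.realMem = σ.realMem := (hf.realMem (by simp [dotCmd, argmaxCmd]))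
        have hs : σ'.state 1 = σ.state 1 := (hf.state 1 (by simp [dotCmd, argmaxCmd]))
        have hslot := slot_add_le (d := d) (H := p.horizon) (l := n + 1)
          (show r - 1 < y.C.length by omega) (by omega)
        have hcoef := hT.coef n (by omega) (r - 1) (by have := hlen hb.2 n hn; omega)
        apply Runs.seq
        apply Runs.setIdx
        apply Runs.seq
        refine (dotCmd_runs (y.act p acc.feature (σ.state 1) (r - 1) n) (y.θ n (r - 1))
          ?_ (by norm_num) ?_ ?_ ?_).monoFrame ?_
        · simpa using h0
        · simpa using hI
        · simp [slotExp_value, IExp.value, h0, h2, hxn, h11]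
          omega
        · intro j
          simpa [slotExp_value, IExp.value, h0, h2, hxn, h11, hm] using hcoef j
        intro σ₁ hq₁ hf₁
        apply Runs.seq
        apply Runs.setReal
        have h17 := hf₁.idx 17 (by simp [dotCmd])
        have h0' := hf₁.idx 0 (by simp [dotCmd])
        have h1' := hf₁.idx 1 (by simp [dotCmd])
        have h12' := hf₁.idx 12 (by simp [dotCmd])
        have hr1' := hf₁.real 1 (by simp [dotCmd])
        have hs' := hf₁.state 1 (by simp [dotCmd])
        have hm' := hf₁.realMem (by simp [dotCmd])
        simp [slotExp_value, IExp.value, h0, h1, h2, hxn, h11, hs, hm, hr1, hI]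
          at h17 h0' h1' h12' hr1' hs' hm' hq₁
        apply Runs.seq
        refine (argmaxCmd_runs (y.θ n (r - 1)) ?_ ?_ ?_ ?_).monoFrame ?_
        · simpa using h0'
        · simpa using h1'
        · simp [h17]
          omega
        · intro j
          simpa [h17, hm'] using hcoef j
        intro σ₂ ⟨ha₂, hb₂⟩ hf₂
        have h12 := hf₂.idx 12 (by simp [dotCmd, argmaxCmd])
        have hr1₂ := hf₂.real 1 (by simp [dotCmd, argmaxCmd])
        have hr15 := hf₂.real 15 (by simp [dotCmd, argmaxCmd])
        simp [RExp.value, hr1', hq₁, h12', hs'] at h12 hr1₂ hr15 ha₂ hb₂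
        rw [Ledger.act, improveAct]
        apply Runs.ite
        · intro ht
          simp [Test.Holds, RExp.value, hb₂, hr1₂, hr15] at ht
          apply Runs.skip
          rw [h12, if_neg]
          simpa using ht
        · intro ht
          simp only [Test.Holds, RExp.value, hb₂, hr1₂, hr15, not_le] at ht
          apply Runs.setIdx
          rw [if_pos ht]
          simpa [IExp.value] using ha₂
      · intro σ' _ h
        rw [h, if_pos hb.2, Ledger.policy, if_neg (by omega)]
    · intro hb
      simp [Test.Holds, IExp.value, hr, hT.size] at hb
      apply Runs.skip
      rcases Nat.eq_zero_or_pos r with rfl | h0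
      · simp [IExp.value, Ledger.policy]
      · rw [if_neg (by have := hb h0; omega)]
        simp [IExp.value]
  · simp only [IExp.cost, RExp.cost, Test.cost, slotExp_cost]
    have h1 : d + 1 ≤ (K + 1) * (d + 1) := Nat.le_mul_of_pos_left _ (by omega)
    generalize hA : (K + 1) * (d + 1) = A at h1 ⊢
    have h3 : A ≤ (l + 1) * A := Nat.le_mul_of_pos_left _ (by omega)
    refine le_trans (b := 1 + 1 + (1 + 1 + 1 + (1 + 1 + 1 + 1) + 1 + ((l + 1) * (300 * A) + 1)))
      ?_ ?_
    · refine Nat.add_le_add_left (Nat.add_le_add_left (Nat.add_le_add_right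
        (Nat.mul_le_mul_left _ ?_) _) _) _
      omega
    · rw [mul_left_comm]
      omega

end PolicyProgram

/-! ### Vector operations in memory and extension of the core sequence -/

section MemoryPrograms

variable {S : Type*} {d K : ℕ} {acc : Access S d K} {M : ℕ} {p : Params} {y : Ledger S d K}

/-- Write the real expression `e`, which may depend on the loop counter in the index register 13,
to the real cells `dst, …, dst + d - 1`, after a preparation `c`. -/
def fillCmd (c : Cmd) (dst : IExp) (e : RExp) : Cmd :=
  .forLoop 13 (.reg 0) (c ;; .storeReal (.plus dst (.reg 13)) e)

/-- The real cells of `σ` and `σ'` agree but for `b, …, b + d - 1`. -/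
def AgreeOff (d b : ℕ) (m m' : ℕ → ℝ) : Prop :=
  ∀ i, i < b ∨ b + d ≤ i → m' i = m i

theorem AgreeOff.trans {b : ℕ} {m₁ m₂ m₃ : ℕ → ℝ} (h : AgreeOff d b m₁ m₂)
    (h' : AgreeOff d b m₂ m₃) : AgreeOff d b m₁ m₃ :=
  fun i hi => (h' i hi).trans (h i hi)

/-- The preparation may assume that the cell about to be written still has its old content, which
permits updates in place. The destination must be the same in all stores that differ only in the
index register 13, since this register is the loop counter. -/
theorem fillCmd_runs {c : Cmd} {dst : IExp} {e : RExp} {σ : Store S K} {t b : ℕ}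
    (v : Fin d → ℝ) (hd : σ.idx 0 = d) (hM : b + d ≤ M) (hc : c.wIdx = []) (hm : c.wRealMem = false)
    (hdst : ∀ σ' : Store S K, (∀ i, i ≠ 13 → σ'.idx i = σ.idx i) → dst.value σ' = b)
    (hv : ∀ (j : Fin d) (σ' : Store S K), Frame (fillCmd c dst e) σ σ' → σ'.idx 13 = j →
      AgreeOff d b σ.realMem σ'.realMem → σ'.realMem (b + j) = σ.realMem (b + j) →
      Runs acc M c σ' t fun σ'' => e.value σ'' = v j) :
    Runs acc M (fillCmd c dst e) σ ((d + 1) * (t + (dst.cost + e.cost + 20))) fun σ' =>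
      (∀ j : Fin d, σ'.realMem (b + j) = v j) ∧ AgreeOff d b σ.realMem σ'.realMem := by
  apply Runs.le
  · apply Runs.forLoop d (fun n σ' =>
      (∀ j : Fin d, σ'.realMem (b + j) = if j.val < n then v j else σ.realMem (b + j)) ∧
      AgreeOff d b σ.realMem σ'.realMem)
    · simp [hc]
    · intro σ' hf
      simp [IExp.value, hf.idx 0 (by simp [hc]), hd]
    · exact ⟨fun j => by simp, fun _ _ => rfl⟩
    · exact fun _ _ _ h => h
    · intro n hn σ' hf hxn ⟨hI, hA⟩
      lift n to Fin d using hn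
      apply Runs.seq
      refine (hv n σ' hf hxn hA (by rw [hI, if_neg (lt_irrefl _)])).monoFrame fun σ₁ h₁ hf₁ => ?_
      have hidx : ∀ i, i ≠ 13 → σ₁.idx i = σ.idx i := fun i hi =>
        (hf₁.idx i (by simp [hc])).trans (hf.idx i (by simp [hc, hi]))
      have h13 : σ₁.idx 13 = n := (hf₁.idx 13 (by simp [hc])).trans hxn
      have hm₁ : σ₁.realMem = σ'.realMem := hf₁.realMem hm
      have haddr : (IExp.plus dst (.reg 13)).value σ₁ = b + n := by
        simp [IExp.value, hdst σ₁ hidx, h13]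
      apply Runs.storeReal
      · rw [haddr]
        omega
      refine ⟨fun j => ?_, fun i hi => ?_⟩
      · rcases eq_or_ne j n with rfl | hj
        · simp [haddr, h₁]
        · have hne : b + (j : ℕ) ≠ b + n := fun h => hj (Fin.ext (by omega))
          have hlt : j.val < n.val + 1 ↔ j.val < n.val := by
            have : j.val ≠ n.val := fun h => hj (Fin.ext h)
            omega
          simp [haddr, Fin.val_inj, hj, hm₁, hI, hlt]
      · have hne : i ≠ b + n := by omega
        simpa [haddr, hne, hm₁] using hA i hi
    · intro σ' _ ⟨hI, hA⟩
      exact ⟨fun j => by rw [hI, if_pos j.2], hA⟩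
  · simp only [IExp.cost]
    exact Nat.mul_le_mul_left _ (by omega)

theorem IExp.value_withReal (σ : Store S K) (f : ℕ → ℝ) (e : IExp) :
    e.value { σ with real := f } = e.value σ := by
  induction e <;> simp_all [IExp.value]

/-- Add `c` times the vector in the real cells from the address in the index register 17 on to the
vector in the real cells `dst, …, dst + d - 1`, where `c` is in the real register 17. -/
def axpyCmd (dst : IExp) : Cmd :=
  fillCmd (.loadReal 11 (.plus (.reg 17) (.reg 13)) ;; .loadReal 12 (.plus dst (.reg 13))) dst
    (.plus (.reg 12) (.times (.reg 17) (.reg 11)))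

theorem axpyCmd_runs {dst : IExp} {σ : Store S K} {b : ℕ} (v w : Fin d → ℝ)
    (hd : σ.idx 0 = d) (hM : b + d ≤ M) (hM' : σ.idx 17 + d ≤ M)
    (hdisj : σ.idx 17 + d ≤ b ∨ b + d ≤ σ.idx 17)
    (hdst : ∀ σ' : Store S K, (∀ i, i ≠ 13 → σ'.idx i = σ.idx i) → dst.value σ' = b)
    (hv : ∀ j : Fin d, σ.realMem (b + j) = v j)
    (hw : ∀ j : Fin d, σ.realMem (σ.idx 17 + j) = w j) :
    Runs acc M (axpyCmd dst) σ ((d + 1) * (2 * dst.cost + 40)) fun σ' =>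
      (∀ j : Fin d, σ'.realMem (b + j) = v j + σ.real 17 * w j) ∧
        AgreeOff d b σ.realMem σ'.realMem := by
  apply Runs.le
  · apply fillCmd_runs (fun j => v j + σ.real 17 * w j) hd hM
    · rfl
    · rfl
    · exact hdst
    · intro j σ' hf hj hA hb
      have h17 := hf.idx 17 (by simp [fillCmd])
      have hr17 := hf.real 17 (by simp [fillCmd])
      have hd' : dst.value σ' = b := hdst σ' fun i hi => hf.idx i (by simp [fillCmd, hi])
      apply Runs.seq
      apply Runs.loadReal
      · simp [IExp.value, h17, hj]
        omega
      apply Runs.loadReal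
      · simp only [IExp.value, IExp.value_withReal, hd', hj]
        omega
      have hw' : σ'.realMem (σ.idx 17 + j) = w j := by
        rw [← hw j]
        exact hA _ (by omega)
      simp only [RExp.value, IExp.value, IExp.value_withReal, hd', hj, h17]
      simp [hw', hb, hv, hr17]
  · simp only [IExp.cost, RExp.cost]
    exact Nat.mul_le_mul_left _ (by omega)

/-- The real number of which the number of rollouts is the integer part, rounded up. -/
noncomputable def Params.rolloutBound (p : Params) (d : ℕ) : ℝ :=
  ((p.ω / 4) ^ 2)⁻¹ * ((1 - p.γ) ^ 2)⁻¹ * Real.log (2 / p.zeta d) / 2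

/-- The registers and memory cells that represent the ledger `y` and the parameters. -/
structure PlannerMem (p : Params) (acc : Access S d K) (s₀ : S) (y : Ledger S d K)
    (σ : Store S K) : Prop extends Tables p acc.feature y σ where
  gamma : σ.real 0 = p.γ
  bound : σ.real 6 = p.rolloutBound d
  start : σ.state 0 = s₀
  cell_dim : σ.idxMem 0 = d
  cell_actions : σ.idxMem 1 = K
  cell_horizon : σ.idxMem 2 = p.horizon
  cell_lam : σ.realMem 0 = p.lam
  cell_omega : σ.realMem 1 = p.ω
  len : ∀ l ≤ p.horizon, σ.idxMem (4 + 3 * l) = y.len l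
  meas : ∀ l < p.horizon, σ.idxMem (5 + 3 * l) = y.meas l
  coreAct : ∀ (i : ℕ) (hi : i < y.C.length), σ.idxMem (6 + 3 * i) = (y.C[i].2 : ℕ)
  coreState : ∀ (i : ℕ) (hi : i < y.C.length), σ.stateMem i = y.C[i].1
  est : ∀ l < p.horizon, ∀ i < y.meas l,
    σ.realMem (slot d p.horizon i (l + 1) + d) = y.q l i

/-- A program that does not write to the registers and memory cells that represent a ledger. -/
def Cmd.quiet (c : Cmd) : Bool :=
  c.wIdx.all (4 ≤ ·) && c.wReal.all (7 ≤ ·) && c.wState.all (1 ≤ ·) && !c.wIdxMem &&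
    !c.wRealMem && !c.wStateMem

/-- Whether a program is quiet is a Boolean computation on its syntax, so for coverage tests, policy
evaluation and measurements the invariant is preserved by `rfl`. -/
theorem PlannerMem.of_frame {s₀ : S} {c : Cmd} {σ σ' : Store S K}
    (h : PlannerMem p acc s₀ y σ) (hf : Frame c σ σ') (hc : c.quiet = true) :
    PlannerMem p acc s₀ y σ' := by
  simp only [Cmd.quiet, Bool.and_eq_true, List.all_eq_true, decide_eq_true_eq,
    Bool.not_eq_true'] at hc
  obtain ⟨⟨⟨⟨⟨hi, hr⟩, hs⟩, him⟩, hrm⟩, hsm⟩ := hc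
  have hi' : ∀ i < 4, σ'.idx i = σ.idx i := fun i h4 => hf.idx i fun h => by
    have := hi i h; omega
  have hr' : ∀ i < 7, σ'.real i = σ.real i := fun i h4 => hf.real i fun h => by
    have := hr i h; omega
  have hs' : σ'.state 0 = σ.state 0 := hf.state 0 fun h => by
    have := hs 0 h; omega
  exact
  { toTables := h.toTables.of_eq (hi' 0 (by omega)) (hi' 1 (by omega)) (hi' 2 (by omega))
      (hi' 3 (by omega)) (hr' 1 (by omega)) (hr' 5 (by omega)) (hf.realMem hrm)
    gamma := (hr' 0 (by omega)).trans h.gamma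
    bound := (hr' 6 (by omega)).trans h.bound
    start := hs'.trans h.start
    cell_dim := hf.idxMem him ▸ h.cell_dim
    cell_actions := hf.idxMem him ▸ h.cell_actions
    cell_horizon := hf.idxMem him ▸ h.cell_horizon
    cell_lam := hf.realMem hrm ▸ h.cell_lam
    cell_omega := hf.realMem hrm ▸ h.cell_omega
    len := hf.idxMem him ▸ h.len
    meas := hf.idxMem him ▸ h.meas
    coreAct := hf.idxMem him ▸ h.coreAct
    coreState := hf.stateMem hsm ▸ h.coreState
    est := hf.realMem hrm ▸ h.est }

/-- Put the direction of the rank-one update by the pair of the state in the state register 1 and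
the action in the index register 10 into the next free slot. -/
def updateDirCmd : Cmd :=
  fillCmd (.feature 11 1 (.reg 10) (.reg 13)) (slotExp (.reg 3) (.const 0))
    (.quot (.reg 11) (.reg 5)) ;;
  .forLoop 15 (.reg 3)
    (.setIdx 17 (slotExp (.reg 15) (.const 0)) ;;
     dotCmd 10 1 ;;
     .loadReal 12 (.plus (.reg 17) (.reg 0)) ;;
     .setReal 17 (.minus (.ofIdx (.const 0)) (.quot (.reg 10) (.reg 12))) ;;
     axpyCmd (slotExp (.reg 3) (.const 0)))

/-- V⁻¹φ is obtained without solving a linear system: start from φ/λ, the value for the empty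
sequence, and subtract the correction of each earlier pair, using the vectors and denominators in
the records. -/
theorem updateDirCmd_runs (hp : 0 < p.lam) {σ : Store S K} (hT : Tables p acc.feature y σ)
    (hM : slot d p.horizon (y.C.length + 1) 0 ≤ M) (a : Fin K) (ha : σ.idx 10 = a) :
    Runs acc M updateDirCmd σ (400 * ((y.C.length + 1) * (d + 1))) fun σ' =>
      (∀ j : Fin d, σ'.realMem (slot d p.horizon y.C.length 0 + j) =
        updateDir p acc.feature y.C (σ.state 1, a) j) ∧
      AgreeOff d (slot d p.horizon y.C.length 0) σ.realMem σ'.realMem := by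
  have hb : slot d p.horizon y.C.length 0 + (d + 1) ≤ slot d p.horizon (y.C.length + 1) 0 :=
    slot_add_le (Nat.lt_succ_self _) (Nat.zero_le _)
  set b := slot d p.horizon y.C.length 0 with hbdef
  apply Runs.le
  · unfold updateDirCmd
    apply Runs.seq
    refine (fillCmd_runs (t := 10) (b := b)
      (fun j => invCov p acc.feature [] (acc.feature (σ.state 1) a) j) hT.dim (by omega) rfl rfl
      ?_ ?_).monoFrame ?_
    · intro σ' h
      simp [slotExp_value, h 0, h 2, h 3, IExp.value, hT.dim, hT.horizon, hT.size, hbdef]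
    · intro j σ' hf hj _ _
      refine (Runs.feature a j ?_ (by simpa [IExp.value] using hj) ?_).le (by simp [IExp.cost])
      · simpa [IExp.value, ha] using hf.idx 10 (by simp [fillCmd])
      · have h5 := hf.real 5 (by simp [fillCmd])
        have hs := hf.state 1 (by simp [fillCmd])
        simp [RExp.value, h5, hs, hT.lam, invCov_nil hp, div_eq_inv_mul]
    intro σ₁ ⟨hrow₁, hA₁⟩ hf₁
    apply Runs.forLoop y.C.length (fun n σ' =>
      (∀ j : Fin d, σ'.realMem (b + j) =
        invCov p acc.feature (y.C.take n) (acc.feature (σ.state 1) a) j) ∧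
      AgreeOff d b σ.realMem σ'.realMem)
    · simp [dotCmd, axpyCmd, fillCmd]
    · intro σ' hf
      have := hf₁.idx 3 (by simp [fillCmd])
      simp [IExp.value, hf.idx 3 (by simp [dotCmd, axpyCmd, fillCmd]), this, hT.size]
    · exact ⟨by simpa using hrow₁, hA₁⟩
    · exact fun _ _ _ h => h
    · intro n hn σ' hf hxn ⟨hI, hA⟩
      have hslot := slot_add_le (d := d) (H := p.horizon) hn (Nat.zero_le _)
      have h0 : σ'.idx 0 = d := (hf.idx 0 (by simp [dotCmd, axpyCmd, fillCmd])).trans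
        ((hf₁.idx 0 (by simp [fillCmd])).trans hT.dim)
      have h2 : σ'.idx 2 = p.horizon := (hf.idx 2 (by simp [dotCmd, axpyCmd, fillCmd])).trans
        ((hf₁.idx 2 (by simp [fillCmd])).trans hT.horizon)
      have h3 : σ'.idx 3 = y.C.length := (hf.idx 3 (by simp [dotCmd, axpyCmd, fillCmd])).trans
        ((hf₁.idx 3 (by simp [fillCmd])).trans hT.size)
      have h10 : σ'.idx 10 = a := (hf.idx 10 (by simp [dotCmd, axpyCmd, fillCmd])).trans
        ((hf₁.idx 10 (by simp [fillCmd])).trans ha)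
      have hs : σ'.state 1 = σ.state 1 := (hf.state 1 (by simp [dotCmd, axpyCmd, fillCmd])).trans
        (hf₁.state 1 (by simp [fillCmd]))
      have hdir : ∀ j : Fin d, σ'.realMem (slot d p.horizon n 0 + j) =
          updateDir p acc.feature (y.C.take n) y.C[n] j := fun j => by
        rw [hA _ (by omega), hT.dir n hn j]
      have hden : σ'.realMem (slot d p.horizon n 0 + d) =
          updateDen p acc.feature (y.C.take n) y.C[n] := by
        rw [hA _ (by omega), hT.den n hn]
      apply Runs.seq
      apply Runs.setIdx
      apply Runs.seq
      refine (dotCmd_runs a (updateDir p acc.feature (y.C.take n) y.C[n]) ?_ (by norm_num) ?_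
        ?_ ?_).monoFrame ?_
      · simpa using h0
      · simpa using h10
      · simp [slotExp_value, IExp.value, h0, h2, hxn]
        omega
      · intro j
        simpa [slotExp_value, IExp.value, h0, h2, hxn] using hdir j
      intro σ₂ hd₂ hf₂
      have h17 := hf₂.idx 17 (by simp [dotCmd])
      have h0' := hf₂.idx 0 (by simp [dotCmd])
      have h2' := hf₂.idx 2 (by simp [dotCmd])
      have h3' := hf₂.idx 3 (by simp [dotCmd])
      have hm₂ := hf₂.realMem (by simp [dotCmd])
      simp [slotExp_value, IExp.value, h0, h2, h3, hxn, hs] at h17 h0' h2' h3' hm₂ hd₂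
      apply Runs.seq
      apply Runs.loadReal
      · simp [IExp.value, h17, h0']
        omega
      apply Runs.seq
      apply Runs.setReal
      refine (axpyCmd_runs (b := b) (invCov p acc.feature (y.C.take n) (acc.feature (σ.state 1) a))
        (updateDir p acc.feature (y.C.take n) y.C[n]) ?_ ?_ ?_ ?_ ?_ ?_ ?_).monoFrame ?_
      · simpa using h0'
      · omega
      · simp [h17]
        omega
      · left
        simp [h17]
        omega
      · intro σ'' h
        simp [slotExp_value, h 0, h 2, h 3, IExp.value, h0', h2', h3', hbdef]
      · intro j
        simpa [hm₂] using hI j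
      · intro j
        simpa [hm₂, h17] using hdir j
      intro σ₃ ⟨hrow₃, hA₃⟩ _
      refine ⟨fun j => ?_, hA.trans ?_⟩
      · rw [hrow₃, List.take_succ_eq_append_getElem hn, invCov_append_singleton hp]
        simp [RExp.value, IExp.value, h17, h0', hm₂, hden, hd₂,
          dotProduct_comm (updateDir p acc.feature (y.C.take n) y.C[n])]
        ring
      · simpa [hm₂] using hA₃
    · intro σ' _ ⟨hI, hA⟩
      exact ⟨by simpa [updateDir] using hI, hA⟩
  · simp only [IExp.cost, RExp.cost, slotExp_cost]
    have h1 : d + 1 ≤ (y.C.length + 1) * (d + 1) := Nat.le_mul_of_pos_left _ (by omega)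
    have h2 : ∀ c, (y.C.length + 1) * (c * (d + 1)) = c * ((y.C.length + 1) * (d + 1)) :=
      fun c => mul_left_comm _ _ _
    refine le_trans (b := 50 * (d + 1) + (y.C.length + 1) * (200 * (d + 1))) ?_ ?_
    · refine Nat.add_le_add (by omega) (Nat.mul_le_mul_left _ (by omega))
    · rw [h2]
      omega

/-- Append the pair of the state in the state register 1 and the action in the index register 10 to
the core sequence of level `0`. -/
def pushCmd : Cmd :=
  updateDirCmd ;;
  .setIdx 17 (slotExp (.reg 3) (.const 0)) ;;
  dotCmd 10 1 ;;
  .storeReal (.plus (.reg 17) (.reg 0)) (.plus (.ofIdx (.const 1)) (.reg 10)) ;;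
  .storeState (.reg 3) 1 ;;
  .storeIdx (.plus (.const 6) (.times (.const 3) (.reg 3))) (.reg 10) ;;
  .setIdx 3 (.plus (.reg 3) (.const 1)) ;;
  .storeIdx (.const 4) (.reg 3)

/-- The new record lies beyond all existing ones, so stored vectors and estimates survive. In the
index memory, lengths, numbers of estimates and core actions occupy different residue classes modulo
3, so neither of the two writes there spoils another entry. -/
theorem pushCmd_runs (hp : 0 < p.lam) {s₀ : S} {σ : Store S K} (h : PlannerMem p acc s₀ y σ)
    (hch : y.Chain p.horizon) (hM : slot d p.horizon (y.C.length + 1) 0 ≤ M)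
    (hM' : 6 + 3 * y.C.length < M) (a : Fin K) (ha : σ.idx 10 = a) :
    Runs acc M pushCmd σ (600 * ((y.C.length + 1) * (d + 1))) fun σ' =>
      PlannerMem p acc s₀ (y.push (σ.state 1, a)) σ' ∧ Frame pushCmd σ σ' := by
  have hb : slot d p.horizon y.C.length 0 + (d + 1) ≤ slot d p.horizon (y.C.length + 1) 0 :=
    slot_add_le (Nat.lt_succ_self _) (Nat.zero_le _)
  have hlow : 2 ≤ slot d p.horizon y.C.length 0 := by unfold slot; omega
  apply Runs.frame
  apply Runs.le
  · unfold pushCmd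
    apply Runs.seq
    refine (updateDirCmd_runs hp h.toTables hM a ha).monoFrame ?_
    intro σ₁ ⟨hrow, hA⟩ hf₁
    have h0 : σ₁.idx 0 = d := (hf₁.idx 0 (by decide)).trans h.dim
    have h1 : σ₁.idx 1 = K := (hf₁.idx 1 (by decide)).trans h.actions
    have h2 : σ₁.idx 2 = p.horizon := (hf₁.idx 2 (by decide)).trans h.horizon
    have h3 : σ₁.idx 3 = y.C.length := (hf₁.idx 3 (by decide)).trans h.size
    have h10 : σ₁.idx 10 = a := (hf₁.idx 10 (by decide)).trans ha
    have hs : σ₁.state 1 = σ.state 1 := hf₁.state 1 (by decide)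
    apply Runs.seq
    apply Runs.setIdx
    apply Runs.seq
    refine (dotCmd_runs a (updateDir p acc.feature y.C (σ.state 1, a)) ?_ (by norm_num) ?_
      ?_ ?_).monoFrame ?_
    · simpa using h0
    · simpa using h10
    · simp [slotExp_value, IExp.value, h0, h2, h3]
      omega
    · intro j
      simpa [slotExp_value, IExp.value, h0, h2, h3] using hrow j
    intro σ₂ hd₂ hf₂
    have i0 := hf₂.idx 0 (by decide)
    have i1 := hf₂.idx 1 (by decide)
    have i2 := hf₂.idx 2 (by decide)
    have i3 := hf₂.idx 3 (by decide)
    have i10 := hf₂.idx 10 (by decide)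
    have i17 := hf₂.idx 17 (by decide)
    have r0 := (hf₂.real 0 (by decide)).trans ((hf₁.real 0 (by decide)).trans h.gamma)
    have r1 := (hf₂.real 1 (by decide)).trans ((hf₁.real 1 (by decide)).trans h.omega)
    have r5 := (hf₂.real 5 (by decide)).trans ((hf₁.real 5 (by decide)).trans h.lam)
    have r6 := (hf₂.real 6 (by decide)).trans ((hf₁.real 6 (by decide)).trans h.bound)
    have s0 := (hf₂.state 0 (by decide)).trans ((hf₁.state 0 (by decide)).trans h.start)
    have s1 := (hf₂.state 1 (by decide)).trans hs
    have im := (hf₂.idxMem (by decide)).trans (hf₁.idxMem (by decide))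
    have sm := (hf₂.stateMem (by decide)).trans (hf₁.stateMem (by decide))
    have rm := hf₂.realMem (by decide)
    simp [slotExp_value, IExp.value, h0, h1, h2, h3, h10, hs] at i0 i1 i2 i3 i10 i17 rm hd₂
    apply Runs.seq
    apply Runs.storeReal
    · simp [IExp.value, i17, i0]
      omega
    apply Runs.seq
    apply Runs.storeState
    · simp [IExp.value, i3]
      omega
    apply Runs.seq
    apply Runs.storeIdx
    · simp [IExp.value, i3]
      omega
    apply Runs.seq
    apply Runs.setIdx
    apply Runs.storeIdx
    · simp [IExp.value]
      omega
    simp only [IExp.value, RExp.value, i0, i17, i3, i10]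
    have old : ∀ i < slot d p.horizon y.C.length 0,
        Function.update σ₂.realMem (slot d p.horizon y.C.length 0 + d)
          (((1 : ℕ) : ℝ) + σ₂.real 10) i = σ.realMem i := fun i hi => by
      rw [Function.update_of_ne (by omega), rm, hA i (.inl hi)]
    constructor
    · constructor
      · simp [i0]
      · simp [i1]
      · simp [i2]
      · simp [Ledger.push]
      · simp [r1]
      · simp [r5]
      · intro i hi j
        have hi' : i < y.C.length + 1 := by simpa [Ledger.push] using hi
        rcases Nat.lt_succ_iff_lt_or_eq.1 hi' with hlt | rfl
        · have hsl := slot_add_le (d := d) (H := p.horizon) hlt (Nat.zero_le _)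
          simp only [Ledger.push]
          rw [old _ (by omega), h.dir i hlt j, List.take_append_of_le_length hlt.le,
            List.getElem_append_left hlt]
        · simp only [Ledger.push]
          rw [Function.update_of_ne (by omega), rm, hrow j]
          simp
      · intro i hi
        have hi' : i < y.C.length + 1 := by simpa [Ledger.push] using hi
        rcases Nat.lt_succ_iff_lt_or_eq.1 hi' with hlt | rfl
        · have hsl := slot_add_le (d := d) (H := p.horizon) hlt (Nat.zero_le _)
          simp only [Ledger.push]
          rw [old _ (by omega), h.den i hlt, List.take_append_of_le_length hlt.le,
            List.getElem_append_left hlt]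
        · simp only [Ledger.push]
          simp [updateDen, hd₂]
      · intro l hl i hi j
        have hi' : i < y.len (l + 1) := by simpa [Ledger.push] using hi
        have hsl := slot_add_le (d := d) (H := p.horizon) (l := l + 1)
          (hi'.trans_le (hch.len_le hl)) hl
        exact (old _ (by omega)).trans (h.coef l hl i hi' j)
    · simp [r0]
    · simp [r6]
    · simp [s0]
    · simpa [im, show 0 ≠ 6 + 3 * y.C.length by omega] using h.cell_dim
    · simpa [im, show 1 ≠ 6 + 3 * y.C.length by omega] using h.cell_actions
    · simpa [im, show 2 ≠ 6 + 3 * y.C.length by omega] using h.cell_horizon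
    · simpa using (old 0 (by omega)).trans h.cell_lam
    · simpa using (old 1 (by omega)).trans h.cell_omega
    · intro l hl
      rcases Nat.eq_zero_or_pos l with rfl | h0
      · simp [Ledger.push]
      · have := h.len l hl
        have e1 : 4 + 3 * l ≠ 4 := by omega
        have e2 : 4 + 3 * l ≠ 6 + 3 * y.C.length := by omega
        simpa [Ledger.push, im, h0.ne', e1, e2] using this
    · intro l hl
      have := h.meas l hl
      have e1 : 5 + 3 * l ≠ 4 := by omega
      have e2 : 5 + 3 * l ≠ 6 + 3 * y.C.length := by omega
      simpa [Ledger.push, im, e1, e2] using this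
    · intro i hi
      have hi' : i < y.C.length + 1 := by simpa [Ledger.push] using hi
      have e1 : 6 + 3 * i ≠ 4 := by omega
      rcases Nat.lt_succ_iff_lt_or_eq.1 hi' with hlt | rfl
      · have e2 : 6 + 3 * i ≠ 6 + 3 * y.C.length := by omega
        have := h.coreAct i hlt
        simp only [Ledger.push]
        rw [Function.update_of_ne e1, Function.update_of_ne e2, im, this,
          List.getElem_append_left hlt]
      · simp only [Ledger.push]
        rw [Function.update_of_ne e1]
        simp
    · intro i hi
      have hi' : i < y.C.length + 1 := by simpa [Ledger.push] using hi
      rcases Nat.lt_succ_iff_lt_or_eq.1 hi' with hlt | rfl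
      · have := h.coreState i hlt
        simp only [Ledger.push]
        rw [Function.update_of_ne hlt.ne, sm, this, List.getElem_append_left hlt]
      · simp [Ledger.push, s1]
    · intro l hl i hi
      have hlen : i < y.C.length :=
        lt_of_lt_of_le hi ((hch.meas_le l hl).trans (hch.len_le hl.le))
      have hsl := slot_add_le (d := d) (H := p.horizon) (l := l + 1) hlen hl
      exact (old _ (by omega)).trans (h.est l hl i hi)
  · simp only [IExp.cost, RExp.cost, slotExp_cost]
    have h1 : d + 1 ≤ (y.C.length + 1) * (d + 1) := Nat.le_mul_of_pos_left _ (by omega)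
    omega

end MemoryPrograms

/-! ### Recording of estimates, least squares, and propagation to the next level -/

section Propagation

variable {S : Type*} {d K : ℕ} {acc : Access S d K} {M : ℕ} {p : Params} {y : Ledger S d K}

/-- Record the estimate in the real register 7 for the core pair whose index is in the index
register 7, at the level in the index register 6. -/
def recordCmd : Cmd :=
  .storeReal (.plus (slotExp (.reg 7) (.plus (.reg 6) (.const 1))) (.reg 0)) (.reg 7) ;;
  .storeIdx (.plus (.const 5) (.times (.const 3) (.reg 6))) (.plus (.reg 7) (.const 1))

theorem recordCmd_runs {s₀ : S} {σ : Store S K} (h : PlannerMem p acc s₀ y σ)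
    (hch : y.Chain p.horizon) (hM : slot d p.horizon y.C.length 0 ≤ M)
    (hM' : 5 + 3 * p.horizon ≤ M) {l : ℕ} (hl : l < p.horizon) (hm : y.meas l < y.len l)
    (h6 : σ.idx 6 = l) (h7 : σ.idx 7 = y.meas l) :
    Runs acc M recordCmd σ 50 fun σ' =>
      PlannerMem p acc s₀ (y.record l (σ.real 7)) σ' ∧ Frame recordCmd σ σ' := by
  have hmN : y.meas l < y.C.length := hm.trans_le (hch.len_le hl.le)
  have hsl := slot_add_le (d := d) hmN (show l + 1 ≤ p.horizon from hl)
  apply Runs.frame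
  apply Runs.le
  · unfold recordCmd
    apply Runs.seq
    apply Runs.storeReal
    · simp [slotExp_value, IExp.value, h.dim, h.horizon, h6, h7]
      omega
    apply Runs.storeIdx
    · simp [IExp.value, h6]
      omega
    simp only [IExp.value, RExp.value, slotExp_value, h.dim, h.horizon, h6, h7]
    -- The only real cell that changes is the last one of a slot `l + 1`; vectors end before that
    -- cell, and earlier estimates belong to other slots.
    have old : ∀ (i l' j : ℕ), l' ≤ p.horizon → j ≤ d → (l' = l + 1 → i = y.meas l → j ≠ d) →
        Function.update σ.realMem (slot d p.horizon (y.meas l) (l + 1) + d) (σ.real 7)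
          (slot d p.horizon i l' + j) = σ.realMem (slot d p.horizon i l' + j) := by
      intro i l' j hl' hj hne
      refine Function.update_of_ne (fun e => ?_) _ _
      obtain ⟨e1, e2, e3⟩ := slot_inj hl' (show l + 1 ≤ p.horizon from hl) hj le_rfl e
      exact hne e2 e1 e3
    have hlow : 2 ≤ slot d p.horizon (y.meas l) (l + 1) := by unfold slot; omega
    constructor
    · constructor
      · exact h.dim
      · exact h.actions
      · exact h.horizon
      · exact h.size
      · exact h.omega
      · exact h.lam
      · exact fun i hi j => (old i 0 j (by omega) j.2.le (by omega)).trans (h.dir i hi j)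
      · exact fun i hi => (old i 0 d (by omega) le_rfl (by omega)).trans (h.den i hi)
      · exact fun l' hl' i hi j => (old i (l' + 1) j hl' j.2.le
          (fun _ _ => j.2.ne)).trans (h.coef l' hl' i hi j)
    · exact h.gamma
    · exact h.bound
    · exact h.start
    · simpa [show 0 ≠ 5 + 3 * l by omega] using h.cell_dim
    · simpa [show 1 ≠ 5 + 3 * l by omega] using h.cell_actions
    · simpa [show 2 ≠ 5 + 3 * l by omega] using h.cell_horizon
    · exact (Function.update_of_ne (by omega) _ _).trans h.cell_lam
    · exact (Function.update_of_ne (by omega) _ _).trans h.cell_omega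
    · exact fun l' hl' => (Function.update_of_ne (by omega) _ _).trans (h.len l' hl')
    · intro l' hl'
      rcases eq_or_ne l' l with rfl | hne
      · simp [Ledger.record]
      · simpa [Ledger.record, hne] using h.meas l' hl'
    · exact fun i hi => (Function.update_of_ne (by omega) _ _).trans (h.coreAct i hi)
    · exact h.coreState
    · intro l' hl' i hi
      rcases eq_or_ne l' l with rfl | hne
      · have hi' : i < y.meas l' + 1 := by simpa [Ledger.record] using hi
        rcases Nat.lt_succ_iff_lt_or_eq.1 hi' with hlt | rfl
        · refine (old i (l' + 1) d hl' le_rfl (by omega)).trans ?_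
          simpa [Ledger.record, hlt.ne] using h.est l' hl' i hlt
        · simp [Ledger.record]
      · refine (old i (l' + 1) d hl' le_rfl (by omega)).trans ?_
        have hi' : i < y.meas l' := by simpa [Ledger.record, hne] using hi
        simpa [Ledger.record, hne] using h.est l' hl' i hi'
  · simp [IExp.cost, RExp.cost]

/-- Compute the coefficients of the least-squares estimator of the level in the index register 6 by
recursive least squares, in the real cells `2, …, d + 1`. -/
def leastSquaresCmd : Cmd :=
  fillCmd .skip (.const 2) (.ofIdx (.const 0)) ;;
  .forLoop 15 (.reg 3)
    (.loadState 2 (.reg 15) ;;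
     .loadIdx 12 (.plus (.const 6) (.times (.const 3) (.reg 15))) ;;
     .setIdx 17 (.const 2) ;;
     dotCmd 12 2 ;;
     .loadReal 12 (.plus (slotExp (.reg 15) (.plus (.reg 6) (.const 1))) (.reg 0)) ;;
     .loadReal 13 (.plus (slotExp (.reg 15) (.const 0)) (.reg 0)) ;;
     .setReal 17 (.quot (.minus (.reg 12) (.reg 10)) (.reg 13)) ;;
     .setIdx 17 (slotExp (.reg 15) (.const 0)) ;;
     axpyCmd (.const 2))

/-- Recursive least squares: the pair number `n` corrects the coefficients along its stored vector u
by the prediction error divided by D. The level has the full core sequence and all its estimates, so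
one pass suffices. -/
theorem leastSquaresCmd_runs (hp : 0 < p.lam) {s₀ : S} {σ : Store S K}
    (h : PlannerMem p acc s₀ y σ) (hM : slot d p.horizon y.C.length 0 ≤ M)
    (hM' : 6 + 3 * y.C.length ≤ M) {l : ℕ} (hl : l < p.horizon) (hm : y.meas l = y.C.length)
    (h6 : σ.idx 6 = l) :
    Runs acc M leastSquaresCmd σ (400 * ((y.C.length + 1) * (d + 1))) fun σ' =>
      (∀ j : Fin d, σ'.realMem (2 + j) = lseCoef p acc.feature y.C (y.q l) j) ∧
        AgreeOff d 2 σ.realMem σ'.realMem := by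
  have hlow : ∀ i l', d + 2 ≤ slot d p.horizon i l' := fun i l' => by unfold slot; omega
  have hbase := hlow y.C.length 0
  apply Runs.le
  · unfold leastSquaresCmd
    apply Runs.seq
    refine (fillCmd_runs (t := 1) (b := 2) (fun _ => 0) h.dim (by omega) rfl rfl
      (fun _ _ => rfl) ?_).monoFrame ?_
    · exact fun j σ' _ _ _ _ => Runs.skip (by simp [RExp.value, IExp.value])
    intro σ₁ ⟨hrow₁, hA₁⟩ hf₁
    apply Runs.forLoop y.C.length (fun n σ' =>
      (∀ j : Fin d, σ'.realMem (2 + j) = lseCoef p acc.feature (y.C.take n) (y.q l) j) ∧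
      AgreeOff d 2 σ.realMem σ'.realMem)
    · decide
    · intro σ' hf
      have := (hf.idx 3 (by decide)).trans (hf₁.idx 3 (by decide))
      simp [IExp.value, this, h.size]
    · exact ⟨by simpa [lseCoef_nil] using hrow₁, hA₁⟩
    · exact fun _ _ _ h => h
    · intro n hn σ' hf hxn ⟨hI, hA⟩
      have h0 : σ'.idx 0 = d := (hf.idx 0 (by decide)).trans ((hf₁.idx 0 (by decide)).trans h.dim)
      have h2 : σ'.idx 2 = p.horizon :=
        (hf.idx 2 (by decide)).trans ((hf₁.idx 2 (by decide)).trans h.horizon)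
      have h6' : σ'.idx 6 = l := (hf.idx 6 (by decide)).trans ((hf₁.idx 6 (by decide)).trans h6)
      have him : σ'.idxMem = σ.idxMem := (hf.idxMem (by decide)).trans (hf₁.idxMem (by decide))
      have hsm : σ'.stateMem = σ.stateMem :=
        (hf.stateMem (by decide)).trans (hf₁.stateMem (by decide))
      have hsl₀ := slot_add_le (d := d) (H := p.horizon) hn (Nat.zero_le _)
      have hsl₁ := slot_add_le (d := d) hn (show l + 1 ≤ p.horizon from hl)
      have hl₀ := hlow n 0
      have hl₁ := hlow n (l + 1)
      have hdir : ∀ j : Fin d, σ'.realMem (slot d p.horizon n 0 + j) =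
          updateDir p acc.feature (y.C.take n) y.C[n] j := fun j => by
        rw [hA _ (by omega), h.dir n hn j]
      have hden : σ'.realMem (slot d p.horizon n 0 + d) =
          updateDen p acc.feature (y.C.take n) y.C[n] := by
        rw [hA _ (by omega), h.den n hn]
      have hest : σ'.realMem (slot d p.horizon n (l + 1) + d) = y.q l n := by
        rw [hA _ (by omega), h.est l hl n (by omega)]
      apply Runs.seq
      apply Runs.loadState
      · simp [IExp.value, hxn]
        omega
      apply Runs.seq
      apply Runs.loadIdx
      · simp [IExp.value, hxn]
        omega
      apply Runs.seq
      apply Runs.setIdx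
      apply Runs.seq
      refine (dotCmd_runs y.C[n].2 (lseCoef p acc.feature (y.C.take n) (y.q l)) ?_ (by norm_num)
        ?_ ?_ ?_).monoFrame ?_
      · simpa using h0
      · simp [IExp.value, hxn, him, h.coreAct n hn]
      · simp [IExp.value]
        omega
      · intro j
        simpa [IExp.value] using hI j
      intro σ₂ hd₂ hf₂
      have i0 := hf₂.idx 0 (by decide)
      have i2 := hf₂.idx 2 (by decide)
      have i6 := hf₂.idx 6 (by decide)
      have i15 := hf₂.idx 15 (by decide)
      have hm₂ := hf₂.realMem (by decide)
      simp [IExp.value, h0, h2, h6', hxn, hsm, h.coreState n hn] at i0 i2 i6 i15 hm₂ hd₂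
      apply Runs.seq
      apply Runs.loadReal
      · simp [IExp.value, slotExp_value, i0, i2, i6, i15]
        omega
      apply Runs.seq
      apply Runs.loadReal
      · simp [IExp.value, slotExp_value, i0, i2, i15]
        omega
      apply Runs.seq
      apply Runs.setReal
      apply Runs.seq
      apply Runs.setIdx
      refine (axpyCmd_runs (b := 2) (lseCoef p acc.feature (y.C.take n) (y.q l))
        (updateDir p acc.feature (y.C.take n) y.C[n]) ?_ ?_ ?_ ?_ (fun _ _ => rfl) ?_ ?_).monoFrame
        ?_
      · simpa using i0
      · omega
      · simp [slotExp_value, IExp.value, i0, i2, i15]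
        omega
      · right
        simp [slotExp_value, IExp.value, i0, i2, i15]
        omega
      · intro j
        simpa [hm₂] using hI j
      · intro j
        simpa [slotExp_value, IExp.value, i0, i2, i15, hm₂] using hdir j
      intro σ₃ ⟨hrow₃, hA₃⟩ _
      refine ⟨fun j => ?_, hA.trans ?_⟩
      · rw [hrow₃, List.take_succ_eq_append_getElem hn, lseCoef_append_singleton hp]
        simp [RExp.value, IExp.value, slotExp_value, i0, i2, i6, i15, hm₂, hden, hest, hd₂,
          min_eq_left hn.le]
      · simpa [hm₂] using hA₃
    · intro σ' _ ⟨hI, hA⟩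
      exact ⟨by simpa using hI, hA⟩
  · simp only [IExp.cost, RExp.cost, slotExp_cost]
    have h1 : d + 1 ≤ (y.C.length + 1) * (d + 1) := Nat.le_mul_of_pos_left _ (by omega)
    have h2 : ∀ c, (y.C.length + 1) * (c * (d + 1)) = c * ((y.C.length + 1) * (d + 1)) :=
      fun c => mul_left_comm _ _ _
    refine le_trans (b := 50 * (d + 1) + (y.C.length + 1) * (250 * (d + 1))) ?_ ?_
    · refine Nat.add_le_add (by omega) (Nat.mul_le_mul_left _ (by omega))
    · rw [h2]
      omega

/-- Copy the vector in the real cells `2, …, d + 1` to the slots of the next level for the core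
pairs that are not yet in the core sequence of the next level. -/
def copyCmd : Cmd :=
  .forLoop 15 (.reg 3)
    (.ite (.ltIdx (.reg 15) (.reg 20)) .skip
      (fillCmd (.loadReal 11 (.plus (.const 2) (.reg 13)))
        (slotExp (.reg 15) (.plus (.reg 6) (.const 1))) (.reg 11)))

theorem copyCmd_runs {σ : Store S K} (hT : Tables p acc.feature y σ) (v : Fin d → ℝ)
    (hM : slot d p.horizon y.C.length 0 ≤ M) {l m : ℕ} (hl : l < p.horizon)
    (h6 : σ.idx 6 = l) (h20 : σ.idx 20 = m) (hv : ∀ j : Fin d, σ.realMem (2 + j) = v j) :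
    Runs acc M copyCmd σ (100 * ((y.C.length + 1) * (d + 1))) fun σ' =>
      (∀ i < y.C.length, m ≤ i → ∀ j : Fin d,
        σ'.realMem (slot d p.horizon i (l + 1) + j) = v j) ∧
      ∀ b, (∀ i < y.C.length, m ≤ i → ∀ j < d, b ≠ slot d p.horizon i (l + 1) + j) →
        σ'.realMem b = σ.realMem b := by
  have hlow : ∀ i l', d + 2 ≤ slot d p.horizon i l' := fun i l' => by unfold slot; omega
  have hbase := hlow y.C.length 0
  apply Runs.le
  · unfold copyCmd
    apply Runs.forLoop y.C.length (fun n σ' =>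
      (∀ i < n, m ≤ i → ∀ j : Fin d, σ'.realMem (slot d p.horizon i (l + 1) + j) = v j) ∧
      ∀ b, (∀ i < y.C.length, m ≤ i → ∀ j < d, b ≠ slot d p.horizon i (l + 1) + j) →
        σ'.realMem b = σ.realMem b)
    · decide
    · intro σ' hf
      simp [IExp.value, hf.idx 3 (by decide), hT.size]
    · exact ⟨fun i hi => absurd hi (Nat.not_lt_zero i), fun _ _ => rfl⟩
    · exact fun _ _ _ h => h
    · intro n hn σ' hf hxn ⟨hI, hA⟩
      have h0 : σ'.idx 0 = d := (hf.idx 0 (by decide)).trans hT.dim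
      have h2 : σ'.idx 2 = p.horizon := (hf.idx 2 (by decide)).trans hT.horizon
      have h6' : σ'.idx 6 = l := (hf.idx 6 (by decide)).trans h6
      have h20' : σ'.idx 20 = m := (hf.idx 20 (by decide)).trans h20
      have hsl := slot_add_le (d := d) hn (show l + 1 ≤ p.horizon from hl)
      have hln := hlow n (l + 1)
      apply Runs.ite
      · intro hb
        simp [Test.Holds, IExp.value, hxn, h20'] at hb
        apply Runs.skip
        refine ⟨fun i hi hmi => ?_, hA⟩
        rcases Nat.lt_succ_iff_lt_or_eq.1 hi with hi | rfl
        exacts [hI i hi hmi, by omega]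
      · intro hb
        simp [Test.Holds, IExp.value, hxn, h20'] at hb
        refine (fillCmd_runs (t := 10) (b := slot d p.horizon n (l + 1)) v h0 (by omega) rfl rfl
          ?_ ?_).mono ?_
        · intro σ'' h
          simp [slotExp_value, h 0, h 2, h 6, h 15, IExp.value, h0, h2, h6', hxn]
        · intro j σ'' hf'' hj hA'' _
          refine (Runs.loadReal ?_ ?_).le (by simp [IExp.cost])
          · simp [IExp.value, hj]
            omega
          · have e1 := hA'' (2 + j) (by omega)
            have e2 := hA (2 + j) (fun i _ _ j' hj' => by have := hlow i (l + 1); omega)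
            simp [RExp.value, IExp.value, hj, e1, e2, hv]
        · intro σ'' ⟨hrow, hA''⟩
          refine ⟨fun i hi hmi j => ?_, fun b hb' => ?_⟩
          · rcases Nat.lt_succ_iff_lt_or_eq.1 hi with hi | rfl
            · rw [hA'' _ ?_, hI i hi hmi j]
              -- An address outside the safe region would lie in the block just written, at an
              -- offset below `d`; injectivity of addresses then identifies the two records,
              -- although `i < n`.
              by_contra hcon
              have h3 : slot d p.horizon i (l + 1) + j = slot d p.horizon n (l + 1) +
                  (slot d p.horizon i (l + 1) + j - slot d p.horizon n (l + 1)) := by omega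
              have := (slot_inj (show l + 1 ≤ p.horizon from hl) (show l + 1 ≤ p.horizon from hl)
                j.2.le (by omega) h3).1
              omega
            · exact hrow j
          · rw [hA'' b ?_, hA b hb']
            by_contra hcon
            exact hb' n hn hb (b - slot d p.horizon n (l + 1)) (by omega) (by omega)
    · exact fun σ' _ h => h
  · simp only [IExp.cost, RExp.cost, Test.cost, slotExp_cost]
    have h2 : ∀ c, (y.C.length + 1) * (c * (d + 1)) = c * ((y.C.length + 1) * (d + 1)) :=
      fun c => mul_left_comm _ _ _
    rw [← h2]
    exact Nat.mul_le_mul_left _ (by omega)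

/-- Propagate the level in the index register 6 to the next level. -/
def propagateCmd : Cmd :=
  leastSquaresCmd ;;
  .loadIdx 20 (.plus (.const 4) (.times (.const 3) (.plus (.reg 6) (.const 1)))) ;;
  copyCmd ;;
  .storeIdx (.plus (.const 4) (.times (.const 3) (.plus (.reg 6) (.const 1)))) (.reg 3)

/-- The copy starts at the old length of the next level. Below it the coefficients have to stay, as
the policy is frozen in the states of those ranks. -/
theorem propagateCmd_runs (hp : 0 < p.lam) {s₀ : S} {σ : Store S K}
    (h : PlannerMem p acc s₀ y σ) (hM : slot d p.horizon y.C.length 0 ≤ M)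
    (hM' : 6 + 3 * y.C.length ≤ M) (hM'' : 5 + 3 * p.horizon ≤ M) {l : ℕ} (hl : l < p.horizon)
    (hlen : y.len l = y.C.length) (hm : y.meas l = y.len l) (h6 : σ.idx 6 = l) :
    Runs acc M propagateCmd σ (600 * ((y.C.length + 1) * (d + 1))) fun σ' =>
      PlannerMem p acc s₀
        (y.propagate l (lseCoef p acc.feature (y.C.take (y.len l)) (y.q l))) σ' ∧
      Frame propagateCmd σ σ' := by
  have hlow : ∀ i l', d + 2 ≤ slot d p.horizon i l' := fun i l' => by unfold slot; omega
  apply Runs.frame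
  apply Runs.le
  · unfold propagateCmd
    apply Runs.seq
    refine (leastSquaresCmd_runs hp h hM hM' hl (hm.trans hlen) h6).monoFrame ?_
    intro σ₁ ⟨hrow₁, hA₁⟩ hf₁
    have h6₁ : σ₁.idx 6 = l := (hf₁.idx 6 (by decide)).trans h6
    have him₁ : σ₁.idxMem = σ.idxMem := hf₁.idxMem (by decide)
    apply Runs.seq
    apply Runs.loadIdx
    · simp [IExp.value, h6₁]
      omega
    have hT₁ : Tables p acc.feature y σ₁ := by
      have old : ∀ i l' j, σ₁.realMem (slot d p.horizon i l' + j) =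
          σ.realMem (slot d p.horizon i l' + j) := fun i l' j => by
        have := hlow i l'
        exact hA₁ _ (by omega)
      exact
      { dim := (hf₁.idx 0 (by decide)).trans h.dim
        actions := (hf₁.idx 1 (by decide)).trans h.actions
        horizon := (hf₁.idx 2 (by decide)).trans h.horizon
        size := (hf₁.idx 3 (by decide)).trans h.size
        omega := (hf₁.real 1 (by decide)).trans h.omega
        lam := (hf₁.real 5 (by decide)).trans h.lam
        dir := fun i hi j => (old _ _ _).trans (h.dir i hi j)
        den := fun i hi => (old _ _ _).trans (h.den i hi)
        coef := fun l hl i hi j => (old _ _ _).trans (h.coef l hl i hi j) }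
    apply Runs.seq
    refine (copyCmd_runs (m := y.len (l + 1)) (hT₁.of_eq ?_ ?_ ?_ ?_ ?_ ?_ ?_)
      (lseCoef p acc.feature y.C (y.q l)) hM hl ?_ ?_ ?_).monoFrame ?_
    · simp
    · simp
    · simp
    · simp
    · rfl
    · rfl
    · rfl
    · simpa using h6₁
    · have := h.len (l + 1) hl
      simp [IExp.value, h6₁, him₁, this]
    · exact hrow₁
    intro σ₂ ⟨hnew, hold⟩ hf₂
    have h6₂ : σ₂.idx 6 = l := (hf₂.idx 6 (by decide)).trans (by simpa using h6₁)
    have h3₂ : σ₂.idx 3 = y.C.length := (hf₂.idx 3 (by decide)).trans (by simpa using hT₁.size)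
    have him₂ : σ₂.idxMem = σ.idxMem := (hf₂.idxMem (by decide)).trans him₁
    apply Runs.storeIdx
    · simp [IExp.value, h6₂]
      omega
    simp only [IExp.value, h6₂, h3₂, him₂]
    -- Least squares touches only the scratch cells below all records, and the copy touches only
    -- vector cells of slot `l + 1` from the old length on, never the scalar cells with the
    -- estimates.
    have old : ∀ i l' j, l' ≤ p.horizon → j ≤ d →
        (l' = l + 1 → y.len (l + 1) ≤ i → i < y.C.length → j = d) →
        σ₂.realMem (slot d p.horizon i l' + j) = σ.realMem (slot d p.horizon i l' + j) := by
      intro i l' j hl' hj hne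
      have := hlow i l'
      rw [hold, hA₁ _ (by omega)]
      intro i' hi' hm' j' hj' he
      obtain ⟨e1, e2, e3⟩ := slot_inj hl' (show l + 1 ≤ p.horizon from hl) hj hj'.le he
      have := hne e2 (e1 ▸ hm') (e1 ▸ hi')
      omega
    have old' : ∀ b < 2, σ₂.realMem b = σ.realMem b := fun b hb => by
      rw [hold b fun i _ _ j _ => by have := hlow i (l + 1); omega, hA₁ _ (by omega)]
    constructor
    · constructor
      · exact (hf₂.idx 0 (by decide)).trans (by simpa using hT₁.dim)
      · exact (hf₂.idx 1 (by decide)).trans (by simpa using hT₁.actions)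
      · exact (hf₂.idx 2 (by decide)).trans (by simpa using hT₁.horizon)
      · exact h3₂
      · exact (hf₂.real 1 (by decide)).trans hT₁.omega
      · exact (hf₂.real 5 (by decide)).trans hT₁.lam
      · exact fun i hi j => (old i 0 j (by omega) j.2.le (by omega)).trans (h.dir i hi j)
      · exact fun i hi => (old i 0 d (by omega) le_rfl (by omega)).trans (h.den i hi)
      · intro l' hl' i hi j
        simp only [Ledger.propagate] at hi ⊢
        rcases eq_or_ne l' l with rfl | hne
        · rw [Function.update_self, hlen] at hi
          by_cases hi' : y.len (l' + 1) ≤ i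
          · rw [if_pos ⟨rfl, hi', by omega⟩, hlen, List.take_length]
            exact hnew i hi hi' j
          · rw [if_neg (by omega)]
            exact (old i (l' + 1) j hl' j.2.le (by omega)).trans
              (h.coef l' hl' i (by omega) j)
        · rw [Function.update_of_ne (by omega)] at hi
          rw [if_neg (by omega)]
          exact (old i (l' + 1) j hl' j.2.le (by omega)).trans (h.coef l' hl' i hi j)
    · exact (hf₂.real 0 (by decide)).trans ((hf₁.real 0 (by decide)).trans h.gamma)
    · exact (hf₂.real 6 (by decide)).trans ((hf₁.real 6 (by decide)).trans h.bound)
    · exact (hf₂.state 0 (by decide)).trans ((hf₁.state 0 (by decide)).trans h.start)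
    · simpa [show 0 ≠ 4 + 3 * (l + 1) by omega] using h.cell_dim
    · simpa [show 1 ≠ 4 + 3 * (l + 1) by omega] using h.cell_actions
    · simpa [show 2 ≠ 4 + 3 * (l + 1) by omega] using h.cell_horizon
    · exact (old' 0 (by omega)).trans h.cell_lam
    · exact (old' 1 (by omega)).trans h.cell_omega
    · intro l' hl'
      rcases eq_or_ne l' (l + 1) with rfl | hne
      · simp [Ledger.propagate, hlen]
      · simpa [Ledger.propagate, hne] using h.len l' hl'
    · exact fun l' hl' => (Function.update_of_ne (by omega) _ _).trans (h.meas l' hl')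
    · exact fun i hi => (Function.update_of_ne (by omega) _ _).trans (h.coreAct i hi)
    · exact fun i hi => by
        have := (hf₂.stateMem (by decide)).trans (hf₁.stateMem (by decide))
        exact this ▸ h.coreState i hi
    · exact fun l' hl' i hi => (old i (l' + 1) d hl' le_rfl (by omega)).trans (h.est l' hl' i hi)
  · simp only [IExp.cost]
    have h1 : d + 1 ≤ (y.C.length + 1) * (d + 1) := Nat.le_mul_of_pos_left _ (by omega)
    omega

end Propagation

/-! ### Rollouts and measurements -/

section Measurement

variable {S : Type*} {d K : ℕ} {acc : Access S d K} {M : ℕ} {p : Params} {y : Ledger S d K}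

/-- One step of a rollout, which ends with the flag in the index register 19 set to `1` if the
current state is not covered. -/
def rolloutStepCmd : Cmd :=
  coverCmd ;;
  .ite (.ltIdx (.reg 10) (.reg 1)) (.setIdx 19 (.const 1))
    (policyCmd ;;
     .simulate 16 1 1 (.reg 12) ;;
     .setReal 8 (.plus (.reg 8) (.times (.reg 9) (.reg 16))) ;;
     .setReal 9 (.times (.reg 9) (.reg 0)) ;;
     .setIdx 9 (.plus (.reg 9) (.const 1)))

/-- Complete a rollout. -/
def rolloutCmd : Cmd :=
  .loop (.conj (.ltIdx (.reg 9) (.reg 2)) (.ltIdx (.reg 19) (.const 1))) rolloutStepCmd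

/-- The store contains the outcome `o` of (part of) a measurement. A discovered state is in the
state register 1, and its first action that is not covered in the index register 10. Otherwise,
the result is in the real register `i`. -/
def Delivers (p : Params) (φ : S → Fin K → Fin d → ℝ) (C : List (S × Fin K)) (i : ℕ)
    (o : Outcome S × List (S × Fin K)) (σ : Store S K) : Prop :=
  σ.trace = o.2 ∧
  match o.1 with
  | .discover s => σ.idx 19 = 1 ∧ σ.state 1 = s ∧ ∃ a : Fin K,
      firstAction (fun a => (s, a) ∉ actionCover p φ C) = some a ∧ σ.idx 10 = a ∧
        (s, a) ∉ actionCover p φ C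
  | .success q => σ.idx 19 = 0 ∧ σ.real i = q

theorem IsFirstUncovered.of_lt {φ : S → Fin K → Fin d → ℝ} {C : List (S × Fin K)} {s : S} {u : ℕ}
    (h : IsFirstUncovered p φ C s u) (hu : u < K) : s ∉ cover p φ C ∧ ∃ a : Fin K,
      firstAction (fun a => (s, a) ∉ actionCover p φ C) = some a ∧ u = a ∧
        (s, a) ∉ actionCover p φ C := by
  rcases h with ⟨-, h⟩ | h
  · omega
  · obtain ⟨a, h1, h2, h3⟩ := h
    exact ⟨fun hc => h3 (hc a), a, h1, h2, h3⟩

theorem IsFirstUncovered.of_not_lt {φ : S → Fin K → Fin d → ℝ} {C : List (S × Fin K)} {s : S}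
    {u : ℕ} (h : IsFirstUncovered p φ C s u) (hu : ¬ u < K) : s ∈ cover p φ C ∧
      firstAction (fun a => (s, a) ∉ actionCover p φ C) = none := by
  rcases h with ⟨h, -⟩ | ⟨a, -, h, -⟩
  · exact ⟨fun a => not_not.1 (firstAction_eq_none.1 h a), h⟩
  · have := a.2
    omega

/-- All levels up to `l` share the whole core sequence, so a single coverage pass serves twice: it
decides whether the rollout goes on, and it delivers the rank from which the policy is evaluated. A
step therefore costs one such pass and one climb through `l` levels. -/
theorem rolloutCmd_runs [NeZero K] (hp : 0 < p.lam) {s₀ : S} {l : ℕ} (hl : l ≤ p.horizon)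
    (hlen : ∀ l' ≤ l, y.len l' = y.C.length) {π : S → Fin K}
    (hπ : ∀ s r, IsRank p acc.feature y.C s r → r ≤ y.C.length →
      π s = y.policy p acc.feature s r l)
    (hM : slot d p.horizon y.C.length 0 ≤ M) (m h : ℕ) (hmh : h + m = p.horizon) (g : ℝ)
    (σ : Store S K) (hσ : PlannerMem p acc s₀ y σ) (h6 : σ.idx 6 = l) (h9 : σ.idx 9 = h)
    (h19 : σ.idx 19 = 0) (hg : σ.real 8 = g) (hγ : σ.real 9 = p.γ ^ h) :
    Runs acc M rolloutCmd σ
      ((m + 1) * (1000 * ((y.C.length + p.horizon + 2) * ((K + 1) * (d + 1)))))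
      (Delivers p acc.feature y.C 8
        (rollout p acc π (cover p acc.feature y.C) m h (σ.state 1) g σ.trace)) := by
  have hW : 1 ≤ (y.C.length + p.horizon + 2) * ((K + 1) * (d + 1)) :=
    Nat.one_le_iff_ne_zero.2 (by positivity)
  have hstep : 400 * ((K + 1) * ((y.C.length + 1) * (d + 1))) +
      400 * ((l + 1) * ((K + 1) * (d + 1))) ≤
      400 * ((y.C.length + p.horizon + 2) * ((K + 1) * (d + 1))) := by
    have h1 := Nat.mul_le_mul_right ((K + 1) * (d + 1))
      (show (y.C.length + 1) + (l + 1) ≤ y.C.length + p.horizon + 2 by omega)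
    rw [mul_left_comm (K + 1), ← mul_add, ← add_mul]
    omega
  set W := (y.C.length + p.horizon + 2) * ((K + 1) * (d + 1)) with hWdef
  clear_value W
  induction m generalizing h g σ with
  | zero =>
    refine (Runs.loopStop ?_ ?_).le ?_
    · simp [Test.Holds, IExp.value, h9, hσ.horizon]
      omega
    · exact ⟨rfl, h19, hg⟩
    · simp [Test.cost, IExp.cost]
      omega
  | succ m ih =>
    apply Runs.le
    · apply Runs.loopStep (t₂ :=
        (m + 1) * (1000 * W))
      · simp [Test.Holds, IExp.value, h9, h19, hσ.horizon]
        omega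
      unfold rolloutStepCmd
      apply Runs.seq
      refine (coverCmd_runs hp hσ.toTables hM).monoFrame fun σ₁ ⟨hr, hu⟩ hf₁ => ?_
      have hσ₁ := hσ.of_frame hf₁ rfl
      have s1 : σ₁.state 1 = σ.state 1 := hf₁.state 1 (by decide)
      have t1 : σ₁.trace = σ.trace := hf₁.trace rfl
      apply Runs.ite
      · intro hb
        simp only [Test.Holds, IExp.value, hσ₁.actions] at hb
        obtain ⟨hc, a, ha₁, ha₂, ha₃⟩ := hu.of_lt hb
        apply Runs.setIdx
        refine (Runs.loopStop ?_ ?_).le ?_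
        · simp [Test.Holds, IExp.value]
        · rw [rollout, if_neg hc]
          refine ⟨t1, ?_, s1, a, ha₁, ?_, ha₃⟩
          · simp [IExp.value]
          · simpa using ha₂
        · simp [Test.cost, IExp.cost]
          have : 1 * (1000 * W) ≤ (m + 1) *
            (1000 * W) :=
            Nat.mul_le_mul_right _ (by omega)
          omega
      · intro hb
        simp only [Test.Holds, IExp.value, hσ₁.actions] at hb
        obtain ⟨hc, hnone⟩ := hu.of_not_lt hb
        have hrN := hr.mem_cover_iff.1 hc
        apply Runs.seq
        refine (policyCmd_runs hσ₁.toTables hM rfl ((hf₁.idx 6 (by decide)).trans h6) hl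
          fun hr' l' hl' => by rwa [hlen _ (by omega)]).monoFrame fun σ₂ ha hf₂ => ?_
        rw [if_pos hrN, s1, ← hπ _ _ hr hrN] at ha
        have hσ₂ := hσ₁.of_frame hf₂ rfl
        have s2 : σ₂.state 1 = σ.state 1 := (hf₂.state 1 (by decide)).trans s1
        have t2 : σ₂.trace = σ.trace := (hf₂.trace rfl).trans t1
        apply Runs.seq
        refine Runs.simulate (π (σ.state 1)) ha ?_
        apply Runs.seq
        apply Runs.setReal
        apply Runs.seq
        apply Runs.setReal
        apply Runs.setIdx
        rw [rollout, if_pos hc]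
        have i9 : σ₂.idx 9 = h := (hf₂.idx 9 (by decide)).trans ((hf₁.idx 9 (by decide)).trans h9)
        have r8 : σ₂.real 8 = g := (hf₂.real 8 (by decide)).trans
          ((hf₁.real 8 (by decide)).trans hg)
        have r9 : σ₂.real 9 = p.γ ^ h := (hf₂.real 9 (by decide)).trans
          ((hf₁.real 9 (by decide)).trans hγ)
        have r0 : σ₂.real 0 = p.γ := hσ₂.gamma
        simp only [IExp.value, RExp.value, s2, t2, i9]
        refine (ih (h + 1) (by omega) (g + p.γ ^ h *
          (acc.simulate σ.trace.length (σ.state 1) (π (σ.state 1))).2) _ ?_ ?_ ?_ ?_ ?_ ?_).mono ?_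
        -- The command named here is not executed. It stands for the set of registers in which the
        -- two stores may differ.
        · refine hσ₂.of_frame (c := .setIdx 9 (.const 0) ;; .simulate 16 1 1 (.reg 12) ;;
            .setReal 8 (.reg 8) ;; .setReal 9 (.reg 9)) ?_ rfl
          constructor <;> simp +contextual [Function.update_of_ne]
        · simpa using (hf₂.idx 6 (by decide)).trans ((hf₁.idx 6 (by decide)).trans h6)
        · simp
        · simpa using (hf₂.idx 19 (by decide)).trans ((hf₁.idx 19 (by decide)).trans h19)
        · simp [r8, r9]
        · simp [r9, r0, pow_succ]
        · intro σ' h'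
          simpa using h'
    · simp only [Test.cost, IExp.cost, RExp.cost]
      have : (m + 1 + 1) * (1000 * W) = (m + 1) *
        (1000 * W) +
        1000 * W := by ring
      generalize 400 * ((K + 1) * ((y.C.length + 1) * (d + 1))) = A at hstep ⊢
      generalize 400 * ((l + 1) * ((K + 1) * (d + 1))) = D at hstep ⊢
      rw [this]
      generalize (m + 1) * (1000 * W) = E
      clear * - hstep hW
      omega

/-- One rollout of the measurement of the core pair whose index is in the index register 7. -/
def episodeCmd : Cmd :=
  .loadState 1 (.reg 7) ;;
  .loadIdx 12 (.plus (.const 6) (.times (.const 3) (.reg 7))) ;;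
  .simulate 8 1 1 (.reg 12) ;;
  .setIdx 9 (.const 1) ;;
  .setReal 9 (.reg 0) ;;
  rolloutCmd ;;
  .setReal 7 (.plus (.reg 7) (.reg 8)) ;;
  .setIdx 8 (.plus (.reg 8) (.const 1))

/-- The rollouts of a measurement. -/
def episodesCmd : Cmd :=
  .loop (.conj (.neg (.leReal (.reg 6) (.ofIdx (.reg 8)))) (.ltIdx (.reg 19) (.const 1)))
    episodeCmd

/-- Measure the core pair whose index is in the index register 7. The result is put into the real
register 7. -/
def measureCmd : Cmd :=
  .setIdx 8 (.const 0) ;;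
  .setIdx 19 (.const 0) ;;
  .setReal 7 (.ofIdx (.const 0)) ;;
  episodesCmd ;;
  .setReal 7 (.quot (.reg 7) (.ofIdx (.reg 8)))

theorem episodesCmd_runs [NeZero K] (hp : 0 < p.lam) {s₀ : S} {l : ℕ} (hl : l < p.horizon)
    (hlen : ∀ l' ≤ l, y.len l' = y.C.length) {π : S → Fin K}
    (hπ : ∀ s r, IsRank p acc.feature y.C s r → r ≤ y.C.length →
      π s = y.policy p acc.feature s r l)
    (hM : slot d p.horizon y.C.length 0 ≤ M) (hM' : 6 + 3 * y.C.length ≤ M) {k : ℕ}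
    (hk : k < y.C.length) (m : ℕ) (hm : m ≤ p.rollouts d) (g : ℝ)
    (σ : Store S K) (hσ : PlannerMem p acc s₀ y σ) (h6 : σ.idx 6 = l) (h7 : σ.idx 7 = k)
    (h8 : σ.idx 8 = p.rollouts d - m) (h19 : σ.idx 19 = 0) (hg : σ.real 7 = g) :
    Runs acc M episodesCmd σ
      ((m + 1) * ((p.horizon + 1) *
        (2000 * ((y.C.length + p.horizon + 2) * ((K + 1) * (d + 1))))))
      fun σ' => Delivers p acc.feature y.C 7 (episodes p acc y.C[k].1 y.C[k].2 π
        (cover p acc.feature y.C) m g σ.trace) σ' ∧ (σ'.idx 19 = 0 → σ'.idx 8 = p.rollouts d) := by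
  have hW : 1 ≤ (y.C.length + p.horizon + 2) * ((K + 1) * (d + 1)) :=
    Nat.one_le_iff_ne_zero.2 (by positivity)
  set W := (y.C.length + p.horizon + 2) * ((K + 1) * (d + 1)) with hWdef
  have hW' : 1 * (2000 * W) ≤ (p.horizon + 1) * (2000 * W) := Nat.mul_le_mul_right _ (by omega)
  induction m generalizing g σ with
  | zero =>
    refine (Runs.loopStop ?_ ?_).le ?_
    · have : p.rolloutBound d ≤ (p.rollouts d : ℝ) := Nat.le_ceil _
      simp [Test.Holds, RExp.value, IExp.value, h8, hσ.bound, this]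
    · exact ⟨⟨rfl, h19, hg⟩, fun _ => by simpa using h8⟩
    · simp [Test.cost, RExp.cost, IExp.cost]
      omega
  | succ m ih =>
    -- The machine has no rounding. A natural number is below the ceiling of a real number iff it is
    -- below that number, so comparing the counter with the unrounded bound gives the right number
    -- of rollouts.
    have hlt : ((p.rollouts d - (m + 1) : ℕ) : ℝ) < p.rolloutBound d := by
      rw [← Nat.lt_ceil]
      change _ < p.rollouts d
      omega
    have hrollout : (p.horizon - 1 + 1) * (1000 * W) ≤ (p.horizon + 1) * (1000 * W) :=
      Nat.mul_le_mul_right _ (by omega)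
    apply Runs.le
    · apply Runs.loopStep (t₂ := (m + 1) * ((p.horizon + 1) * (2000 * W)))
      · simpa [Test.Holds, RExp.value, IExp.value, h8, h19, hσ.bound] using hlt
      unfold episodeCmd
      apply Runs.seq
      apply Runs.loadState
      · simp [IExp.value, h7]
        omega
      apply Runs.seq
      apply Runs.loadIdx
      · simp [IExp.value, h7]
        omega
      apply Runs.seq
      refine Runs.simulate y.C[k].2 ?_ ?_
      · simp [IExp.value, h7, hσ.coreAct k hk]
      apply Runs.seq
      apply Runs.setIdx
      apply Runs.seq
      apply Runs.setReal
      have hs : σ.stateMem ((IExp.reg 7).value σ) = y.C[k].1 := by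
        simp [IExp.value, h7, hσ.coreState k hk]
      simp only [hs, Function.update_self]
      apply Runs.seq
      -- Since `l < p.horizon`, the horizon is positive and the truncated difference is genuine: the
      -- call at the measured pair is step 0, and `p.horizon - 1` steps follow.
      refine (rolloutCmd_runs hp (s₀ := s₀) hl.le hlen hπ hM (p.horizon - 1) 1 (by omega)
        (acc.simulate σ.trace.length y.C[k].1 y.C[k].2).2 _ ?_ ?_ ?_ ?_ ?_ ?_).monoFrame ?_
      · refine hσ.of_frame (c := .setIdx 9 (.const 0) ;; .setIdx 12 (.const 0) ;;
          .simulate 8 1 1 (.reg 12) ;; .setReal 9 (.reg 9)) ?_ rfl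
        constructor <;> simp +contextual [Function.update_of_ne]
      · simpa using h6
      · simp [IExp.value]
      · simpa using h19
      · simp
      · simp [RExp.value, hσ.gamma]
      intro σ₁ hd₁ hf₁
      simp only [Function.update_self] at hd₁
      have hσ₁ : PlannerMem p acc s₀ y σ₁ := by
        refine hσ.of_frame (c := (.setIdx 9 (.const 0) ;; .setIdx 12 (.const 0) ;;
          .simulate 8 1 1 (.reg 12) ;; .setReal 9 (.reg 9)) ;; rolloutCmd) ?_ rfl
        refine Frame.trans (Frame.seqLeft ?_) (Frame.seqRight hf₁)
        constructor <;> simp +contextual [Function.update_of_ne]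
      have i6 : σ₁.idx 6 = l := (hf₁.idx 6 (by decide)).trans (by simpa using h6)
      have i7 : σ₁.idx 7 = k := (hf₁.idx 7 (by decide)).trans (by simpa using h7)
      have i8 : σ₁.idx 8 = p.rollouts d - (m + 1) :=
        (hf₁.idx 8 (by decide)).trans (by simpa using h8)
      have r7 : σ₁.real 7 = g := (hf₁.real 7 (by decide)).trans (by simpa using hg)
      apply Runs.seq
      apply Runs.setReal
      apply Runs.setIdx
      rw [episodes]
      generalize rollout p acc π (cover p acc.feature y.C) (p.horizon - 1) 1 _ _ _ = o at hd₁ ⊢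
      obtain ⟨o | q, tr⟩ := o
      · obtain ⟨ht, h1, h2, a, h3, h4, h5⟩ := hd₁
        refine (Runs.loopStop ?_ ?_).le ?_
        · simp [Test.Holds, IExp.value, h1]
        · refine ⟨⟨ht, ?_, h2, a, h3, ?_, h5⟩, ?_⟩
          · simpa using h1
          · simpa using h4
          · simp [h1]
        · simp [Test.cost, IExp.cost, RExp.cost]
          have := Nat.mul_le_mul_right ((p.horizon + 1) * (2000 * W)) (show 1 ≤ m + 1 by omega)
          omega
      · obtain ⟨ht, h1, h2⟩ := hd₁
        simp only at ht h2
        refine (ih (by omega) (g + q) _ ?_ ?_ ?_ ?_ ?_ ?_).mono ?_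
        · refine hσ₁.of_frame (c := .setIdx 8 (.const 0) ;; .setReal 7 (.reg 9)) ?_ rfl
          constructor <;> simp +contextual [Function.update_of_ne]
        · simpa using i6
        · simpa using i7
        · simp [IExp.value, i8]
          omega
        · simpa using h1
        · simp [RExp.value, r7, h2]
        · intro σ' h'
          simpa [ht] using h'
    · simp only [Test.cost, IExp.cost, RExp.cost, ← hWdef]
      have e1 : (m + 1 + 1) * ((p.horizon + 1) * (2000 * W)) =
        (m + 1) * ((p.horizon + 1) * (2000 * W)) + (p.horizon + 1) * (2000 * W) := by ring
      have e2 : (p.horizon + 1) * (2000 * W) = 2 * ((p.horizon + 1) * (1000 * W)) := by ring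
      omega

theorem measureCmd_runs [NeZero K] (hp : 0 < p.lam) {s₀ : S} {l : ℕ} (hl : l < p.horizon)
    (hlen : ∀ l' ≤ l, y.len l' = y.C.length) {π : S → Fin K}
    (hπ : ∀ s r, IsRank p acc.feature y.C s r → r ≤ y.C.length →
      π s = y.policy p acc.feature s r l)
    (hM : slot d p.horizon y.C.length 0 ≤ M) (hM' : 6 + 3 * y.C.length ≤ M) {k : ℕ}
    (hk : k < y.C.length) {σ : Store S K} (hσ : PlannerMem p acc s₀ y σ) (h6 : σ.idx 6 = l)
    (h7 : σ.idx 7 = k) :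
    Runs acc M measureCmd σ
      ((p.rollouts d + 1) * ((p.horizon + 1) *
        (2100 * ((y.C.length + p.horizon + 2) * ((K + 1) * (d + 1))))))
      (Delivers p acc.feature y.C 7 (measure p acc y.C[k].1 y.C[k].2 π
        (cover p acc.feature y.C) σ.trace)) := by
  have hW : 1 ≤ (p.rollouts d + 1) * ((p.horizon + 1) *
      ((y.C.length + p.horizon + 2) * ((K + 1) * (d + 1)))) :=
    Nat.one_le_iff_ne_zero.2 (by positivity)
  apply Runs.le
  · unfold measureCmd
    apply Runs.seq
    apply Runs.setIdx
    apply Runs.seq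
    apply Runs.setIdx
    apply Runs.seq
    apply Runs.setReal
    apply Runs.seq
    refine (episodesCmd_runs hp (s₀ := s₀) hl hlen hπ hM hM' hk (p.rollouts d) le_rfl 0 _ ?_ ?_ ?_ ?_ ?_
      ?_).mono ?_
    · refine hσ.of_frame (c := .setIdx 8 (.const 0) ;; .setIdx 19 (.const 0) ;;
        .setReal 7 (.reg 9)) ?_ rfl
      constructor <;> simp +contextual [Function.update_of_ne]
    · simpa using h6
    · simpa using h7
    · simp [IExp.value]
    · simp [IExp.value]
    · simp [RExp.value, IExp.value]
    intro σ₁ ⟨hd, h8⟩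
    apply Runs.setReal
    rw [measure]
    simp only at hd
    generalize episodes p acc y.C[k].1 y.C[k].2 π _ _ _ _ = o at hd ⊢
    obtain ⟨o | q, tr⟩ := o
    · exact hd
    · obtain ⟨ht, h1, h2⟩ := hd
      refine ⟨ht, h1, ?_⟩
      -- After a success the counter equals the number of rollouts, so dividing by the counter gives
      -- the average.
      simp [RExp.value, IExp.value, h8 h1, h2]
  · simp only [IExp.cost, RExp.cost]
    set W := (y.C.length + p.horizon + 2) * ((K + 1) * (d + 1))
    have e : ∀ c, (p.rollouts d + 1) * ((p.horizon + 1) * (c * W)) =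
        c * ((p.rollouts d + 1) * ((p.horizon + 1) * W)) := fun c => by ring
    rw [e, e]
    omega

end Measurement

/-! ### A potential that counts the iterations -/

section Progress

variable {S : Type*} {d K : ℕ}

/-- The number of core pairs and estimates. It grows by one in each iteration of the planner. -/
def Ledger.progress (y : Ledger S d K) (H : ℕ) : ℕ := y.C.length + ∑ l ∈ Finset.range H, y.meas l

theorem Ledger.progress_push (y : Ledger S d K) (e : S × Fin K) (H : ℕ) :
    (y.push e).progress H = y.progress H + 1 := by
  simp only [Ledger.progress, Ledger.push, List.length_append, List.length_singleton]
  omega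

theorem Ledger.progress_record (y : Ledger S d K) {l H : ℕ} (hl : l < H) (r : ℝ) :
    (y.record l r).progress H = y.progress H + 1 := by
  simp only [Ledger.progress, Ledger.record]
  rw [Finset.sum_update_of_mem (Finset.mem_range.2 hl),
    ← Finset.add_sum_erase _ _ (Finset.mem_range.2 hl), Finset.sdiff_singleton_eq_erase]
  omega

/-- Each of the `H` levels holds at most one estimate per core pair. As the length is bounded, this
bounds the number of iterations and yields termination whatever the simulator answers. -/
theorem Ledger.Chain.progress_le {y : Ledger S d K} {H : ℕ} (h : y.Chain H) :
    y.progress H ≤ y.C.length * (H + 1) := by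
  have : ∑ l ∈ Finset.range H, y.meas l ≤ ∑ l ∈ Finset.range H, y.C.length :=
    Finset.sum_le_sum fun l hl =>
      (h.meas_le l (Finset.mem_range.1 hl)).trans (h.len_le (Finset.mem_range.1 hl).le)
  rw [Finset.sum_const, Finset.card_range, smul_eq_mul] at this
  rw [Ledger.progress]
  nlinarith

end Progress

/-! ### Iterations of the planner in terms of the ledger -/

section Steps

variable {S : Type*} {d K : ℕ} [NeZero K] {p : Params} {acc : Access S d K} {s₀ : S}
  {x : PlanState S K} {y : Ledger S d K}

theorem Track.core_zero {φ : S → Fin K → Fin d → ℝ} (h : Track p φ x y) : x.C 0 = y.C := by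
  rw [h.core 0 (Nat.zero_le _), h.chain.len_zero, List.take_length]

theorem Track.planStep_start (h : Track p acc.feature x y) {a : Fin K}
    (ha : firstAction (fun a => (s₀, a) ∉ actionCover p acc.feature y.C) = some a) :
    planStep p acc s₀ x = some (x.append 0 [(s₀, a)]) := by
  simp only [planStep, h.core_zero, ha]

theorem Track.planStep_return (h : Track p acc.feature x y)
    (ha : firstAction (fun a => (s₀, a) ∉ actionCover p acc.feature y.C) = none)
    (hm : ∀ l < p.horizon, y.meas l = y.len l) : planStep p acc s₀ x = none := by
  simp only [planStep, h.core_zero, ha,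
    h.lmin_eq le_rfl hm fun hlt => absurd hlt (lt_irrefl _), if_pos]

/-- At the lowest level with a missing estimate the core sequence is that of level 0, and estimates
fill up from the left. So the pair to measure is found by counting, and the level is complete once
the count reaches the length. -/
theorem Track.planStep_measure (h : Track p acc.feature x y) (hs : y.Settled p.horizon)
    (ha : firstAction (fun a => (s₀, a) ∉ actionCover p acc.feature y.C) = none) {l : ℕ}
    (hl : l < p.horizon) (hlt : ∀ l' < l, y.meas l' = y.len l') (hm : y.meas l < y.C.length) :
    planStep p acc s₀ x =
      match measure p acc y.C[y.meas l].1 y.C[y.meas l].2 (x.pol l) (cover p acc.feature y.C)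
        x.trace with
      | (.discover s', tr) =>
        some (PlanState.append { x with trace := tr } 0
          [(s', (firstAction fun a => (s', a) ∉ actionCover p acc.feature y.C).getD 0)])
      | (.success r, tr) =>
        if y.meas l + 1 < y.C.length then
          some { x with
            qbar := Function.update x.qbar l ((x.qbar l).set (y.meas l) (some r)), trace := tr }
        else
          some (PlanState.improve p acc { x with
            qbar := Function.update x.qbar l ((x.qbar l).set (y.meas l) (some r)),
            trace := tr } l) := by
  have hlen : y.len l = y.C.length := hs.len_eq h.chain hl.le hlt
  have hcore : x.C l = y.C := by rw [h.core l hl.le, hlen, List.take_length]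
  have hmin : x.lmin p.horizon = l := h.lmin_eq hl.le hlt fun _ => by omega
  simp only [planStep, h.core_zero, ha, hmin, if_neg hl.ne, hcore, h.findIdx_eq hl (by omega),
    List.getD_eq_getElem _ _ hm]
  generalize measure p acc y.C[y.meas l].1 y.C[y.meas l].2 (x.pol l) (cover p acc.feature y.C)
    x.trace = o
  obtain ⟨s' | r, tr⟩ := o
  · rfl
  · have hnone := ((h.record hl (by omega) r).none_mem_iff hl).trans
      (show _ ↔ y.meas l + 1 < y.C.length by simp [Ledger.record, hlen]; omega)
    simp only at hnone ⊢
    by_cases hc : y.meas l + 1 < y.C.length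
    · rw [if_pos hc, if_pos (hnone.2 hc)]
    · rw [if_neg hc, if_neg (mt hnone.1 hc)]

end Steps

/-! ### Simulation of the planner by the program -/

section MainLoop

variable {S : Type*} {d K : ℕ} {acc : Access S d K} {M : ℕ} {p : Params} {s₀ : S}

/-- Put the lowest level with a missing estimate into the index register 6. -/
def scanCmd : Cmd :=
  .setIdx 6 (.reg 2) ;;
  .forLoop 16 (.reg 2)
    (.loadIdx 18 (.plus (.const 4) (.times (.const 3) (.reg 16))) ;;
     .loadIdx 20 (.plus (.const 5) (.times (.const 3) (.reg 16))) ;;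
     .ite (.conj (.ltIdx (.reg 20) (.reg 18)) (.neg (.ltIdx (.reg 6) (.reg 2))))
       (.setIdx 6 (.reg 16)) .skip)

theorem scanCmd_runs {y : Ledger S d K} {σ : Store S K} (h : PlannerMem p acc s₀ y σ)
    (hch : y.Chain p.horizon) (hM : 5 + 3 * p.horizon ≤ M) :
    Runs acc M scanCmd σ (60 * (p.horizon + 1)) fun σ' =>
      (σ'.idx 6 = p.horizon ∧ ∀ l < p.horizon, y.meas l = y.len l) ∨
      (σ'.idx 6 < p.horizon ∧ (∀ l < σ'.idx 6, y.meas l = y.len l) ∧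
        y.meas (σ'.idx 6) < y.len (σ'.idx 6)) := by
  apply Runs.le
  · unfold scanCmd
    apply Runs.seq
    apply Runs.setIdx
    apply Runs.forLoop p.horizon (fun j σ' =>
      (σ'.idx 6 = p.horizon ∧ ∀ l < j, y.meas l = y.len l) ∨
      (σ'.idx 6 < p.horizon ∧ (∀ l < σ'.idx 6, y.meas l = y.len l) ∧
        y.meas (σ'.idx 6) < y.len (σ'.idx 6)))
    · simp
    · intro σ' hf
      simpa [IExp.value, h.horizon] using hf.idx 2 (by simp)
    · left
      simp [IExp.value, h.horizon]
    · intro j σ' v hI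
      simpa using hI
    · intro j hj σ' hf hj' hI
      have hi2 : σ'.idx 2 = p.horizon := by simpa [h.horizon] using hf.idx 2 (by simp)
      have him : σ'.idxMem = σ.idxMem := hf.idxMem (by simp)
      apply Runs.seq
      apply Runs.loadIdx
      · simp [IExp.value, hj']
        omega
      apply Runs.seq
      apply Runs.loadIdx
      · simp [IExp.value, hj']
        omega
      have hlen := h.len j hj.le
      have hmeas := h.meas j hj
      have hle := hch.meas_le j hj
      apply Runs.ite
      · intro hb
        simp [Test.Holds, IExp.value, him, hj', hi2, hlen, hmeas] at hb
        apply Runs.setIdx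
        right
        rcases hI with ⟨-, hI⟩ | ⟨hI, -⟩
        · simpa [IExp.value, hj'] using ⟨hj, hI, hb.1⟩
        · omega
      · intro hb
        simp [Test.Holds, IExp.value, him, hj', hi2, hlen, hmeas] at hb
        apply Runs.skip
        rcases hI with ⟨h6, hI⟩ | hI
        · left
          refine ⟨by simpa using h6, fun l hl => ?_⟩
          rcases Nat.lt_succ_iff_lt_or_eq.1 hl with hl | rfl
          · exact hI l hl
          · by_contra hne
            have := hb (by omega)
            omega
        · right
          simpa using hI
    · intro σ' _ hI
      exact hI
  · simp only [Test.cost, IExp.cost]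
    omega

/-- One iteration of the planner. The flag in the index register 5 is set to `1` if the planner
returns. -/
def iterationCmd : Cmd :=
  .setState 1 0 ;;
  coverCmd ;;
  .ite (.ltIdx (.reg 10) (.reg 1)) pushCmd
    (scanCmd ;;
     .ite (.ltIdx (.reg 6) (.reg 2))
      (.loadIdx 7 (.plus (.const 5) (.times (.const 3) (.reg 6))) ;;
       measureCmd ;;
       .ite (.ltIdx (.const 0) (.reg 19)) pushCmd
        (recordCmd ;;
         .ite (.ltIdx (.plus (.reg 7) (.const 1)) (.reg 3)) .skip propagateCmd))
      (.setIdx 5 (.const 1)))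

variable [NeZero K]

/-- The store `σ` represents the variables `x` of the planner through the ledger `y`. -/
structure Represents (p : Params) (acc : Access S d K) (s₀ : S) (x : PlanState S K)
    (y : Ledger S d K) (σ : Store S K) : Prop where
  track : Track p acc.feature x y
  settled : y.Settled p.horizon
  mem : PlannerMem p acc s₀ y σ
  trace : σ.trace = x.trace

/-- The unit in which the computation of one iteration of the planner is measured. -/
noncomputable def iterationUnit (p : Params) (d K N : ℕ) : ℕ :=
  (p.rollouts d + 1) * ((p.horizon + 1) * ((N + p.horizon + 2) * ((K + 1) * (d + 1))))

/-- A simulation argument: the program and the planner take matching steps, and each step that does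
not return raises the potential by one. The bound `N` on all fresh sequences keeps every address
within the memory and every cost below one common unit. -/
theorem iterationCmd_runs (hp : 0 < p.lam) {N : ℕ}
    (hN : ∀ C, Fresh p acc.feature C → C.length ≤ N) (hM : slot d p.horizon N 0 ≤ M)
    (hM' : 6 + 3 * N ≤ M) (hM'' : 5 + 3 * p.horizon ≤ M) {x : PlanState S K}
    {y : Ledger S d K} {σ : Store S K} (h : Represents p acc s₀ x y σ) (h5 : σ.idx 5 = 0) :
    Runs acc M iterationCmd σ (5000 * iterationUnit p d K N) fun σ' =>
      (σ'.idx 5 = 1 ∧ planStep p acc s₀ x = none ∧ Represents p acc s₀ x y σ' ∧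
        ∀ l < p.horizon, y.meas l = y.len l) ∨
      (σ'.idx 5 = 0 ∧ ∃ x' y', planStep p acc s₀ x = some x' ∧ Represents p acc s₀ x' y' σ' ∧
        y'.progress p.horizon = y.progress p.horizon + 1) := by
  obtain ⟨hT, hs, hmem, htr⟩ := h
  have hyN : y.C.length ≤ N := hN _ hT.fresh
  have slot_mono : ∀ {n}, n ≤ N → slot d p.horizon n 0 ≤ M := fun hn => by
    refine le_trans ?_ hM
    unfold slot
    gcongr
  have hMy := slot_mono hyN
  -- Common to both ways in which a pair is appended: for the start state, and for a state
  -- discovered by a measurement.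
  have pushed : ∀ (σ₁ : Store S K) (tr : List (S × Fin K)) (a : Fin K),
      PlannerMem p acc s₀ y σ₁ → σ₁.idx 5 = 0 → σ₁.trace = tr → σ₁.idx 10 = a →
      (σ₁.state 1, a) ∉ actionCover p acc.feature y.C →
      planStep p acc s₀ x =
        some (PlanState.append { x with trace := tr } 0 [(σ₁.state 1, a)]) →
      Runs acc M pushCmd σ₁ (600 * ((N + 1) * (d + 1))) fun σ' =>
        (σ'.idx 5 = 1 ∧ planStep p acc s₀ x = none ∧ Represents p acc s₀ x y σ' ∧
          ∀ l < p.horizon, y.meas l = y.len l) ∨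
        (σ'.idx 5 = 0 ∧ ∃ x' y', planStep p acc s₀ x = some x' ∧
          Represents p acc s₀ x' y' σ' ∧
          y'.progress p.horizon = y.progress p.horizon + 1) := by
    intro σ₁ tr a hσ₁ h5₁ htr₁ ha hna hstep
    have hfr := hT.fresh.append_singleton hna
    -- The extended sequence is fresh too, so its length obeys the bound before the pair is stored;
    -- the new record therefore fits into the memory.
    have hlt : y.C.length + 1 ≤ N := by simpa using hN _ hfr
    refine (Runs.mono (pushCmd_runs hp hσ₁ hT.chain (slot_mono hlt) (by omega) a ha) ?_).le ?_
    · intro σ' ⟨hσ', hf⟩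
      refine Or.inr ⟨(hf.idx 5 (by decide)).trans h5₁, _, _, hstep,
        ⟨(hT.setTrace tr).append_zero hp hna, hs.push hT.chain _, hσ', ?_⟩,
        y.progress_push _ _⟩
      rw [hf.trace (by decide), htr₁]
      rfl
    · gcongr
  apply Runs.le
  · unfold iterationCmd
    apply Runs.seq
    apply Runs.setState
    have hmem₀ : PlannerMem p acc s₀ y
        { σ with state := Function.update σ.state 1 (σ.state 0) } := by
      refine hmem.of_frame (c := .setState 1 0) ?_ rfl
      constructor <;> simp +contextual [Function.update_of_ne]
    apply Runs.seq
    refine (coverCmd_runs hp hmem₀.toTables hMy).monoFrame fun σ₁ ⟨_, hu⟩ hf₁ => ?_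
    have hσ₁ := hmem₀.of_frame hf₁ rfl
    have s1 : σ₁.state 1 = s₀ := by simpa [hmem.start] using hf₁.state 1 (by decide)
    have i5 : σ₁.idx 5 = 0 := (hf₁.idx 5 (by decide)).trans h5
    have t1 : σ₁.trace = x.trace := (hf₁.trace (by decide)).trans htr
    simp only [Function.update_self, hmem.start] at hu
    apply Runs.ite
    · intro hb
      simp only [Test.Holds, IExp.value, hσ₁.actions] at hb
      obtain ⟨-, a, ha₁, ha₂, ha₃⟩ := hu.of_lt hb
      exact pushed σ₁ x.trace a hσ₁ i5 t1 ha₂ (by rwa [s1]) (by rw [s1]; exact hT.planStep_start ha₁)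
    · intro hb
      simp only [Test.Holds, IExp.value, hσ₁.actions] at hb
      obtain ⟨-, hnone⟩ := hu.of_not_lt hb
      apply Runs.seq
      refine (scanCmd_runs hσ₁ hT.chain hM'').monoFrame fun σ₂ hscan hf₂ => ?_
      have hσ₂ := hσ₁.of_frame hf₂ rfl
      have i5₂ : σ₂.idx 5 = 0 := (hf₂.idx 5 (by decide)).trans i5
      have t2 : σ₂.trace = x.trace := (hf₂.trace (by decide)).trans t1
      apply Runs.ite
      · intro hb
        simp only [Test.Holds, IExp.value, hσ₂.horizon] at hb
        rcases hscan with ⟨h6, -⟩ | ⟨-, hlt, hm⟩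
        · omega
        generalize h6 : σ₂.idx 6 = l at hb hlt hm
        have hlen : y.len l = y.C.length := hs.len_eq hT.chain hb.le hlt
        have hlen' : ∀ l' ≤ l, y.len l' = y.C.length := fun l' hl' =>
          hs.len_eq hT.chain (hl'.trans hb.le) fun j hj => hlt j (by omega)
        have hk : y.meas l < y.C.length := by omega
        have hstep := hT.planStep_measure hs hnone hb hlt hk
        apply Runs.seq
        apply Runs.loadIdx
        · simp [IExp.value, h6]
          omega
        have hv : (IExp.plus (.const 5) (.times (.const 3) (.reg 6))).value σ₂ = 5 + 3 * l := by
          simp [IExp.value, h6]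
        rw [hv, hσ₂.meas l hb]
        have hσ₃ : PlannerMem p acc s₀ y
            { σ₂ with idx := Function.update σ₂.idx 7 (y.meas l) } := by
          refine hσ₂.of_frame (c := .setIdx 7 (.const 0)) ?_ rfl
          constructor <;> simp +contextual [Function.update_of_ne]
        apply Runs.seq
        refine (measureCmd_runs hp hb hlen' (fun s r hr hrN => hT.pol l hb.le s r hr (by omega))
          hMy (by omega) hk hσ₃ (by simpa using h6) (by simp)).monoFrame ?_
        intro σ₄ hd hf₄
        have hσ₄ := hσ₃.of_frame hf₄ rfl
        have i5₄ : σ₄.idx 5 = 0 := (hf₄.idx 5 (by decide)).trans (by simpa using i5₂)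
        have i6₄ : σ₄.idx 6 = l := (hf₄.idx 6 (by decide)).trans (by simpa using h6)
        have i7₄ : σ₄.idx 7 = y.meas l := (hf₄.idx 7 (by decide)).trans (by simp)
        simp only [t2] at hd
        generalize measure p acc y.C[y.meas l].1 y.C[y.meas l].2 (x.pol l)
          (cover p acc.feature y.C) x.trace = o at hd hstep
        obtain ⟨s' | r, tr⟩ := o
        · obtain ⟨ht, h19, h1, a, ha₁, ha₂, ha₃⟩ := hd
          apply Runs.ite
          · intro _
            refine pushed σ₄ tr a hσ₄ i5₄ ht ha₂ (by rwa [h1]) ?_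
            rw [hstep]
            simp only [ha₁, h1, Option.getD_some]
          · intro hb'
            simp [Test.Holds, IExp.value, h19] at hb'
        · obtain ⟨ht, h19, h7⟩ := hd
          apply Runs.ite
          · intro hb'
            simp [Test.Holds, IExp.value, h19] at hb'
          · intro _
            have hrec := (hT.record hb (by omega) r).setTrace tr
            apply Runs.seq
            refine (recordCmd_runs hσ₄ hT.chain hMy hM'' hb (by omega) i6₄ i7₄).mono ?_
            intro σ₅ ⟨hσ₅, hf₅⟩
            rw [h7] at hσ₅
            have i5₅ : σ₅.idx 5 = 0 := (hf₅.idx 5 (by decide)).trans i5₄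
            have i6₅ : σ₅.idx 6 = l := (hf₅.idx 6 (by decide)).trans i6₄
            have i7₅ : σ₅.idx 7 = y.meas l := (hf₅.idx 7 (by decide)).trans i7₄
            have t5 : σ₅.trace = tr := (hf₅.trace (by decide)).trans ht
            apply Runs.ite
            · intro hb'
              simp only [Test.Holds, IExp.value, i7₅, hσ₅.size] at hb'
              replace hb' : y.meas l + 1 < y.C.length := hb'
              simp only [if_pos hb'] at hstep
              apply Runs.skip
              exact Or.inr ⟨i5₅, _, _, hstep, ⟨hrec, hs.record (by omega) r, hσ₅, t5⟩,
                y.progress_record hb r⟩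
            · intro hb'
              simp only [Test.Holds, IExp.value, i7₅, hσ₅.size] at hb'
              replace hb' : ¬ y.meas l + 1 < y.C.length := hb'
              simp only [if_neg hb'] at hstep
              have hfull : (y.record l r).meas l = (y.record l r).len l := by
                simp only [Ledger.record, Function.update_self]
                omega
              refine Runs.mono (t := 600 * ((y.C.length + 1) * (d + 1))) (propagateCmd_runs hp hσ₅
                hMy (show 6 + 3 * y.C.length ≤ M by omega) hM'' hb hlen hfull i6₅) ?_
              intro σ₆ ⟨hσ₆, hf₆⟩
              exact Or.inr ⟨(hf₆.idx 5 (by decide)).trans i5₅, _, _, hstep,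
                ⟨hrec.improve hp hb hfull,
                  hs.record_propagate hT.chain hb (by omega) r _, hσ₆,
                  (hf₆.trace (by decide)).trans t5⟩, y.progress_record hb r⟩
      · intro hb
        simp only [Test.Holds, IExp.value, hσ₂.horizon] at hb
        rcases hscan with ⟨h6, hall⟩ | ⟨h6, -⟩
        · apply Runs.setIdx
          refine Or.inl ⟨by simp [IExp.value], hT.planStep_return hnone hall,
            ⟨hT, hs, ?_, t2⟩, hall⟩
          refine hσ₂.of_frame (c := .setIdx 5 (.const 0)) ?_ rfl
          constructor <;> simp +contextual [Function.update_of_ne]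
        · omega
  · simp only [Test.cost, IExp.cost]
    have hU : 1 ≤ iterationUnit p d K N :=
      Nat.one_le_iff_ne_zero.2 (by unfold iterationUnit; positivity)
    have u1 : (K + 1) * ((y.C.length + 1) * (d + 1)) ≤ iterationUnit p d K N := by
      calc (K + 1) * ((y.C.length + 1) * (d + 1))
          = 1 * (1 * ((y.C.length + 1) * ((K + 1) * (d + 1)))) := by ring
        _ ≤ iterationUnit p d K N := by unfold iterationUnit; gcongr <;> omega
    have u2 : (N + 1) * (d + 1) ≤ iterationUnit p d K N := by
      calc (N + 1) * (d + 1) = 1 * (1 * ((N + 1) * (1 * (d + 1)))) := by ring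
        _ ≤ iterationUnit p d K N := by unfold iterationUnit; gcongr <;> omega
    have u3 : (y.C.length + 1) * (d + 1) ≤ (N + 1) * (d + 1) := by gcongr
    have u4 : p.horizon + 1 ≤ iterationUnit p d K N := by
      calc p.horizon + 1 = 1 * ((p.horizon + 1) * (1 * (1 * 1))) := by ring
        _ ≤ iterationUnit p d K N := by unfold iterationUnit; gcongr <;> omega
    have u5 : (p.rollouts d + 1) * ((p.horizon + 1) *
        (2100 * ((y.C.length + p.horizon + 2) * ((K + 1) * (d + 1))))) ≤
        2100 * iterationUnit p d K N := by
      calc (p.rollouts d + 1) * ((p.horizon + 1) *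
            (2100 * ((y.C.length + p.horizon + 2) * ((K + 1) * (d + 1)))))
          = 2100 * ((p.rollouts d + 1) * ((p.horizon + 1) *
            ((y.C.length + p.horizon + 2) * ((K + 1) * (d + 1))))) := by ring
        _ ≤ 2100 * iterationUnit p d K N := by unfold iterationUnit; gcongr
    omega

/-- The main loop of the planner. -/
def mainCmd : Cmd := .loop (.ltIdx (.reg 5) (.const 1)) iterationCmd

/-- The number `n` bounds the iterations that the potential still permits. It counts the iterations
before the last one, whence `n + 1` in the time. -/
theorem mainCmd_runs (hp : 0 < p.lam) {N : ℕ}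
    (hN : ∀ C, Fresh p acc.feature C → C.length ≤ N) (hM : slot d p.horizon N 0 ≤ M)
    (hM' : 6 + 3 * N ≤ M) (hM'' : 5 + 3 * p.horizon ≤ M) (n : ℕ) {x : PlanState S K}
    {y : Ledger S d K} {σ : Store S K} (h : Represents p acc s₀ x y σ) (h5 : σ.idx 5 = 0)
    (hn : N * (p.horizon + 1) ≤ y.progress p.horizon + n) :
    Runs acc M mainCmd σ ((n + 1) * (5010 * iterationUnit p d K N)) fun σ' =>
      ∃ x' y', Relation.ReflTransGen (fun u v => planStep p acc s₀ u = some v) x x' ∧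
        planStep p acc s₀ x' = none ∧ Represents p acc s₀ x' y' σ' ∧
        ∀ l < p.horizon, y'.meas l = y'.len l := by
  have hU : 1 ≤ iterationUnit p d K N := Nat.one_le_iff_ne_zero.2 (by unfold iterationUnit; positivity)
  induction n generalizing x y σ with
  | zero =>
    apply Runs.le
    · apply Runs.loopStep (t₂ := 3)
      · simp [Test.Holds, IExp.value, h5]
      refine (iterationCmd_runs hp hN hM hM' hM'' h h5).mono ?_
      rintro σ' (⟨h5', hret, hrep, hall⟩ | ⟨-, x', y', -, hrep, hpr⟩)
      · refine (Runs.loopStop ?_ ?_)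
        · simp [Test.Holds, IExp.value, h5']
        · exact ⟨x, y, .refl, hret, hrep, hall⟩
      -- With no iterations left the potential is already maximal, so a further step would exceed
      -- its bound; the planner has to return.
      · have h1 := hrep.track.chain.progress_le
        have h2 := Nat.mul_le_mul_right (p.horizon + 1) (hN _ hrep.track.fresh)
        omega
    · simp only [Test.cost, IExp.cost]
      omega
  | succ n ih =>
    apply Runs.le
    · apply Runs.loopStep (t₂ := (n + 1) * (5010 * iterationUnit p d K N))
      · simp [Test.Holds, IExp.value, h5]
      refine (iterationCmd_runs hp hN hM hM' hM'' h h5).mono ?_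
      rintro σ' (⟨h5', hret, hrep, hall⟩ | ⟨h5', x', y', hstep, hrep, hpr⟩)
      · refine (Runs.loopStop ?_ ?_).le ?_
        · simp [Test.Holds, IExp.value, h5']
        · exact ⟨x, y, .refl, hret, hrep, hall⟩
        · have := Nat.mul_le_mul_right (5010 * iterationUnit p d K N) (show 1 ≤ n + 1 by omega)
          simp only [Test.cost, IExp.cost]
          omega
      · refine (ih hrep h5' (by omega)).mono ?_
        rintro σ'' ⟨x'', y'', hreach, hrest⟩
        exact ⟨x'', y'', .head hstep hreach, hrest⟩
    · simp only [Test.cost, IExp.cost]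
      have : (n + 1 + 1) * (5010 * iterationUnit p d K N) =
        (n + 1) * (5010 * iterationUnit p d K N) + 5010 * iterationUnit p d K N := by ring
      omega

end MainLoop

/-! ### Parameters, the complete planner, and the evaluation program -/

section Initialization

variable {S : Type*} {d K : ℕ} {acc : Access S d K} {M : ℕ} {p : Params} {s₀ : S}

/-- The number of which the horizon is the ceiling. -/
def horizonExp : RExp :=
  .quot (.log (.times (.quot (.reg 1) (.ofIdx (.const 4))) (.minus (.ofIdx (.const 1)) (.reg 0))))
    (.log (.reg 0))

/-- Count up to the horizon in the index register 2. -/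
def horizonCmd : Cmd :=
  .loop (.neg (.leReal horizonExp (.ofIdx (.reg 2)))) (.setIdx 2 (.plus (.reg 2) (.const 1)))

/-- The ceiling is found by counting up to the real quotient. If the quotient is not positive, the
loop ends at once with horizon 0. The time is linear in the horizon, which is affordable. -/
theorem horizonCmd_runs (n : ℕ) {σ : Store S K} (hγ : σ.real 0 = p.γ) (hω : σ.real 1 = p.ω)
    (hn : σ.idx 2 + n = p.horizon) :
    Runs acc M horizonCmd σ (40 * (n + 1)) fun σ' => σ'.idx 2 = p.horizon := by
  have hv : ∀ σ : Store S K, σ.real 0 = p.γ → σ.real 1 = p.ω → horizonExp.value σ =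
      Real.log ((p.ω / 4) * (1 - p.γ)) / Real.log p.γ := fun σ h0 h1 => by
    simp [horizonExp, RExp.value, IExp.value, h0, h1]
  induction n generalizing σ with
  | zero =>
    refine (Runs.loopStop ?_ ?_).le ?_
    · have := Nat.le_ceil (Real.log ((p.ω / 4) * (1 - p.γ)) / Real.log p.γ)
      rw [Test.Holds, not_not, Test.Holds, hv σ hγ hω, RExp.value, IExp.value,
        show σ.idx 2 = p.horizon from hn]
      exact this
    · exact hn
    · simp [Test.cost, horizonExp, RExp.cost, IExp.cost]
  | succ n ih =>
    apply Runs.le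
    · apply Runs.loopStep (t₂ := 40 * (n + 1))
      · rw [Test.Holds, Test.Holds, hv σ hγ hω, RExp.value, IExp.value, not_le, ← Nat.lt_ceil]
        change _ < p.horizon
        omega
      apply Runs.setIdx
      refine ih ?_ ?_ ?_
      · exact hγ
      · exact hω
      · simp [IExp.value]
        omega
    · simp only [Test.cost, horizonExp, RExp.cost, IExp.cost]
      omega

/-- Compute the parameters of the planner. -/
def parameterCmd : Cmd :=
  .setReal 5 (.quot (.times (.reg 1) (.reg 1)) (.times (.reg 4) (.reg 4))) ;;
  horizonCmd ;;
  .setReal 7 (.times (.times (.ofIdx (.const 4)) (.ofIdx (.reg 0)))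
    (.log (.plus (.ofIdx (.const 1))
      (.quot (.times (.ofIdx (.const 4)) (.times (.reg 3) (.reg 3))) (.reg 5))))) ;;
  .setReal 8 (.log (.quot (.ofIdx (.const 2))
    (.quot (.reg 2) (.times (.reg 7) (.ofIdx (.reg 2)))))) ;;
  .setReal 9 (.times (.quot (.reg 1) (.ofIdx (.const 4)))
    (.minus (.ofIdx (.const 1)) (.reg 0))) ;;
  .setReal 6 (.quot (.quot (.reg 8) (.times (.reg 9) (.reg 9))) (.ofIdx (.const 2)))

theorem parameterCmd_runs :
    Runs acc M parameterCmd (Store.planInput d K p s₀) (40 * (p.horizon + 1) + 80) fun σ' =>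
      σ'.idx 2 = p.horizon ∧ σ'.real 5 = p.lam ∧ σ'.real 6 = p.rolloutBound d := by
  apply Runs.le
  · unfold parameterCmd
    apply Runs.seq
    apply Runs.setReal
    apply Runs.seq
    refine (horizonCmd_runs (p := p) p.horizon ?_ ?_ ?_).monoFrame ?_
    · simp [Store.planInput]
    · simp [Store.planInput]
    · simp [Store.planInput]
    intro σ h2 hf
    have i0 : σ.idx 0 = d := (hf.idx 0 (by decide)).trans (by simp [Store.planInput])
    have r0 : σ.real 0 = p.γ := (hf.real 0 (by decide)).trans (by simp [Store.planInput])
    have r1 : σ.real 1 = p.ω := (hf.real 1 (by decide)).trans (by simp [Store.planInput])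
    have r2 : σ.real 2 = p.δ := (hf.real 2 (by decide)).trans (by simp [Store.planInput])
    have r3 : σ.real 3 = p.L := (hf.real 3 (by decide)).trans (by simp [Store.planInput])
    have r5 : σ.real 5 = p.lam := (hf.real 5 (by decide)).trans
      (by simp [Store.planInput, RExp.value, Params.lam, sq])
    apply Runs.seq
    apply Runs.setReal
    apply Runs.seq
    apply Runs.setReal
    apply Runs.seq
    apply Runs.setReal
    apply Runs.setReal
    refine ⟨h2, by simpa using r5, ?_⟩
    simp only [RExp.value, IExp.value, Function.update_self, ne_eq, Nat.reduceEqDiff,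
      not_false_eq_true, Function.update_of_ne, i0, h2, r0, r1, r2, r3, r5, Params.rolloutBound,
      Params.zeta, Params.dTilde]
    push_cast
    rw [← sq, ← sq, mul_pow, div_eq_mul_inv _ ((p.ω / 4) ^ 2 * (1 - p.γ) ^ 2), mul_inv,
      mul_comm (Real.log _)]
  · simp only [IExp.cost, RExp.cost]
    omega

/-- Compute the parameters of the planner, and store those that the evaluation of policies
needs. -/
def initCmd : Cmd :=
  parameterCmd ;;
  .storeIdx (.const 0) (.reg 0) ;;
  .storeIdx (.const 1) (.reg 1) ;;
  .storeIdx (.const 2) (.reg 2) ;;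
  .storeReal (.const 0) (.reg 5) ;;
  .storeReal (.const 1) (.reg 1)

theorem initCmd_runs (hM : 3 ≤ M) :
    Runs acc M initCmd (Store.planInput d K p s₀) (40 * (p.horizon + 1) + 100) fun σ' =>
      PlannerMem p acc s₀ (Ledger.empty S d K) σ' ∧ σ'.idx 5 = 0 ∧ σ'.trace = [] := by
  apply Runs.le
  · unfold initCmd
    apply Runs.seq
    refine parameterCmd_runs.monoFrame fun σ ⟨h2, r5, r6⟩ hf => ?_
    have i0 : σ.idx 0 = d := (hf.idx 0 (by decide)).trans (by simp [Store.planInput])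
    have i1 : σ.idx 1 = K := (hf.idx 1 (by decide)).trans (by simp [Store.planInput])
    have i3 : σ.idx 3 = 0 := (hf.idx 3 (by decide)).trans (by simp [Store.planInput])
    have i5 : σ.idx 5 = 0 := (hf.idx 5 (by decide)).trans (by simp [Store.planInput])
    have r0 : σ.real 0 = p.γ := (hf.real 0 (by decide)).trans (by simp [Store.planInput])
    have r1 : σ.real 1 = p.ω := (hf.real 1 (by decide)).trans (by simp [Store.planInput])
    have s0 : σ.state 0 = s₀ := (hf.state 0 (by decide)).trans (by simp [Store.planInput])
    have im : σ.idxMem = fun _ => 0 := hf.idxMem (by decide)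
    have tr : σ.trace = [] := hf.trace (by decide)
    apply Runs.seq
    apply Runs.storeIdx
    · simp only [IExp.value]; omega
    apply Runs.seq
    apply Runs.storeIdx
    · simp only [IExp.value]; omega
    apply Runs.seq
    apply Runs.storeIdx
    · simp only [IExp.value]; omega
    apply Runs.seq
    apply Runs.storeReal
    · simp only [IExp.value]; omega
    apply Runs.storeReal
    · simp only [IExp.value]; omega
    refine ⟨?_, i5, tr⟩
    have hcell : ∀ b, 3 ≤ b → Function.update (Function.update (Function.update
        (fun _ => 0 : ℕ → ℕ) 0 d) 1 K) 2 p.horizon b = 0 := fun b hb => by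
      rw [Function.update_of_ne (by omega), Function.update_of_ne (by omega),
        Function.update_of_ne (by omega)]
    simp only [IExp.value, RExp.value, i0, i1, h2, r5, r1, im]
    exact
    { dim := i0
      actions := i1
      horizon := h2
      size := i3
      omega := r1
      lam := r5
      dir := fun i hi => absurd hi (Nat.not_lt_zero _)
      den := fun i hi => absurd hi (Nat.not_lt_zero _)
      coef := fun l _ i hi => absurd hi (Nat.not_lt_zero _)
      gamma := r0
      bound := r6
      start := s0
      cell_dim := by simp
      cell_actions := by simp
      cell_horizon := by simp
      cell_lam := by simp
      cell_omega := by simp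
      len := fun l _ => hcell _ (by omega)
      meas := fun l _ => hcell _ (by omega)
      coreAct := fun i hi => absurd hi (Nat.not_lt_zero _)
      coreState := fun i hi => absurd hi (Nat.not_lt_zero _)
      est := fun l _ i hi => absurd hi (Nat.not_lt_zero _) }
  · simp only [IExp.cost, RExp.cost]
    omega

/-- The planner. -/
def planCmd : Cmd := initCmd ;; mainCmd

theorem planCmd_runs [NeZero K] (hp : 0 < p.lam) {N : ℕ}
    (hN : ∀ C, Fresh p acc.feature C → C.length ≤ N) (hM : slot d p.horizon N 0 ≤ M)
    (hM' : 6 + 3 * N ≤ M) (hM'' : 5 + 3 * p.horizon ≤ M) :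
    Runs acc M planCmd (Store.planInput d K p s₀)
      (40 * (p.horizon + 1) + 100 + (N * (p.horizon + 1) + 1) * (5010 * iterationUnit p d K N))
      fun σ => ∃ x y, PlanReturns p acc s₀ (x.pol p.horizon) σ.trace ∧
        Represents p acc s₀ x y σ ∧ ∀ l < p.horizon, y.meas l = y.len l := by
  unfold planCmd
  apply Runs.seq
  refine (initCmd_runs (by omega)).mono fun σ ⟨hσ, h5, ht⟩ => ?_
  refine (mainCmd_runs hp hN hM hM' hM'' (N * (p.horizon + 1)) (x := PlanState.initial S K)
    ⟨Track.initial, Ledger.Settled.empty _, hσ, ht⟩ h5 (Nat.le_add_left _ _)).mono ?_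
  rintro σ' ⟨x, y, hreach, hret, hrep, hall⟩
  exact ⟨x, y, ⟨x, hreach, hret, rfl, hrep.trace.symm⟩, hrep, hall⟩

/-- Evaluation of a stored policy. -/
def actCmd : Cmd :=
  .loadIdx 0 (.const 0) ;; .loadIdx 1 (.const 1) ;; .loadIdx 2 (.const 2) ;;
  .loadIdx 3 (.const 4) ;; .loadReal 5 (.const 0) ;; .loadReal 1 (.const 1) ;;
  .setIdx 6 (.reg 2) ;; coverCmd ;; policyCmd ;; .setIdx 0 (.reg 12)

/-- When the planner returns, every level has been propagated, so each vector that a covered state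
may need is present. Core states and core actions are not consulted: the vectors u, the denominators
and the coefficients suffice, together with the features of the query state. -/
theorem actCmd_runs [NeZero K] (hp : 0 < p.lam) {x : PlanState S K} {y : Ledger S d K}
    {σ : Store S K} (h : Represents p acc s₀ x y σ) (hall : ∀ l < p.horizon, y.meas l = y.len l)
    (hM : slot d p.horizon y.C.length 0 ≤ M) (hM' : 5 ≤ M) (s : S) :
    Runs acc M actCmd (σ.policyInput M s)
      (800 * ((y.C.length + p.horizon + 2) * ((K + 1) * (d + 1)))) fun σ' =>
        σ'.idx 0 = (x.pol p.horizon s : ℕ) ∧ σ'.trace = [] := by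
  obtain ⟨hT, hs, hmem, -⟩ := h
  have hlen : ∀ l ≤ p.horizon, y.len l = y.C.length := fun l hl =>
    hs.len_eq hT.chain hl fun l' hl' => hall l' (by omega)
  apply Runs.le
  · unfold actCmd
    apply Runs.seq
    apply Runs.loadIdx
    · simp only [IExp.value]; omega
    apply Runs.seq
    apply Runs.loadIdx
    · simp only [IExp.value]; omega
    apply Runs.seq
    apply Runs.loadIdx
    · simp only [IExp.value]; omega
    apply Runs.seq
    apply Runs.loadIdx
    · simp only [IExp.value]; omega
    apply Runs.seq
    apply Runs.loadReal
    · simp only [IExp.value]; omega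
    apply Runs.seq
    apply Runs.loadReal
    · simp only [IExp.value]; omega
    apply Runs.seq
    apply Runs.setIdx
    -- The length of level 0, kept in index cell 4, is the size of the core sequence; no separate
    -- cell is needed for it.
    have c0 := hmem.len 0 (Nat.zero_le _)
    rw [hT.chain.len_zero] at c0
    have hsl : ∀ {i l}, i < y.C.length → l ≤ p.horizon →
      slot d p.horizon i l + (d + 1) ≤ slot d p.horizon y.C.length 0 := slot_add_le
    have hT₀ : Tables p acc.feature y
        { σ.policyInput M s with
          idx := Function.update (Function.update (Function.update (Function.update
            (Function.update (fun _ => 0) 0 d) 1 K) 2 p.horizon) 3 y.C.length) 6 p.horizon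
          real := Function.update (Function.update (fun _ => 0) 5 p.lam) 1 p.ω } := by
      constructor
      · simp
      · simp
      · simp
      · simp
      · simp
      · simp
      · intro i hi j
        have := hsl hi (Nat.zero_le _)
        rw [← hmem.dir i hi j]
        exact if_pos (by have := j.2; omega)
      · intro i hi
        have := hsl hi (Nat.zero_le _)
        rw [← hmem.den i hi]
        exact if_pos (by omega)
      · intro l hl i hi j
        rw [hlen _ hl] at hi
        have := hsl hi (show l + 1 ≤ p.horizon from hl)
        rw [← hmem.coef l hl i (by rwa [hlen _ hl]) j]
        exact if_pos (by have := j.2; omega)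
    have e : ∀ {i}, i < 5 → i < M := fun h => by omega
    simp only [Store.policyInput, IExp.value, e (show 0 < 5 by omega), e (show 1 < 5 by omega),
      e (show 2 < 5 by omega), e (show 4 < 5 by omega), if_true, hmem.cell_dim, hmem.cell_actions,
      hmem.cell_horizon, hmem.cell_lam, hmem.cell_omega, show σ.idxMem 4 = _ from c0] at hT₀ ⊢
    simp only [ne_eq, Nat.reduceEqDiff, not_false_eq_true, Function.update_of_ne,
      Function.update_self]
    apply Runs.seq
    refine (coverCmd_runs hp hT₀ hM).monoFrame fun σ₁ ⟨hr, _⟩ hf₁ => ?_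
    have hT₁ : Tables p acc.feature y σ₁ := hT₀.of_eq (hf₁.idx 0 (by decide))
      (hf₁.idx 1 (by decide)) (hf₁.idx 2 (by decide)) (hf₁.idx 3 (by decide))
      (hf₁.real 1 (by decide)) (hf₁.real 5 (by decide)) (hf₁.realMem (by decide))
    have i6 : σ₁.idx 6 = p.horizon := (hf₁.idx 6 (by decide)).trans (by simp)
    have s1 : σ₁.state 1 = s := hf₁.state 1 (by decide)
    have t1 : σ₁.trace = [] := hf₁.trace (by decide)
    simp only at hr
    apply Runs.seq
    refine (policyCmd_runs hT₁ hM rfl i6 le_rfl fun hr l hl => by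
      rwa [hlen _ (by omega)]).monoFrame fun σ₂ ha hf₂ => ?_
    apply Runs.setIdx
    refine ⟨?_, (hf₂.trace (by decide)).trans t1⟩
    simp only [IExp.value, Function.update_self, ha, s1]
    split_ifs with hrN
    · rw [hT.pol _ le_rfl s _ hr (by rwa [hlen _ le_rfl])]
    -- In states that are never covered, all policies are still the initial one.
    · rw [hT.pol_of_notMem _ le_rfl s (mt hr.mem_cover_iff.1 hrN)]
      simp
  · simp only [IExp.cost]
    have hW : 1 ≤ (K + 1) * (d + 1) := Nat.one_le_iff_ne_zero.2 (by positivity)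
    have e : (y.C.length + p.horizon + 2) * ((K + 1) * (d + 1)) =
      (K + 1) * ((y.C.length + 1) * (d + 1)) + (p.horizon + 1) * ((K + 1) * (d + 1)) := by ring
    have : 1 * 1 ≤ (p.horizon + 1) * ((K + 1) * (d + 1)) := Nat.mul_le_mul (by omega) hW
    rw [e]
    omega

end Initialization

/-! ### Logarithmic bounds on horizon, core size and number of rollouts -/

section Bounds

/-- The admissible parameters in dimension `d`. -/
structure Params.Admissible (p : Params) (d : ℕ) : Prop where
  dim_pos : 1 ≤ d
  discount_pos : 0 < p.γ
  discount_lt : p.γ < 1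
  accuracy_pos : 0 < p.ω
  failure_pos : 0 < p.δ
  feature_nonneg : 0 ≤ p.L
  norm_pos : 0 < p.B

/-- The number of which the logarithmic factor is the logarithm. -/
noncomputable def Params.scale (p : Params) (d : ℕ) : ℝ :=
  3 + d + 1 / (1 - p.γ) + 1 / p.ω + 1 / p.δ + p.L + p.B

/-- A bound on the sizes of the core sequences. -/
noncomputable def Params.coreBound (p : Params) (d : ℕ) : ℕ := ⌊20 * d * p.logFactor d⌋₊

namespace Params.Admissible

variable {p : Params} {d : ℕ} (h : p.Admissible d)
include h

theorem one_le_dim : (1 : ℝ) ≤ d := by exact_mod_cast h.dim_pos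

theorem one_le_inv : 1 ≤ (1 - p.γ)⁻¹ :=
  (one_le_inv₀ (by linarith [h.discount_lt])).2 (by linarith [h.discount_pos])

/-- All summands are nonnegative, so each is at most the sum. The constant 5 comes from 3, `d ≥ 1`
and 1/(1-γ) ≥ 1; it exceeds e, so the logarithmic factor is at least 1. -/
theorem scale_bounds : 5 ≤ p.scale d ∧ (d : ℝ) ≤ p.scale d ∧ (1 - p.γ)⁻¹ ≤ p.scale d ∧
    p.ω⁻¹ ≤ p.scale d ∧ p.δ⁻¹ ≤ p.scale d ∧ p.L ≤ p.scale d ∧ p.B ≤ p.scale d := by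
  have h1 := h.one_le_dim
  have h2 := h.one_le_inv
  have h3 := inv_pos.2 h.accuracy_pos
  have h4 := inv_pos.2 h.failure_pos
  have h5 := h.feature_nonneg
  have h6 := h.norm_pos
  simp only [Params.scale, one_div]
  refine ⟨?_, ?_, ?_, ?_, ?_, ?_, ?_⟩ <;> linarith

theorem scale_pos : 0 < p.scale d := by linarith [h.scale_bounds.1]

theorem one_le_logFactor : 1 ≤ p.logFactor d := by
  have h1 : Real.exp 1 ≤ p.scale d := by linarith [Real.exp_one_lt_d9, h.scale_bounds.1]
  have := Real.log_le_log (Real.exp_pos 1) h1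
  rwa [Real.log_exp] at this

/-- Polynomial bounds become multiples of the logarithmic factor. The value `x = 0` is needed: `2 /
p.zeta d` vanishes if the horizon or the bound d̃ does, by the conventions for division by zero. -/
theorem log_le {x : ℝ} {n : ℕ} (hx : 0 ≤ x) (hxn : x ≤ p.scale d ^ n) :
    Real.log x ≤ n * p.logFactor d := by
  rcases hx.eq_or_lt with rfl | hx
  · rw [Real.log_zero]
    have := h.one_le_logFactor
    positivity
  · have := Real.log_le_log hx hxn
    rwa [Real.log_pow] at this

theorem lam_pos : 0 < p.lam := div_pos (pow_pos h.accuracy_pos 2) (pow_pos h.norm_pos 2)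

theorem sq_div_lam_le : p.L ^ 2 / p.lam ≤ p.scale d ^ 6 := by
  obtain ⟨-, -, -, h4, -, h6, h7⟩ := h.scale_bounds
  have h0 := h.scale_pos
  have e : p.L ^ 2 / p.lam = p.L ^ 2 * p.ω⁻¹ ^ 2 * p.B ^ 2 := by
    rw [Params.lam]
    field_simp
  rw [e, show p.scale d ^ 6 = p.scale d ^ 2 * p.scale d ^ 2 * p.scale d ^ 2 by ring]
  have a1 := h.feature_nonneg
  have a2 := (inv_pos.2 h.accuracy_pos).le
  have a3 := h.norm_pos.le
  gcongr

/-- From -log γ ≥ 1 - γ, the quotient is at most log(4/(ω(1-γ)))/(1-γ). The argument of the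
logarithm is at most the third power of the scale, as 4 is below the scale; the ceiling costs one
more unit. -/
theorem horizon_le : (p.horizon : ℝ) ≤ 4 * ((1 - p.γ)⁻¹ * p.logFactor d) := by
  obtain ⟨h1, -, h3, h4, -⟩ := h.scale_bounds
  have hg := h.one_le_inv
  have hl := h.one_le_logFactor
  have hγ : 0 < 1 - p.γ := by linarith [h.discount_lt]
  have hlog : 1 - p.γ ≤ -Real.log p.γ := by linarith [Real.log_le_sub_one_of_pos h.discount_pos]
  have hgl : 1 ≤ (1 - p.γ)⁻¹ * p.logFactor d := one_le_mul_of_one_le_of_one_le hg hl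
  have hx : Real.log ((p.ω / 4) * (1 - p.γ)) / Real.log p.γ ≤
      3 * ((1 - p.γ)⁻¹ * p.logFactor d) := by
    have e : Real.log ((p.ω / 4) * (1 - p.γ)) / Real.log p.γ =
        Real.log (4 * p.ω⁻¹ * (1 - p.γ)⁻¹) / (-Real.log p.γ) := by
      rw [← neg_div_neg_eq, ← Real.log_inv]
      congr 2
      rw [mul_inv, inv_div]
      rfl
    have h5 : Real.log (4 * p.ω⁻¹ * (1 - p.γ)⁻¹) ≤ 3 * p.logFactor d := by
      have a2 := (inv_pos.2 h.accuracy_pos).le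
      have := h.log_le (x := 4 * p.ω⁻¹ * (1 - p.γ)⁻¹) (n := 3) (by positivity) (by
        rw [show p.scale d ^ 3 = p.scale d * p.scale d * p.scale d by ring]
        have := h.scale_pos
        gcongr
        linarith)
      exact_mod_cast this
    rw [e, div_le_iff₀ (by linarith)]
    calc Real.log (4 * p.ω⁻¹ * (1 - p.γ)⁻¹) ≤ 3 * p.logFactor d := h5
      _ = 3 * ((1 - p.γ)⁻¹ * p.logFactor d) * (1 - p.γ) := by field_simp
      _ ≤ 3 * ((1 - p.γ)⁻¹ * p.logFactor d) * -Real.log p.γ := by gcongr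
  have h6 : (p.horizon : ℝ) ≤ ⌈3 * ((1 - p.γ)⁻¹ * p.logFactor d)⌉₊ := by
    exact_mod_cast Nat.ceil_le_ceil hx
  have h7 := Nat.ceil_lt_add_one (show 0 ≤ 3 * ((1 - p.γ)⁻¹ * p.logFactor d) by positivity)
  linarith

/-- Taking logarithms in the determinant inequality leaves `N` on both sides, on the right inside a
logarithm. There it is linearized with a slope small enough to be absorbed on the left. -/
theorem length_le_coreBound {S : Type*} {K : ℕ} {φ : S → Fin K → Fin d → ℝ}
    (hL : ∀ s a, ‖WithLp.toLp 2 (φ s a)‖ ≤ p.L) {C : List (S × Fin K)} (hC : Fresh p φ C) :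
    C.length ≤ p.coreBound d := by
  refine Nat.le_floor ?_
  have hpow := hC.pow_length_le h.lam_pos hL
  obtain ⟨h1, h2, -⟩ := h.scale_bounds
  have h0 := h.scale_pos
  have hd := h.one_le_dim
  have hl := h.one_le_logFactor
  set N : ℝ := (C.length : ℝ)
  have hN : 0 ≤ N := Nat.cast_nonneg _
  have hb : d + N * (p.L ^ 2 / p.lam) ≤ (N + 1) * p.scale d ^ 6 := by
    have := mul_le_mul_of_nonneg_left h.sq_div_lam_le hN
    have h3 : (d : ℝ) ≤ p.scale d ^ 6 := h2.trans (le_self_pow₀ (by linarith) (by norm_num))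
    linarith
  have hpos : 0 < d + N * (p.L ^ 2 / p.lam) := by
    have := div_nonneg (sq_nonneg p.L) h.lam_pos.le
    positivity
  have hlog := Real.log_le_log (by positivity) hpow
  rw [Real.log_pow, Real.log_pow] at hlog
  have h4 : Real.log (d + N * (p.L ^ 2 / p.lam)) ≤ Real.log (N + 1) + 6 * p.logFactor d := by
    refine (Real.log_le_log hpos hb).trans ?_
    rw [Real.log_mul (by positivity) (by positivity), Real.log_pow]
    exact le_rfl
  -- This is log x ≤ x - 1 at x = (N + 1)/(4d). The slope 1/(4d) turns into 1/4 after multiplication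
  -- by `d`, and 1/4 is less than log 2.
  have h5 : Real.log (N + 1) ≤ (N + 1) / (4 * d) + 2 * p.logFactor d := by
    have h6 := Real.log_le_sub_one_of_pos (show 0 < (N + 1) / (4 * d) by positivity)
    rw [Real.log_div (by positivity) (by positivity)] at h6
    have h7 := h.log_le (x := 4 * d) (n := 2) (by positivity) (by rw [sq]; gcongr; linarith)
    push_cast at h7
    linarith
  have h8 : (d : ℝ) * Real.log (d + N * (p.L ^ 2 / p.lam)) ≤
      (N + 1) / 4 + 8 * (d * p.logFactor d) := by
    calc (d : ℝ) * Real.log (d + N * (p.L ^ 2 / p.lam))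
        ≤ d * ((N + 1) / (4 * d) + 8 * p.logFactor d) := by gcongr; linarith
      _ = (N + 1) / 4 + 8 * (d * p.logFactor d) := by field_simp
  have h9 : 1 ≤ d * p.logFactor d := one_le_mul_of_one_le_of_one_le hd hl
  -- With log 2 > 0.69, the coefficient of `N` that remains on the left exceeds 0.44, and 8.25/0.44
  -- < 20.
  have h10 := mul_le_mul_of_nonneg_left Real.log_two_gt_d9.le hN
  rw [mul_assoc]
  linarith

theorem coreBound_le : (p.coreBound d : ℝ) ≤ 20 * (d * p.logFactor d) := by
  have := h.one_le_logFactor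
  rw [← mul_assoc]
  exact Nat.floor_le (by positivity)

theorem rollouts_le : (p.rollouts d : ℝ) ≤
    1 + 72 * (((1 - p.γ)⁻¹) ^ 2 * (p.ω ^ 2)⁻¹ * p.logFactor d) := by
  obtain ⟨h1, h2, h3, -, h5, -⟩ := h.scale_bounds
  have h0 := h.scale_pos
  have hd := h.one_le_dim
  have hl := h.one_le_logFactor
  have hlE : p.logFactor d ≤ p.scale d := (Real.log_le_sub_one_of_pos h0).trans (by linarith)
  have hX := h.sq_div_lam_le
  have hX0 : 0 ≤ p.L ^ 2 / p.lam := div_nonneg (sq_nonneg p.L) h.lam_pos.le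
  have hlog0 : 0 ≤ Real.log (1 + 4 * p.L ^ 2 / p.lam) :=
    Real.log_nonneg (by rw [mul_div_assoc]; linarith)
  have hlog1 : Real.log (1 + 4 * p.L ^ 2 / p.lam) ≤ 7 * p.scale d := by
    have := h.log_le (x := 1 + 4 * p.L ^ 2 / p.lam) (n := 7) (by rw [mul_div_assoc]; linarith) (by
      have h6 : 1 ≤ p.scale d ^ 6 := one_le_pow₀ (by linarith)
      have h7 : 5 * p.scale d ^ 6 ≤ p.scale d * p.scale d ^ 6 := by gcongr
      rw [mul_div_assoc, pow_succ' _ 6]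
      linarith)
    push_cast at this
    linarith
  have hδ := (inv_pos.2 h.failure_pos).le
  have hg0 : 0 ≤ (1 - p.γ)⁻¹ := by linarith [h.one_le_inv]
  have hζ : Real.log (2 / p.zeta d) ≤ 9 * p.logFactor d := by
    have e : 2 / p.zeta d = 2 * (p.dTilde d * p.horizon) * p.δ⁻¹ := by
      rw [Params.zeta, div_div_eq_mul_div, div_eq_mul_inv]
    have hT0 : 0 ≤ p.dTilde d := by unfold Params.dTilde; positivity
    have hT : p.dTilde d ≤ 4 * p.scale d * (7 * p.scale d) := by unfold Params.dTilde; gcongr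
    have hH : (p.horizon : ℝ) ≤ 4 * (p.scale d * p.scale d) := h.horizon_le.trans (by gcongr)
    -- The crude bounds give 224 times the fifth power of the scale, and 224 ≤ 5⁴ is at most its
    -- fourth power.
    have := h.log_le (x := 2 / p.zeta d) (n := 9) (by rw [e]; positivity) (by
      calc 2 / p.zeta d = 2 * (p.dTilde d * p.horizon) * p.δ⁻¹ := e
        _ ≤ 2 * (4 * p.scale d * (7 * p.scale d) * (4 * (p.scale d * p.scale d))) * p.scale d := by
          gcongr
        _ = 224 * p.scale d ^ 5 := by ring
        _ ≤ 5 ^ 4 * p.scale d ^ 5 := by gcongr; norm_num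
        _ ≤ p.scale d ^ 4 * p.scale d ^ 5 := by gcongr
        _ = p.scale d ^ 9 := by ring)
    exact_mod_cast this
  have hω := h.accuracy_pos
  have hγ : 0 < 1 - p.γ := by linarith [h.discount_lt]
  -- The constant is 16 · 9 / 2 = 72.
  have hb : ((p.ω / 4) ^ 2)⁻¹ * ((1 - p.γ) ^ 2)⁻¹ * Real.log (2 / p.zeta d) / 2 ≤
      72 * (((1 - p.γ)⁻¹) ^ 2 * (p.ω ^ 2)⁻¹ * p.logFactor d) := by
    calc ((p.ω / 4) ^ 2)⁻¹ * ((1 - p.γ) ^ 2)⁻¹ * Real.log (2 / p.zeta d) / 2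
        ≤ ((p.ω / 4) ^ 2)⁻¹ * ((1 - p.γ) ^ 2)⁻¹ * (9 * p.logFactor d) / 2 := by gcongr
      _ = 72 * (((1 - p.γ)⁻¹) ^ 2 * (p.ω ^ 2)⁻¹ * p.logFactor d) := by
        rw [div_pow, inv_div, inv_pow]
        ring
  have h6 : (p.rollouts d : ℝ) ≤
      ⌈72 * (((1 - p.γ)⁻¹) ^ 2 * (p.ω ^ 2)⁻¹ * p.logFactor d)⌉₊ := by
    exact_mod_cast Nat.ceil_le_ceil hb
  have h7 := Nat.ceil_lt_add_one
    (show 0 ≤ 72 * (((1 - p.γ)⁻¹) ^ 2 * (p.ω ^ 2)⁻¹ * p.logFactor d) by positivity)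
  linarith

end Params.Admissible

end Bounds

/-! ### Memory and computation in terms of the parameters -/

section Costs

/-- A number of memory cells that suffices for the planner. -/
noncomputable def Params.memory (p : Params) (d : ℕ) : ℕ :=
  slot d p.horizon (p.coreBound d) 0 + (6 + 3 * p.coreBound d) + (5 + 3 * p.horizon)

namespace Params.Admissible

variable {p : Params} {d : ℕ} (h : p.Admissible d)
include h

/-- The dominant term is the table of vectors, N(H + 1)(d + 1) cells; it accounts for 20 · 5 · 2 =
200, and the lower-order terms fit into the rest. -/
theorem memory_le :
    (p.memory d : ℝ) ≤ 400 * (d ^ 2 * (1 - p.γ)⁻¹ * p.logFactor d ^ 2) := by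
  have hd := h.one_le_dim
  have hg := h.one_le_inv
  have hl := h.one_le_logFactor
  have hH := h.horizon_le
  have hN := h.coreBound_le
  simp only [Params.memory, slot]
  push_cast
  set g := (1 - p.γ)⁻¹
  set l := p.logFactor d
  have e1 : (1 : ℝ) ≤ d ^ 2 * g * l ^ 2 :=
    one_le_mul_of_one_le_of_one_le (one_le_mul_of_one_le_of_one_le (one_le_pow₀ hd) hg)
      (one_le_pow₀ hl)
  have e2 : d * l ≤ d ^ 2 * g * l ^ 2 := by
    calc d * l = d * 1 * 1 * (l * 1) := by ring
      _ ≤ d * d * g * (l * l) := by gcongr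
      _ = _ := by ring
  have e3 : g * l ≤ d ^ 2 * g * l ^ 2 := by
    calc g * l = 1 * 1 * g * (l * 1) := by ring
      _ ≤ d * d * g * (l * l) := by gcongr
      _ = _ := by ring
  have e4 : (d : ℝ) ≤ d * l := le_mul_of_one_le_right (by linarith) hl
  have e5 : (p.horizon : ℝ) + 1 ≤ 5 * (g * l) := by
    have := one_le_mul_of_one_le_of_one_le hg hl
    linarith
  have e6 : (p.coreBound d : ℝ) * (p.horizon + 1) * (d + 1) ≤ 200 * (d ^ 2 * g * l ^ 2) := by
    calc (p.coreBound d : ℝ) * (p.horizon + 1) * (d + 1)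
        ≤ 20 * (d * l) * (5 * (g * l)) * (d + d) := by gcongr
      _ = _ := by ring
  linarith

/-- This is the cost of a coverage test with a policy evaluation. The sum N + H + 2 is bounded by a
product, with 20 + 4 + 2 = 26, and the two increments by doubling. -/
theorem sweep_le {N K : ℕ} [NeZero K] (hN : N ≤ p.coreBound d) :
    (((N + p.horizon + 2) * ((K + 1) * (d + 1)) : ℕ) : ℝ) ≤
      104 * (d ^ 2 * K * (1 - p.γ)⁻¹ * p.logFactor d) := by
  have hd := h.one_le_dim
  have hg := h.one_le_inv
  have hl := h.one_le_logFactor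
  have hH := h.horizon_le
  have hN' : (N : ℝ) ≤ 20 * (d * p.logFactor d) :=
    (Nat.cast_le.2 hN).trans h.coreBound_le
  have hK : (1 : ℝ) ≤ K := by exact_mod_cast NeZero.one_le
  push_cast
  set g := (1 - p.γ)⁻¹
  set l := p.logFactor d
  have e1 : (1 : ℝ) ≤ d * g * l :=
    one_le_mul_of_one_le_of_one_le (one_le_mul_of_one_le_of_one_le hd hg) hl
  have e2 : d * l ≤ d * g * l := by
    gcongr
    exact le_mul_of_one_le_right (by linarith) hg
  have e3 : g * l ≤ d * g * l := by
    gcongr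
    exact le_mul_of_one_le_left (by linarith) hd
  calc ((N : ℝ) + p.horizon + 2) * ((K + 1) * (d + 1))
      ≤ (26 * (d * g * l)) * ((K + K) * (d + d)) := by gcongr; linarith
    _ = _ := by ring

theorem planTime_le {K : ℕ} [NeZero K] :
    ((40 * (p.horizon + 1) + 100 + (p.coreBound d * (p.horizon + 1) + 1) *
      (5010 * iterationUnit p d K (p.coreBound d)) : ℕ) : ℝ) ≤
    20000000000 * (d ^ 4 * K * ((1 - p.γ) ^ 5)⁻¹ * max (p.ω ^ 2)⁻¹ ((1 - p.γ) ^ 2)) *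
      p.logFactor d ^ 5 := by
  have hd := h.one_le_dim
  have hg := h.one_le_inv
  have hl := h.one_le_logFactor
  have hK : (1 : ℝ) ≤ K := by exact_mod_cast NeZero.one_le
  have hR := h.rollouts_le
  have hγ : 0 < 1 - p.γ := by linarith [h.discount_lt]
  have hω := inv_pos.2 (pow_pos h.accuracy_pos 2)
  have hsweep := h.sweep_le (K := K) le_rfl
  have hunit : (1 - p.γ)⁻¹ ^ 2 * (1 - p.γ) ^ 2 = 1 := by
    rw [← mul_pow, inv_mul_cancel₀ hγ.ne', one_pow]
  have hH := h.horizon_le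
  have hN := h.coreBound_le
  have hm1 := le_max_left (p.ω ^ 2)⁻¹ ((1 - p.γ) ^ 2)
  have hm2 := le_max_right (p.ω ^ 2)⁻¹ ((1 - p.γ) ^ 2)
  rw [← inv_pow]
  simp only [iterationUnit]
  generalize (p.coreBound d + p.horizon + 2) * ((K + 1) * (d + 1)) = W at hsweep ⊢
  push_cast
  set g := (1 - p.γ)⁻¹
  set l := p.logFactor d
  set m := max (p.ω ^ 2)⁻¹ ((1 - p.γ) ^ 2)
  have hm : 0 < m := hω.trans_le hm1
  -- The second term of the maximum is there for this purpose: at least one rollout is allowed for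
  -- even if ω is large, and 1 = (1-γ)⁻²(1-γ)² absorbs it.
  have hgm : 1 ≤ g ^ 2 * m := by
    rw [← hunit]
    gcongr
  have hgml : 1 ≤ g ^ 2 * m * l := one_le_mul_of_one_le_of_one_le hgm hl
  have hgl : 1 ≤ g * l := one_le_mul_of_one_le_of_one_le hg hl
  have e1 : (p.rollouts d : ℝ) + 1 ≤ 74 * (g ^ 2 * m * l) := by
    have : g ^ 2 * (p.ω ^ 2)⁻¹ * l ≤ g ^ 2 * m * l := by gcongr
    linarith
  have e2 : (p.horizon : ℝ) + 1 ≤ 5 * (g * l) := by linarith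
  have e3 : (p.coreBound d : ℝ) * (p.horizon + 1) + 1 ≤ 101 * (d * g * l ^ 2) := by
    have h1 : (p.coreBound d : ℝ) * (p.horizon + 1) ≤ 20 * (d * l) * (5 * (g * l)) := by gcongr
    have h2 : (1 : ℝ) ≤ d * g * l ^ 2 :=
      one_le_mul_of_one_le_of_one_le (one_le_mul_of_one_le_of_one_le hd hg) (one_le_pow₀ hl)
    linarith
  have e4 : g * l ≤ d ^ 4 * K * g ^ 5 * m * l ^ 5 := by
    have h1 : (1 : ℝ) ≤ d ^ 4 * K := one_le_mul_of_one_le_of_one_le (one_le_pow₀ hd) hK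
    have h2 : 1 ≤ g ^ 2 * (g ^ 2 * m) := one_le_mul_of_one_le_of_one_le (one_le_pow₀ hg) hgm
    calc g * l = 1 * 1 * (g * (l * 1)) := by ring
      _ ≤ d ^ 4 * K * (g ^ 2 * (g ^ 2 * m)) * (g * (l * l ^ 4)) := by
        gcongr
        exact one_le_pow₀ hl
      _ = _ := by ring
  -- The implementation needs only the third power of `d`; the stated fourth power is slack.
  have e5 : (d : ℝ) ^ 3 ≤ d ^ 4 := pow_le_pow_right₀ hd (by norm_num)
  calc 40 * ((p.horizon : ℝ) + 1) + 100 + (p.coreBound d * (p.horizon + 1) + 1) *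
        (5010 * ((p.rollouts d + 1) * ((p.horizon + 1) * W)))
      ≤ 300 * (g * l) + 101 * (d * g * l ^ 2) * (5010 * (74 * (g ^ 2 * m * l) *
        (5 * (g * l) * (104 * (d ^ 2 * K * g * l))))) := by
        gcongr
        linarith
    _ = 300 * (g * l) + 19471264800 * (d ^ 3 * (K * g ^ 5 * m * l ^ 5)) := by ring
    _ ≤ 300 * (d ^ 4 * K * g ^ 5 * m * l ^ 5) +
        19471264800 * (d ^ 4 * (K * g ^ 5 * m * l ^ 5)) := by gcongr
    _ = 19471265100 * (d ^ 4 * K * g ^ 5 * m * l ^ 5) := by ring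
    _ ≤ 20000000000 * (d ^ 4 * K * g ^ 5 * m * l ^ 5) := by gcongr; norm_num
    _ = _ := by ring

end Params.Admissible

end Costs

end CAPI

/-! ### The theorem -/

theorem theorem2 :
    ∃ (plan act : CAPI.Cmd) (c : ℝ) (k : ℕ),
      ∀ (S : Type*) (d K : ℕ) [NeZero d] [NeZero K] (p : CAPI.Params) (acc : CAPI.Access S d K)
        (s₀ : S),
        0 < p.γ → p.γ < 1 → 0 < p.ω → 0 < p.δ → p.δ ≤ 1 → 0 < p.B →
        (∀ s a, ‖WithLp.toLp 2 (acc.feature s a)‖ ≤ p.L) →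
        ∃ (π : S → Fin K) (tr : List (S × Fin K)) (σ : CAPI.Store S K) (M T M₀ : ℕ),
          -- the planner returns `π`, and the program `plan` performs this run
          CAPI.PlanReturns p acc s₀ π tr ∧
          CAPI.Exec acc M plan (CAPI.Store.planInput d K p s₀) σ T ∧
          σ.trace = tr ∧
          -- memory and computation of running the planner
          (M : ℝ) ≤ c * (d ^ 2 / (1 - p.γ)) * p.logFactor d ^ k ∧
          (T : ℝ) ≤ c * (d ^ 4 * K * ((1 - p.γ) ^ 5)⁻¹ * max (p.ω ^ 2)⁻¹ ((1 - p.γ) ^ 2)) *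
            p.logFactor d ^ k ∧
          -- memory for storing the output policy
          (M₀ : ℝ) ≤ c * (d ^ 2 / (1 - p.γ)) * p.logFactor d ^ k ∧
          -- evaluation of the stored policy by the program `act`, without simulator calls
          ∀ s : S, ∃ (σ' : CAPI.Store S K) (M₁ T₁ : ℕ),
            CAPI.Exec acc M₁ act (CAPI.Store.policyInput σ M₀ s) σ' T₁ ∧
            σ'.idx 0 = (π s : ℕ) ∧ σ'.trace = [] ∧
            (M₁ : ℝ) ≤ c * (d ^ 2 / (1 - p.γ)) * p.logFactor d ^ k ∧
            (T₁ : ℝ) ≤ c * (d ^ 3 * K / (1 - p.γ)) * p.logFactor d ^ k := by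
  refine ⟨CAPI.planCmd, CAPI.actCmd, 20000000000, 5, ?_⟩
  intro S d K _ _ p acc s₀ hγ₀ hγ₁ hω hδ _ hB hL
  have h : p.Admissible d :=
    ⟨NeZero.one_le, hγ₀, hγ₁, hω, hδ, (norm_nonneg _).trans (hL s₀ 0), hB⟩
  have hfresh : ∀ C, CAPI.Fresh p acc.feature C → C.length ≤ p.coreBound d :=
    fun C hC => h.length_le_coreBound hL hC
  have hl := h.one_le_logFactor
  have hg := h.one_le_inv
  have hd := h.one_le_dim
  have hMem : (p.memory d : ℝ) ≤ 20000000000 * (d ^ 2 / (1 - p.γ)) * p.logFactor d ^ 5 := by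
    refine h.memory_le.trans ?_
    rw [div_eq_mul_inv, mul_assoc 20000000000]
    gcongr <;> norm_num
  obtain ⟨σ, T, hexec, hT, x, y, hret, hrep, hall⟩ := CAPI.planCmd_runs (s₀ := s₀) h.lam_pos hfresh
    (M := p.memory d) (by unfold CAPI.Params.memory; omega)
    (by unfold CAPI.Params.memory; omega) (by unfold CAPI.Params.memory; omega)
  refine ⟨x.pol p.horizon, σ.trace, σ, p.memory d, T, p.memory d, hret, hexec, rfl, hMem,
    (Nat.cast_le.2 hT).trans h.planTime_le, hMem, fun s => ?_⟩
  have hy := hfresh _ hrep.track.fresh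
  have hslot : CAPI.slot d p.horizon y.C.length 0 ≤ CAPI.slot d p.horizon (p.coreBound d) 0 := by
    unfold CAPI.slot
    gcongr
  obtain ⟨σ', T₁, hexec₁, hT₁, hact, htr⟩ := CAPI.actCmd_runs (M := p.memory d) h.lam_pos hrep hall
    (by unfold CAPI.Params.memory; omega) (by unfold CAPI.Params.memory; omega) s
  refine ⟨σ', p.memory d, T₁, hexec₁, hact, htr, hMem, ?_⟩
  have hsweep := h.sweep_le (K := K) hy
  calc (T₁ : ℝ)
      ≤ 800 * (((y.C.length + p.horizon + 2) * ((K + 1) * (d + 1)) : ℕ) : ℝ) := by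
        exact_mod_cast hT₁
    _ ≤ 800 * (104 * (d ^ 2 * K * (1 - p.γ)⁻¹ * p.logFactor d ^ 1)) := by
        rw [pow_one]
        gcongr
    -- Here too one power of `d` is given away: evaluation is quadratic in the dimension, up to
    -- logarithms.
    _ ≤ 20000000000 * (d ^ 3 * K * (1 - p.γ)⁻¹ * p.logFactor d ^ 5) := by
        rw [← mul_assoc 800]
        gcongr <;> norm_num
    _ = 20000000000 * (d ^ 3 * K / (1 - p.γ)) * p.logFactor d ^ 5 := by
        rw [div_eq_mul_inv]
        ring
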